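/- Let $\Lambda_n$ be the $n\times n$ square lattice with $4n$ additional boundary edges, so that every one of its $n^2$ vertices has degree $4$. A boundary condition $\xi_n$ prescribes the orientation of each of the $4n$ boundary edges, and $\Omega_{\xi_n}$ is the set of orientations of all the edges of $\Lambda_n$ that agree with $\xi_n$ and have two incoming and two outgoing edges at every vertex. Call a horizontal edge positive if it points east and a vertical edge positive if it points north. A vertex has weight $a$ if its four edges are all positive or all negative; weight $b$ if its two horizontal edges have one common sign and its two vertical edges have the other; and weight $c$ if its two horizontal edges have opposite signs and its two vertical edges have opposite signs. Let $\pi(x)$ be proportional to the product of the vertex weights of $x\in\Omega_{\xi_n}$. Single-site Glauber dynamics on $\Omega_{\xi_n}$ chooses one of the $(n-1)^2$ internal cells uniformly at random and, if the four edges that bound it form a directed cycle, proposes to reverse them; the move from $x$ to $y$ is accepted with the Metropolis--Hastings probability $\min(1,\pi(y)/\pi(x))$, and otherwise the chain stays at $x$. Let $P$ be its transition matrix and let $\tau(1/4)$ be the least $t\ge 0$ such that $\max_{x}\frac12\sum_y |P^t(x,y)-\pi(y)|\le 1/4$. **Theorem.** For all real $a,b,c>0$ such that $a>b+c$ or $b>a+c$,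 there are boundary conditions $\xi_n$ on $\Lambda_n$ $(n\ge 0)$ and a constant $\delta>0$ such that, for all sufficiently large $n$, the set $\Omega_{\xi_n}$ is nonempty and Glauber dynamics on it is ergodic (irreducible and aperiodic), and its mixing time satisfies $\tau(1/4)=\Omega(\exp(n^{\delta}))$ as $n\to\infty$. -/

import Mathlib

/-! Six-vertex model on the `n × n` lattice with fixed boundary conditions, and its
single-site (Metropolis) Glauber dynamics. -/

open scoped ENNReal

namespace SixVertex

/-- An orientation of all the edges of the `n × n` lattice with its `4n` additional boundary
edges, so that every vertex `(i, j)` (column `i`, row `j`) has degree 4. -/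
structure Orientation (n : ℕ) where
  /-- The horizontal edges of row `j`, numbered from left to right: `hor i j` is the edge to the
  left of vertex `(i, j)` and `hor (i + 1) j` the edge to its right.
  `true` means directed east, `false` means directed west. -/
  hor : Fin (n + 1) → Fin n → Bool
  /-- The vertical edges of column `i`, numbered from bottom to top: `ver i j` is the edge below
  vertex `(i, j)` and `ver i (j + 1)` the edge above it.
  `true` means directed north, `false` means directed south. -/
  ver : Fin n → Fin (n + 1) → Bool
deriving DecidableEq, Fintype

namespace Orientation

variable {n : ℕ}

/-- The edge to the left of vertex `(i, j)`. -/
def left (x : Orientation n) (i j : Fin n) : Bool := x.hor i.castSucc j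

/-- The edge to the right of vertex `(i, j)`. -/
def right (x : Orientation n) (i j : Fin n) : Bool := x.hor i.succ j

/-- The edge below vertex `(i, j)`. -/
def below (x : Orientation n) (i j : Fin n) : Bool := x.ver i j.castSucc

/-- The edge above vertex `(i, j)`. -/
def above (x : Orientation n) (i j : Fin n) : Bool := x.ver i j.succ

/-- The number of edges directed into vertex `(i, j)`. -/
def inDegree (x : Orientation n) (i j : Fin n) : ℕ :=
  (x.left i j).toNat + (!x.right i j).toNat + (x.below i j).toNat + (!x.above i j).toNat

/-- Each of the `n²` vertices (of degree 4) has two incoming and hence two outgoing edges. -/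
def IsEulerian (x : Orientation n) : Prop := ∀ i j, x.inDegree i j = 2

end Orientation

/-- Boltzmann weight of a vertex whose left, right, lower and upper edges are oriented as `l`,
`r`, `d`, `u` (`true` for east or north): `a` for the two types in which both lines go straight
and point both positively or both negatively, `b` for the two other types in which both lines go
straight, and `c` for the two types in which both lines reverse direction. The value at the ten
orientations that violate the two-in two-out rule is never used. -/
def vertexWeight (a b c : ℝ) (l r d u : Bool) : ℝ :=
  match l, r, d, u with
  | true, true, true, true => a
  | false, false, false, false => a
  | true, true, false, false => b
  | false, false, true, true => b
  | true, false, false, true => c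
  | false, true, true, false => c
  | _, _, _, _ => 0

/-- A boundary condition: an orientation of each of the `4n` boundary edges. -/
structure BoundaryCondition (n : ℕ) where
  /-- The leftmost horizontal edge of each row. -/
  left : Fin n → Bool
  /-- The rightmost horizontal edge of each row. -/
  right : Fin n → Bool
  /-- The lowest vertical edge of each column. -/
  bottom : Fin n → Bool
  /-- The highest vertical edge of each column. -/
  top : Fin n → Bool

/-- `x` agrees with the boundary condition on all the boundary edges. -/
def Orientation.Agrees {n : ℕ} (x : Orientation n) (ξ : BoundaryCondition n) : Prop :=
  (∀ j, x.hor 0 j = ξ.left j) ∧ (∀ j, x.hor (Fin.last n) j = ξ.right j) ∧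
    (∀ i, x.ver i 0 = ξ.bottom i) ∧ (∀ i, x.ver i (Fin.last n) = ξ.top i)

/-- The state space: Eulerian orientations that satisfy the boundary condition. -/
def State {n : ℕ} (ξ : BoundaryCondition n) : Type :=
  {x : Orientation n // x.IsEulerian ∧ x.Agrees ξ}

noncomputable instance {n : ℕ} (ξ : BoundaryCondition n) : DecidableEq (State ξ) :=
  Classical.decEq _

noncomputable instance {n : ℕ} (ξ : BoundaryCondition n) : Fintype (State ξ) := by
  classical exact inferInstanceAs (Fintype {x : Orientation n // x.IsEulerian ∧ x.Agrees ξ})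

/-- The Boltzmann weight of an orientation, the product of its vertex weights. -/
noncomputable def weight (a b c : ℝ) {n : ℕ} (x : Orientation n) : ℝ :=
  ∏ i, ∏ j, vertexWeight a b c (x.left i j) (x.right i j) (x.below i j) (x.above i j)

/-- The partition function. -/
noncomputable def partitionFunction (a b c : ℝ) {n : ℕ} (ξ : BoundaryCondition n) : ℝ :=
  ∑ x : State ξ, weight a b c x.1

/-- The Boltzmann distribution. -/
noncomputable def gibbs (a b c : ℝ) {n : ℕ} (ξ : BoundaryCondition n) (x : State ξ) : ℝ :=
  weight a b c x.1 / partitionFunction a b c ξ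

/-- The internal cells of the lattice: cell `(i, j)` is the unit square with corners
`(i, j)`, `(i + 1, j)`, `(i, j + 1)`, `(i + 1, j + 1)`. -/
abbrev Cell (n : ℕ) : Type := Fin (n - 1) × Fin (n - 1)

section Cells

variable {n : ℕ}

/-- The smaller of the two vertex coordinates of a cell. -/
def lo (i : Fin (n - 1)) : Fin n := ⟨i, by omega⟩

/-- The larger of the two vertex coordinates of a cell. -/
def hi (i : Fin (n - 1)) : Fin n := ⟨i + 1, by omega⟩

/-- The index of the edges that join the vertices with coordinates `lo i` and `hi i`. -/
def mid (i : Fin (n - 1)) : Fin (n + 1) := ⟨i + 1, by omega⟩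

/-- The four edges that bound the cell form a directed cycle
(counterclockwise or clockwise). -/
def Orientation.IsCycle (x : Orientation n) (q : Cell n) : Prop :=
  (x.hor (mid q.1) (lo q.2) = true ∧ x.ver (hi q.1) (mid q.2) = true ∧
    x.hor (mid q.1) (hi q.2) = false ∧ x.ver (lo q.1) (mid q.2) = false) ∨
  (x.hor (mid q.1) (lo q.2) = false ∧ x.ver (hi q.1) (mid q.2) = false ∧
    x.hor (mid q.1) (hi q.2) = true ∧ x.ver (lo q.1) (mid q.2) = true)

/-- Reverse the four edges that bound the cell. -/
def Orientation.flip (x : Orientation n) (q : Cell n) : Orientation n where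
  hor i j := if i = mid q.1 ∧ (j = lo q.2 ∨ j = hi q.2) then !x.hor i j else x.hor i j
  ver i j := if (i = lo q.1 ∨ i = hi q.1) ∧ j = mid q.2 then !x.ver i j else x.ver i j

end Cells

open Classical in
/-- The probability that the dynamics in state `x` picks a cell (uniformly at random) whose
reversal turns `x` into `y`, the boundary of the cell being a cycle, and accepts the move with the
Metropolis-Hastings probability `min 1 (π y / π x)`. -/
noncomputable def moveProb (a b c : ℝ) {n : ℕ} (ξ : BoundaryCondition n) (x y : State ξ) : ℝ :=
  ∑ q : Cell n, if x.1.IsCycle q ∧ y.1 = x.1.flip q then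
    (1 / (Fintype.card (Cell n) : ℝ)) * min 1 (gibbs a b c ξ y / gibbs a b c ξ x) else 0

/-- The transition matrix of Glauber dynamics: with the remaining probability, the chain stays. -/
noncomputable def glauber (a b c : ℝ) {n : ℕ} (ξ : BoundaryCondition n) :
    Matrix (State ξ) (State ξ) ℝ :=
  fun x y => if x = y then 1 - ∑ z ∈ Finset.univ.erase x, moveProb a b c ξ x z
    else moveProb a b c ξ x y

end SixVertex

/-- Total variation distance between two distributions on a finite set. -/
noncomputable def tvDist {Ω : Type*} [Fintype Ω] (μ ν : Ω → ℝ) : ℝ :=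
  (1 / 2) * ∑ x, |μ x - ν x|

/-- The mixing time `τ(1/4)` of the chain with transition matrix `P` and stationary distribution
`π`: the least `t` with `max_x ‖P^t(x, ·) - π‖ ≤ 1/4` (`⊤` if there is none). -/
noncomputable def mixingTime {Ω : Type*} [Fintype Ω] [DecidableEq Ω]
    (P : Matrix Ω Ω ℝ) (π : Ω → ℝ) : ℕ∞ :=
  ⨅ t ∈ {t : ℕ | ∀ x, tvDist ((P ^ t) x) π ≤ 1 / 4}, (t : ℕ∞)

/-! ### Finite Markov chains -/

section MarkovChains

variable {Ω : Type*} [Fintype Ω] [DecidableEq Ω]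

/-! By the two-in two-out rule the positive edges form lines that run north and east through an
all-negative background of weight `a`. A vertex on a single line contributes, relative to `a`, a
factor β = b/a if the line goes straight and γ = c/a if it turns. A vertex shared by two lines has
four positive edges and weight `a` again. Take first a > b + c, so that β + γ < 1: a lone line is
expensive, and lines that run side by side are cheap.

The boundary condition `combBoundary` sends a constant number K of lines into the square on the
left, at distance s (a constant fraction of n) from each other, and lets each leave at the top at
the far end of its own diagonal. The bottleneck set `separatedStates` asks that every line stay
within D = s/2 of its diagonal. There the lines are disjoint, so the weight factors exactly into
one-line path sums (`sum_separatedStates`). Each path is a persistent random walk. Pinning its end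
to the diagonal costs only a polynomial factor (`le_sum_diagonalPaths`), whereas a deviation of
order n has exponentially small weight (`sum_not_isNarrow_le`). Since a reversal moves a line by at
most one step, every state on the inner boundary has a line with such a deviation, so the inner
boundary is negligible relative to the set.

For the complement one state suffices: `bundleState`, where all lines meet in a solid strip of width
K along the main diagonal. Inside the strip every vertex has weight `a`, and at most 3n vertices are
not of weight `a`, whatever K is (`card_bundleHeight_le`, `le_weight_bundleState`). The separated
states weigh at most a^(n²) (β + γ)^(Kn) in total, so a large K makes them lighter than this one
state (`eventually_hasBottleneck`).

A bottleneck bounds the mixing time from below by stationarity and reversibility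
(`le_of_tvDist_le_of_bottleneck`). Irreducibility comes from height functions: two states with the
same boundary can be moved towards each other one face at a time (`exists_flip_heightDist_lt`). The
case b > a + c follows by a left-right reflection, which exchanges `a` and `b`
(`HasBottleneck.reflect`). -/

theorem matrix_pow_apply_nonneg {P : Matrix Ω Ω ℝ} (hP : ∀ x y, 0 ≤ P x y) (t : ℕ) (x y : Ω) :
    0 ≤ (P ^ t) x y := by
  induction t generalizing x y with
  | zero => by_cases h : x = y <;> simp [h]
  | succ t ih =>
    rw [pow_succ, Matrix.mul_apply]
    exact Finset.sum_nonneg fun z _ => mul_nonneg (ih x z) (hP z y)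

theorem matrix_pow_apply_pos_of_mul {P : Matrix Ω Ω ℝ} (hP : ∀ x y, 0 ≤ P x y) {s t : ℕ}
    {x y z : Ω} (h₁ : 0 < (P ^ s) x y) (h₂ : 0 < (P ^ t) y z) : 0 < (P ^ (s + t)) x z := by
  rw [pow_add, Matrix.mul_apply]
  refine lt_of_lt_of_le (mul_pos h₁ h₂) ?_
  exact Finset.single_le_sum (f := fun w => (P ^ s) x w * (P ^ t) w z)
    (fun w _ => mul_nonneg (matrix_pow_apply_nonneg hP s x w) (matrix_pow_apply_nonneg hP t w z))
    (Finset.mem_univ y)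

theorem exists_matrix_pow_pos_of_reflTransGen {P : Matrix Ω Ω ℝ} (hP : ∀ x y, 0 ≤ P x y)
    {x y : Ω} (h : Relation.ReflTransGen (fun x y => 0 < P x y) x y) :
    ∃ t, 0 < (P ^ t) x y := by
  induction h with
  | refl => exact ⟨0, by simp⟩
  | tail _ hyz ih =>
    obtain ⟨t, ht⟩ := ih
    exact ⟨t + 1, matrix_pow_apply_pos_of_mul hP ht (by simpa using hyz)⟩

/-- A nonnegative matrix whose graph is strongly connected and has a loop is primitive. -/
theorem isPrimitive_of_connected_of_loop {P : Matrix Ω Ω ℝ} (hP : ∀ x y, 0 ≤ P x y)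
    (hconn : ∀ x y, Relation.ReflTransGen (fun x y => 0 < P x y) x y) {w : Ω}
    (hw : 0 < P w w) : P.IsPrimitive := by
  refine ⟨hP, ?_⟩
  choose d hd using fun x y => exists_matrix_pow_pos_of_reflTransGen hP (hconn x y)
  have hloop : ∀ k, 0 < (P ^ k) w w := by
    intro k
    induction k with
    | zero => simp
    | succ k ih => exact matrix_pow_apply_pos_of_mul hP ih (by simpa using hw)
  obtain ⟨M, hM⟩ : ∃ M, ∀ x y, d x y ≤ M := by
    refine ⟨∑ x, ∑ y, d x y, fun x y => ?_⟩
    exact (Finset.single_le_sum (f := fun y => d x y) (fun _ _ => Nat.zero_le _)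
      (Finset.mem_univ y)).trans (Finset.single_le_sum (f := fun x => ∑ y, d x y)
        (fun _ _ => Nat.zero_le _) (Finset.mem_univ x))
  -- Every pair is joined through `w` in at most 2M steps, and loops at `w` pad the length. The
  -- extra 1 keeps the exponent positive even if M = 0.
  refine ⟨2 * M + 1, by omega, fun x y => ?_⟩
  have h := matrix_pow_apply_pos_of_mul hP
    (matrix_pow_apply_pos_of_mul hP (hd x w) (hloop (2 * M + 1 - d x w - d w y))) (hd w y)
  have h₁ := hM x w
  have h₂ := hM w y
  rwa [show d x w + (2 * M + 1 - d x w - d w y) + d w y = 2 * M + 1 by omega] at h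

theorem matrix_pow_row_sum {P : Matrix Ω Ω ℝ} (hrow : ∀ x, ∑ y, P x y = 1) (t : ℕ) (x : Ω) :
    ∑ y, (P ^ t) x y = 1 := by
  induction t with
  | zero => simp [Matrix.one_apply]
  | succ t ih =>
    simp_rw [pow_succ, Matrix.mul_apply]
    rw [Finset.sum_comm]
    simp_rw [← Finset.mul_sum, hrow, mul_one, ih]

theorem sum_sub_le_tvDist {μ ν : Ω → ℝ} (hμ : ∑ x, μ x = 1) (hν : ∑ x, ν x = 1)
    (A : Finset Ω) : ∑ x ∈ A, ν x - ∑ x ∈ A, μ x ≤ tvDist μ ν := by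
  have e₁ : ∑ x ∈ A, (ν x - μ x) + ∑ x ∈ Aᶜ, (ν x - μ x) = 0 := by
    rw [Finset.sum_add_sum_compl, Finset.sum_sub_distrib, hμ, hν, sub_self]
  have e₂ : ∑ x ∈ A, |μ x - ν x| + ∑ x ∈ Aᶜ, |μ x - ν x| = ∑ x, |μ x - ν x| :=
    Finset.sum_add_sum_compl _ _
  have h₁ : ∑ x ∈ A, (ν x - μ x) ≤ ∑ x ∈ A, |μ x - ν x| :=
    Finset.sum_le_sum fun x _ => by rw [abs_sub_comm]; exact le_abs_self _
  have h₂ : -∑ x ∈ Aᶜ, (ν x - μ x) ≤ ∑ x ∈ Aᶜ, |μ x - ν x| := by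
    rw [← Finset.sum_neg_distrib]
    exact Finset.sum_le_sum fun x _ => by rw [neg_sub]; exact le_abs_self _
  rw [← Finset.sum_sub_distrib, tvDist]
  linarith

/-- In `t` steps of a stationary chain, the flow out of a set is at most `t` times the flow in
one step. -/
theorem flow_pow_le {P : Matrix Ω Ω ℝ} {π : Ω → ℝ} (hP : ∀ x y, 0 ≤ P x y)
    (hrow : ∀ x, ∑ y, P x y = 1) (hπ : ∀ x, 0 ≤ π x)
    (hstat : ∀ y, ∑ x, π x * P x y = π y) (S : Finset Ω) (t : ℕ) :
    ∑ x ∈ S, ∑ y ∈ Sᶜ, π x * (P ^ t) x y ≤ t * ∑ x ∈ S, ∑ y ∈ Sᶜ, π x * P x y := by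
  have hstat' : ∀ t y, ∑ x, π x * (P ^ t) x y = π y := by
    intro t
    induction t with
    | zero => intro y; simp [Matrix.one_apply]
    | succ t ih =>
      intro y
      simp_rw [pow_succ, Matrix.mul_apply, Finset.mul_sum]
      rw [Finset.sum_comm]
      simp_rw [← mul_assoc, ← Finset.sum_mul, ih, hstat]
  have hpow := matrix_pow_apply_nonneg hP
  induction t with
  | zero =>
    simp only [pow_zero, CharP.cast_eq_zero, zero_mul]
    refine le_of_eq (Finset.sum_eq_zero fun x hx => Finset.sum_eq_zero fun y hy => ?_)
    have : x ≠ y := by rintro rfl; exact (Finset.mem_compl.1 hy) hx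
    simp [this]
  | succ t ih =>
    -- Split according to the state z after t steps. If z lies in S, the last step is a one-step
    -- exit and stationarity bounds the mass at z by π z. Otherwise the exit has already been
    -- counted for t.
    have hsplit : ∑ x ∈ S, ∑ y ∈ Sᶜ, π x * (P ^ (t + 1)) x y =
        (∑ z ∈ S, (∑ x ∈ S, π x * (P ^ t) x z) * ∑ y ∈ Sᶜ, P z y) +
        ∑ z ∈ Sᶜ, (∑ x ∈ S, π x * (P ^ t) x z) * ∑ y ∈ Sᶜ, P z y := by
      rw [Finset.sum_add_sum_compl]
      simp_rw [Finset.sum_mul_sum, pow_succ, Matrix.mul_apply, Finset.mul_sum, ← mul_assoc]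
      rw [Finset.sum_comm (s := Finset.univ)]
      exact Finset.sum_congr rfl fun x _ => Finset.sum_comm
    have h₁ : ∑ z ∈ S, (∑ x ∈ S, π x * (P ^ t) x z) * ∑ y ∈ Sᶜ, P z y ≤
        ∑ x ∈ S, ∑ y ∈ Sᶜ, π x * P x y := by
      refine Finset.sum_le_sum fun z _ => ?_
      rw [← Finset.mul_sum]
      refine mul_le_mul_of_nonneg_right ?_ (Finset.sum_nonneg fun y _ => hP z y)
      rw [← hstat' t z]
      exact Finset.sum_le_sum_of_subset_of_nonneg (Finset.subset_univ _)
        fun x _ _ => mul_nonneg (hπ x) (hpow t x z)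
    have h₂ : ∑ z ∈ Sᶜ, (∑ x ∈ S, π x * (P ^ t) x z) * ∑ y ∈ Sᶜ, P z y ≤
        ∑ x ∈ S, ∑ y ∈ Sᶜ, π x * (P ^ t) x y := by
      rw [Finset.sum_comm (s := S)]
      refine Finset.sum_le_sum fun z _ => ?_
      refine mul_le_of_le_one_right
        (Finset.sum_nonneg fun x _ => mul_nonneg (hπ x) (hpow t x z)) ?_
      rw [← hrow z]
      exact Finset.sum_le_sum_of_subset_of_nonneg (Finset.subset_univ _) fun y _ _ => hP z y
    rw [hsplit]
    push_cast
    linarith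

/-- A bottleneck of a reversible chain forces a large mixing time. -/
theorem le_of_tvDist_le_of_bottleneck {P : Matrix Ω Ω ℝ} {π : Ω → ℝ} (hP : ∀ x y, 0 ≤ P x y)
    (hrow : ∀ x, ∑ y, P x y = 1) (hπ : ∀ x, 0 < π x) (hsum : ∑ x, π x = 1)
    (hrev : ∀ x y, π x * P x y = π y * P y x) {S : Finset Ω} (hS : S.Nonempty)
    (hS' : Sᶜ.Nonempty) {ε : ℝ} (hε : 0 < ε)
    (h₁ : ∑ x ∈ S, ∑ y ∈ Sᶜ, π x * P x y ≤ ε * ∑ x ∈ S, π x)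
    (h₂ : ∑ x ∈ S, ∑ y ∈ Sᶜ, π x * P x y ≤ ε * ∑ x ∈ Sᶜ, π x) {t : ℕ}
    (ht : ∀ x, tvDist ((P ^ t) x) π ≤ 1 / 4) : 1 / (4 * ε) ≤ t := by
  have hstat : ∀ y, ∑ x, π x * P x y = π y := by
    intro y
    simp_rw [fun x => hrev x y, ← Finset.mul_sum, hrow, mul_one]
  -- If the complement of T has mass at least 1/2, a chain mixed to within 1/4 is outside T with
  -- probability at least 1/4 from every start, so the t-step flow out of T is at least π(T)/4. One
  -- of S and its complement can serve as T, and reversibility makes their flows equal.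
  have key : ∀ T : Finset Ω, T.Nonempty → 1 / 2 ≤ ∑ x ∈ Tᶜ, π x →
      ∑ x ∈ T, ∑ y ∈ Tᶜ, π x * P x y ≤ ε * ∑ x ∈ T, π x → 1 / (4 * ε) ≤ t := by
    intro T hT hhalf hflow
    have hpos : 0 < ∑ x ∈ T, π x := Finset.sum_pos (fun x _ => hπ x) hT
    have hlow : (∑ x ∈ T, π x) * (1 / 4) ≤ ∑ x ∈ T, ∑ y ∈ Tᶜ, π x * (P ^ t) x y := by
      rw [Finset.sum_mul]
      refine Finset.sum_le_sum fun x _ => ?_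
      rw [← Finset.mul_sum]
      refine mul_le_mul_of_nonneg_left ?_ (hπ x).le
      have := sum_sub_le_tvDist (matrix_pow_row_sum hrow t x) hsum Tᶜ
      linarith [ht x]
    have hup := flow_pow_le hP hrow (fun x => (hπ x).le) hstat T t
    have hmul : (t : ℝ) * ∑ x ∈ T, ∑ y ∈ Tᶜ, π x * P x y ≤ t * (ε * ∑ x ∈ T, π x) :=
      mul_le_mul_of_nonneg_left hflow (Nat.cast_nonneg t)
    have hfin : (∑ x ∈ T, π x) * (1 / 4) ≤ (∑ x ∈ T, π x) * (t * ε) := by linarith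
    have h4 := le_of_mul_le_mul_left hfin hpos
    rw [div_le_iff₀ (by positivity)]
    linarith
  have hcompl : ∑ x ∈ S, π x + ∑ x ∈ Sᶜ, π x = 1 := by rw [Finset.sum_add_sum_compl, hsum]
  rcases le_total (1 / 2) (∑ x ∈ Sᶜ, π x) with h | h
  · exact key S hS h h₁
  · refine key Sᶜ hS' (by rw [compl_compl]; linarith) ?_
    rw [compl_compl, Finset.sum_comm]
    simp_rw [fun x y => hrev y x]
    exact h₂

end MarkovChains

/-! ### Edges indexed by natural numbers, and reversals of cells -/

namespace SixVertex

namespace Orientation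

variable {n : ℕ}

/-- The horizontal edges, indexed by natural numbers (`false` outside of the lattice). -/
def horN (x : Orientation n) (i j : ℕ) : Bool :=
  if h : i < n + 1 ∧ j < n then x.hor ⟨i, h.1⟩ ⟨j, h.2⟩ else false

/-- The vertical edges, indexed by natural numbers (`false` outside of the lattice). -/
def verN (x : Orientation n) (i j : ℕ) : Bool :=
  if h : i < n ∧ j < n + 1 then x.ver ⟨i, h.1⟩ ⟨j, h.2⟩ else false

theorem horN_val (x : Orientation n) (i : Fin (n + 1)) (j : Fin n) : x.horN i j = x.hor i j :=
  dif_pos ⟨i.2, j.2⟩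

theorem verN_val (x : Orientation n) (i : Fin n) (j : Fin (n + 1)) : x.verN i j = x.ver i j :=
  dif_pos ⟨i.2, j.2⟩

theorem ext_nat {x y : Orientation n} (hh : ∀ i j, i < n + 1 → j < n → x.horN i j = y.horN i j)
    (hv : ∀ i j, i < n → j < n + 1 → x.verN i j = y.verN i j) : x = y := by
  cases x with | mk xh xv =>
  cases y with | mk yh yv =>
  congr 1
  · funext i j
    have := hh i j i.2 j.2
    simpa only [horN_val] using this
  · funext i j
    have := hv i j i.2 j.2
    simpa only [verN_val] using this

theorem left_eq (x : Orientation n) (i j : Fin n) : x.left i j = x.horN i j := by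
  rw [left, ← horN_val]; rfl

theorem right_eq (x : Orientation n) (i j : Fin n) : x.right i j = x.horN (i + 1) j := by
  rw [right, ← horN_val]; rfl

theorem below_eq (x : Orientation n) (i j : Fin n) : x.below i j = x.verN i j := by
  rw [below, ← verN_val]; rfl

theorem above_eq (x : Orientation n) (i j : Fin n) : x.above i j = x.verN i (j + 1) := by
  rw [above, ← verN_val]; rfl

/-- The two-in two-out rule as a conservation law: as many positive edges enter a vertex from the
left and below as leave it to the right and above. Hence the positive edges form north-east lines.
-/
theorem isEulerian_iff (x : Orientation n) : x.IsEulerian ↔ ∀ i j, i < n → j < n →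
    (x.horN i j).toNat + (x.verN i j).toNat =
      (x.horN (i + 1) j).toNat + (x.verN i (j + 1)).toNat := by
  have key : ∀ l r d u : Bool, l.toNat + (!r).toNat + d.toNat + (!u).toNat = 2 ↔
      l.toNat + d.toNat = r.toNat + u.toNat := by decide
  simp only [IsEulerian, inDegree, left_eq, right_eq, below_eq, above_eq, key]
  exact ⟨fun h i j hi hj => h ⟨i, hi⟩ ⟨j, hj⟩, fun h i j => h i j i.2 j.2⟩

theorem agrees_iff (x : Orientation n) (ξ : BoundaryCondition n) : x.Agrees ξ ↔
    (∀ j : Fin n, x.horN 0 j = ξ.left j) ∧ (∀ j : Fin n, x.horN n j = ξ.right j) ∧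
      (∀ i : Fin n, x.verN i 0 = ξ.bottom i) ∧ (∀ i : Fin n, x.verN i n = ξ.top i) := by
  simp only [Agrees, ← horN_val, ← verN_val, Fin.val_zero, Fin.val_last]

theorem isCycle_iff (x : Orientation n) (q : Cell n) : x.IsCycle q ↔
    (x.horN (q.1 + 1) q.2 = true ∧ x.verN (q.1 + 1) (q.2 + 1) = true ∧
      x.horN (q.1 + 1) (q.2 + 1) = false ∧ x.verN q.1 (q.2 + 1) = false) ∨
    (x.horN (q.1 + 1) q.2 = false ∧ x.verN (q.1 + 1) (q.2 + 1) = false ∧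
      x.horN (q.1 + 1) (q.2 + 1) = true ∧ x.verN q.1 (q.2 + 1) = true) := by
  simp only [IsCycle, ← horN_val, ← verN_val]
  rfl

theorem horN_flip (x : Orientation n) (q : Cell n) (i j : ℕ) : (x.flip q).horN i j =
    if i = q.1 + 1 ∧ (j = q.2 ∨ j = q.2 + 1) then !x.horN i j else x.horN i j := by
  have h₁ := q.1.2
  have h₂ := q.2.2
  by_cases h : i < n + 1 ∧ j < n
  · simp only [horN, h, flip, mid, lo, hi, Fin.ext_iff]
    rfl
  · have : ¬(i = q.1 + 1 ∧ (j = q.2 ∨ j = q.2 + 1)) := by omega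
    simp only [horN, h, this]
    rfl

theorem verN_flip (x : Orientation n) (q : Cell n) (i j : ℕ) : (x.flip q).verN i j =
    if (i = q.1 ∨ i = q.1 + 1) ∧ j = q.2 + 1 then !x.verN i j else x.verN i j := by
  have h₁ := q.1.2
  have h₂ := q.2.2
  by_cases h : i < n ∧ j < n + 1
  · simp only [verN, h, flip, mid, lo, hi, Fin.ext_iff]
    rfl
  · have : ¬((i = q.1 ∨ i = q.1 + 1) ∧ j = q.2 + 1) := by omega
    simp only [verN, h, this]
    rfl

theorem flip_flip (x : Orientation n) (q : Cell n) : (x.flip q).flip q = x := by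
  refine ext_nat (fun i j _ _ => ?_) fun i j _ _ => ?_
  · simp only [horN_flip]; split_ifs <;> simp
  · simp only [verN_flip]; split_ifs <;> simp

theorem IsCycle.flip {x : Orientation n} {q : Cell n} (h : x.IsCycle q) :
    (x.flip q).IsCycle q := by
  rw [isCycle_iff] at h ⊢
  simp only [horN_flip, verN_flip]
  rcases h with ⟨h₁, h₂, h₃, h₄⟩ | ⟨h₁, h₂, h₃, h₄⟩ <;> simp [h₁, h₂, h₃, h₄]

theorem IsEulerian.flip {x : Orientation n} {q : Cell n} (hx : x.IsEulerian)
    (h : x.IsCycle q) : (x.flip q).IsEulerian := by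
  rw [isEulerian_iff] at hx ⊢
  rw [isCycle_iff] at h
  obtain ⟨⟨a, ha⟩, ⟨b, hb⟩⟩ := q
  intro i j hi hj
  have e := hx i j hi hj
  simp only [horN_flip, verN_flip] at h ⊢
  by_cases h₁ : i = a
  · subst h₁
    by_cases h₂ : j = b
    · subst h₂
      rcases h with ⟨h₁, h₂, h₃, h₄⟩ | ⟨h₁, h₂, h₃, h₄⟩ <;> simp [h₁, h₄] at e ⊢ <;> omega
    · by_cases h₃ : j = b + 1
      · subst h₃
        rcases h with ⟨h₁, h₂, h₃, h₄⟩ | ⟨h₁, h₂, h₃, h₄⟩ <;> simp [h₃, h₄] at e ⊢ <;> omega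
      · simp [h₂, h₃, e]
  · by_cases h₁' : i = a + 1
    · subst h₁'
      by_cases h₂ : j = b
      · subst h₂
        rcases h with ⟨h₁, h₂, h₃, h₄⟩ | ⟨h₁, h₂, h₃, h₄⟩ <;> simp [h₁, h₂] at e ⊢ <;> omega
      · by_cases h₃ : j = b + 1
        · subst h₃
          rcases h with ⟨h₁, h₂, h₃, h₄⟩ | ⟨h₁, h₂, h₃, h₄⟩ <;> simp [h₂, h₃] at e ⊢ <;> omega
        · simp [h₂, h₃, e]
    · simp [h₁, h₁', e]

theorem Agrees.flip {x : Orientation n} {ξ : BoundaryCondition n} (q : Cell n)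
    (hx : x.Agrees ξ) : (x.flip q).Agrees ξ := by
  rw [agrees_iff] at hx ⊢
  have h₁ := q.1.2
  have h₂ := q.2.2
  refine ⟨fun j => ?_, fun j => ?_, fun i => ?_, fun i => ?_⟩
  · rw [horN_flip, if_neg (by omega), hx.1]
  · rw [horN_flip, if_neg (by omega), hx.2.1]
  · rw [verN_flip, if_neg (by omega), hx.2.2.1]
  · rw [verN_flip, if_neg (by omega), hx.2.2.2]

end Orientation

/-! ### Reversibility of Glauber dynamics -/

variable {n : ℕ} {ξ : BoundaryCondition n}

/-- The state that results from reversing a cycle. -/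
def State.flip (x : State ξ) {q : Cell n} (h : x.1.IsCycle q) : State ξ :=
  ⟨x.1.flip q, x.2.1.flip h, x.2.2.flip q⟩

theorem vertexWeight_pos {a b c : ℝ} (ha : 0 < a) (hb : 0 < b) (hc : 0 < c) {l r d u : Bool}
    (h : l.toNat + d.toNat = r.toNat + u.toNat) : 0 < vertexWeight a b c l r d u := by
  revert h
  cases l <;> cases r <;> cases d <;> cases u <;> simp [vertexWeight, ha, hb, hc]

theorem weight_eq (a b c : ℝ) (x : Orientation n) : weight a b c x =
    ∏ i : Fin n, ∏ j : Fin n, vertexWeight a b c (x.horN i j) (x.horN (i + 1) j) (x.verN i j)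
      (x.verN i (j + 1)) := by
  simp only [weight, Orientation.left_eq, Orientation.right_eq, Orientation.below_eq,
    Orientation.above_eq]

open Classical in
theorem sum_moveProb_le (a b c : ℝ) (x : State ξ) : ∑ y, moveProb a b c ξ x y ≤
    ∑ q : Cell n, if x.1.IsCycle q then 1 / (Fintype.card (Cell n) : ℝ) else 0 := by
  simp only [moveProb]
  rw [Finset.sum_comm]
  refine Finset.sum_le_sum fun q _ => ?_
  by_cases h : x.1.IsCycle q
  · rw [if_pos h, Finset.sum_eq_single (x.flip h)]
    · rw [if_pos ⟨h, rfl⟩]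
      exact mul_le_of_le_one_right (by positivity) (min_le_left _ _)
    · intro y _ hy
      exact if_neg fun h' => hy (Subtype.ext h'.2)
    · simp
  · rw [if_neg h]
    exact le_of_eq (Finset.sum_eq_zero fun y _ => if_neg fun h' => h h'.1)

theorem sum_moveProb_le_one (a b c : ℝ) (x : State ξ) : ∑ y, moveProb a b c ξ x y ≤ 1 := by
  classical
  refine (sum_moveProb_le a b c x).trans ?_
  calc _ ≤ ∑ q : Cell n, 1 / (Fintype.card (Cell n) : ℝ) := by
        refine Finset.sum_le_sum fun q _ => ?_
        split_ifs
        · exact le_rfl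
        · positivity
    _ ≤ 1 := by
        rw [Finset.sum_const, Finset.card_univ, nsmul_eq_mul, mul_one_div]
        exact div_self_le_one _

theorem glauber_row_sum (a b c : ℝ) (x : State ξ) : ∑ y, glauber a b c ξ x y = 1 := by
  rw [← Finset.add_sum_erase _ _ (Finset.mem_univ x)]
  have : ∑ y ∈ Finset.univ.erase x, glauber a b c ξ x y =
      ∑ y ∈ Finset.univ.erase x, moveProb a b c ξ x y :=
    Finset.sum_congr rfl fun y hy => if_neg (Finset.ne_of_mem_erase hy).symm
  rw [this, glauber, if_pos rfl]
  ring

section Chain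

variable {a b c : ℝ} (ha : 0 < a) (hb : 0 < b) (hc : 0 < c)
include ha hb hc

theorem weight_pos (x : State ξ) : 0 < weight a b c x.1 := by
  rw [weight_eq]
  exact Finset.prod_pos fun i _ => Finset.prod_pos fun j _ => vertexWeight_pos ha hb hc
    ((Orientation.isEulerian_iff _).1 x.2.1 i j i.2 j.2)

theorem partitionFunction_pos [Nonempty (State ξ)] : 0 < partitionFunction a b c ξ :=
  Finset.sum_pos (fun x _ => weight_pos ha hb hc x) Finset.univ_nonempty

theorem gibbs_pos (x : State ξ) : 0 < gibbs a b c ξ x :=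
  haveI : Nonempty (State ξ) := ⟨x⟩
  div_pos (weight_pos ha hb hc x) (partitionFunction_pos ha hb hc)

theorem sum_gibbs [Nonempty (State ξ)] : ∑ x, gibbs a b c ξ x = 1 := by
  simp only [gibbs]
  rw [← Finset.sum_div]
  exact div_self (partitionFunction_pos ha hb hc).ne'

theorem moveProb_nonneg (x y : State ξ) : 0 ≤ moveProb a b c ξ x y := by
  refine Finset.sum_nonneg fun q _ => ?_
  split_ifs
  · have h₁ := gibbs_pos ha hb hc x
    have h₂ := gibbs_pos ha hb hc y
    positivity
  · exact le_rfl

theorem moveProb_pos {x y : State ξ} {q : Cell n} (h : x.1.IsCycle q)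
    (hy : y.1 = x.1.flip q) : 0 < moveProb a b c ξ x y := by
  have h₁ := gibbs_pos ha hb hc x
  have h₂ := gibbs_pos ha hb hc y
  have hcard : 0 < (Fintype.card (Cell n) : ℝ) := by
    exact_mod_cast Fintype.card_pos_iff.2 ⟨q⟩
  refine Finset.sum_pos' (fun q _ => ?_) ⟨q, Finset.mem_univ q, ?_⟩
  · split_ifs
    · positivity
    · exact le_rfl
  · rw [if_pos ⟨h, hy⟩]
    positivity

/-- Detailed balance holds cell by cell: a move is undone by reversing the same cell, and on both
sides the Metropolis rule gives min(π x, π y) divided by the number of cells. -/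
theorem gibbs_mul_moveProb_comm (x y : State ξ) :
    gibbs a b c ξ x * moveProb a b c ξ x y = gibbs a b c ξ y * moveProb a b c ξ y x := by
  have h₁ := gibbs_pos ha hb hc x
  have h₂ := gibbs_pos ha hb hc y
  simp only [moveProb, Finset.mul_sum]
  refine Finset.sum_congr rfl fun q _ => ?_
  have hiff : (x.1.IsCycle q ∧ y.1 = x.1.flip q) ↔ (y.1.IsCycle q ∧ x.1 = y.1.flip q) := by
    constructor
    · rintro ⟨h, e⟩
      exact ⟨e ▸ h.flip, by rw [e, Orientation.flip_flip]⟩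
    · rintro ⟨h, e⟩
      exact ⟨e ▸ h.flip, by rw [e, Orientation.flip_flip]⟩
  by_cases h : x.1.IsCycle q ∧ y.1 = x.1.flip q
  · rw [if_pos h, if_pos (hiff.1 h)]
    have e₁ : gibbs a b c ξ x * min 1 (gibbs a b c ξ y / gibbs a b c ξ x) =
        min (gibbs a b c ξ x) (gibbs a b c ξ y) := by
      rw [mul_min_of_nonneg _ _ h₁.le, mul_one, mul_div_cancel₀ _ h₁.ne']
    have e₂ : gibbs a b c ξ y * min 1 (gibbs a b c ξ x / gibbs a b c ξ y) =
        min (gibbs a b c ξ x) (gibbs a b c ξ y) := by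
      rw [mul_min_of_nonneg _ _ h₂.le, mul_one, mul_div_cancel₀ _ h₂.ne', min_comm]
    linear_combination (1 / (Fintype.card (Cell n) : ℝ)) * e₁ -
      (1 / (Fintype.card (Cell n) : ℝ)) * e₂
  · rw [if_neg h, if_neg (fun h' => h (hiff.2 h'))]
    simp

theorem glauber_nonneg (x y : State ξ) : 0 ≤ glauber a b c ξ x y := by
  unfold glauber
  split_ifs
  · have h₁ := sum_moveProb_le_one a b c x
    have h₂ : ∑ z ∈ Finset.univ.erase x, moveProb a b c ξ x z ≤ ∑ z, moveProb a b c ξ x z :=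
      Finset.sum_le_sum_of_subset_of_nonneg (Finset.erase_subset _ _)
        fun z _ _ => moveProb_nonneg ha hb hc x z
    linarith
  · exact moveProb_nonneg ha hb hc x y

/-- A cell that is not a cycle contributes its whole selection probability to staying put. -/
theorem glauber_self_pos {x : State ξ} {q : Cell n} (h : ¬x.1.IsCycle q) :
    0 < glauber a b c ξ x x := by
  classical
  rw [glauber, if_pos rfl]
  have hcard : 0 < (Fintype.card (Cell n) : ℝ) := by
    exact_mod_cast Fintype.card_pos_iff.2 ⟨q⟩
  have h₁ := sum_moveProb_le a b c x
  have h₂ : ∑ z ∈ Finset.univ.erase x, moveProb a b c ξ x z ≤ ∑ z, moveProb a b c ξ x z :=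
    Finset.sum_le_sum_of_subset_of_nonneg (Finset.erase_subset _ _)
      fun z _ _ => moveProb_nonneg ha hb hc x z
  have h₃ : (∑ q : Cell n, if x.1.IsCycle q then 1 / (Fintype.card (Cell n) : ℝ) else 0) <
      ∑ q : Cell n, 1 / (Fintype.card (Cell n) : ℝ) := by
    refine Finset.sum_lt_sum (fun q _ => ?_) ⟨q, Finset.mem_univ q, ?_⟩
    · split_ifs
      · exact le_rfl
      · positivity
    · rw [if_neg h]
      positivity
  rw [Finset.sum_const, Finset.card_univ, nsmul_eq_mul, mul_one_div_cancel hcard.ne'] at h₃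
  linarith

theorem gibbs_mul_glauber_comm (x y : State ξ) :
    gibbs a b c ξ x * glauber a b c ξ x y = gibbs a b c ξ y * glauber a b c ξ y x := by
  by_cases h : x = y
  · rw [h]
  · rw [glauber, glauber, if_neg h, if_neg (Ne.symm h)]
    exact gibbs_mul_moveProb_comm ha hb hc x y

theorem glauber_pos_of_flip {x y : State ξ} {q : Cell n} (h : x.1.IsCycle q)
    (hy : y.1 = x.1.flip q) (hne : x ≠ y) : 0 < glauber a b c ξ x y := by
  rw [glauber, if_neg hne]
  exact moveProb_pos ha hb hc h hy

end Chain

/-! ### Height functions -/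

namespace Orientation

variable {n : ℕ}

/-- The height of the face with lower left corner `(i, j)` (shifted by one half in both
directions): the signed number of positive edges that a path from face `(0, 0)` crosses. -/
def height (x : Orientation n) (i j : ℕ) : ℤ :=
  ∑ l ∈ Finset.range j, ((x.horN i l).toNat : ℤ) - ∑ k ∈ Finset.range i, ((x.verN k 0).toNat : ℤ)

theorem height_succ_right (x : Orientation n) (i j : ℕ) :
    x.height i (j + 1) = x.height i j + (x.horN i j).toNat := by
  simp only [height, Finset.sum_range_succ]
  ring

/-- The conservation law makes the height independent of the path along which it is computed, so the
vertical edges in every row, not only the bottom one, are height differences. -/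
theorem IsEulerian.height_succ_left {x : Orientation n} (hx : x.IsEulerian) {i j : ℕ}
    (hi : i < n) (hj : j ≤ n) : x.height i j = x.height (i + 1) j + (x.verN i j).toNat := by
  induction j with
  | zero => simp [height, Finset.sum_range_succ]
  | succ j ih =>
    have h := (isEulerian_iff x).1 hx i j hi (by omega)
    rw [height_succ_right, height_succ_right, ih (by omega)]
    zify at h
    linarith

theorem height_zero_right (x : Orientation n) (i : ℕ) :
    x.height i 0 = -∑ k ∈ Finset.range i, ((x.verN k 0).toNat : ℤ) := by
  simp [height]

theorem eq_of_height_eq {x y : Orientation n} (hx : x.IsEulerian) (hy : y.IsEulerian)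
    (h : ∀ i j, i ≤ n → j ≤ n → x.height i j = y.height i j) : x = y := by
  have key : ∀ u v : Bool, u.toNat = v.toNat → u = v := by decide
  refine ext_nat (fun i j hi hj => key _ _ ?_) fun i j hi hj => key _ _ ?_
  · have h₁ := height_succ_right x i j
    have h₂ := height_succ_right y i j
    have h₃ := h i j (by omega) (by omega)
    have h₄ := h i (j + 1) (by omega) (by omega)
    omega
  · have h₁ := hx.height_succ_left hi (Nat.lt_succ_iff.1 hj)
    have h₂ := hy.height_succ_left hi (Nat.lt_succ_iff.1 hj)
    have h₃ := h i j (by omega) (by omega)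
    have h₄ := h (i + 1) j (by omega) (by omega)
    omega

/-- The heights of boundary faces are determined by the boundary condition. -/
theorem height_eq_of_agrees {x y : Orientation n} {ξ : BoundaryCondition n}
    (hxe : x.IsEulerian) (hye : y.IsEulerian) (hx : x.Agrees ξ) (hy : y.Agrees ξ) {i j : ℕ}
    (hi : i ≤ n) (hj : j ≤ n) (h : i = 0 ∨ i = n ∨ j = 0 ∨ j = n) :
    x.height i j = y.height i j := by
  rw [agrees_iff] at hx hy
  have hbot : ∀ i ≤ n, x.height i 0 = y.height i 0 := by
    intro i hi
    rw [height_zero_right, height_zero_right]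
    congr 1
    refine Finset.sum_congr rfl fun k hk => ?_
    have hk := Finset.mem_range.1 hk
    have h₁ := hx.2.2.1 ⟨k, by omega⟩
    have h₂ := hy.2.2.1 ⟨k, by omega⟩
    simp only at h₁ h₂
    rw [h₁, h₂]
  have hside : ∀ i, i = 0 ∨ i = n → ∀ j ≤ n, x.height i j = y.height i j := by
    intro i hi j hj
    induction j with
    | zero => exact hbot i (by omega)
    | succ j ih =>
      rw [height_succ_right, height_succ_right, ih (by omega)]
      rcases hi with rfl | rfl
      · have h₁ := hx.1 ⟨j, by omega⟩
        have h₂ := hy.1 ⟨j, by omega⟩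
        simp only at h₁ h₂
        rw [h₁, h₂]
      · have h₁ := hx.2.1 ⟨j, by omega⟩
        have h₂ := hy.2.1 ⟨j, by omega⟩
        simp only at h₁ h₂
        rw [h₁, h₂]
  have htop : ∀ i ≤ n, x.height i n = y.height i n := by
    intro i hi
    induction i with
    | zero => exact hside 0 (Or.inl rfl) n le_rfl
    | succ i ih =>
      have e₁ := hxe.height_succ_left (show i < n by omega) le_rfl
      have e₂ := hye.height_succ_left (show i < n by omega) le_rfl
      have h₁ := hx.2.2.2 ⟨i, by omega⟩
      have h₂ := hy.2.2.2 ⟨i, by omega⟩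
      simp only at h₁ h₂
      rw [h₁] at e₁
      rw [h₂] at e₂
      have := ih (by omega)
      omega
  rcases h with h | h | rfl | rfl
  · exact hside i (Or.inl h) j hj
  · exact hside i (Or.inr h) j hj
  · exact hbot i hi
  · exact htop i hi

/-- Reversing a cycle changes the height of the enclosed face only. -/
theorem height_flip (x : Orientation n) {q : Cell n} (h : x.IsCycle q) (i j : ℕ) :
    (x.flip q).height i j = x.height i j + if i = q.1 + 1 ∧ j = q.2 + 1 then
      (if x.horN (q.1 + 1) q.2 then -1 else 1) else 0 := by
  induction j with
  | zero =>
    rw [height_zero_right, height_zero_right, if_neg (by omega), add_zero]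
    congr 1
    refine Finset.sum_congr rfl fun k hk => ?_
    rw [verN_flip, if_neg (by omega)]
  | succ j ih =>
    rw [height_succ_right, height_succ_right, ih, horN_flip]
    rw [isCycle_iff] at h
    by_cases hi : i = q.1 + 1
    · subst hi
      by_cases h₁ : j = q.2
      · subst h₁
        rcases h with ⟨h₁, h₂, h₃, h₄⟩ | ⟨h₁, h₂, h₃, h₄⟩ <;> simp [h₁]
      · by_cases h₂ : j = q.2 + 1
        · subst h₂
          rcases h with ⟨h₁, h₂, h₃, h₄⟩ | ⟨h₁, h₂, h₃, h₄⟩ <;> simp [h₁, h₃]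
        · simp [h₁, h₂]
    · simp [hi]

/-- The number of unit height changes that lead from one orientation to another. -/
def heightDist (x y : Orientation n) : ℕ :=
  ∑ f ∈ Finset.range (n + 1) ×ˢ Finset.range (n + 1), (x.height f.1 f.2 - y.height f.1 f.2).natAbs

theorem heightDist_comm (x y : Orientation n) : x.heightDist y = y.heightDist x :=
  Finset.sum_congr rfl fun _ _ => by rw [← Int.natAbs_neg, neg_sub]

/-- Among the faces where x is higher than y, a suitably chosen extremal one is surrounded by a
cycle, and reversing it lowers x there by one, towards y. Such faces are interior because the
boundary heights agree. -/
theorem exists_flip_heightDist_lt {x y : Orientation n} {ξ : BoundaryCondition n}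
    (hxe : x.IsEulerian) (hye : y.IsEulerian) (hx : x.Agrees ξ) (hy : y.Agrees ξ)
    (h : ∃ i j, i ≤ n ∧ j ≤ n ∧ y.height i j < x.height i j) :
    ∃ q, x.IsCycle q ∧ (x.flip q).heightDist y < x.heightDist y := by
  classical
  let F := (Finset.range (n + 1) ×ˢ Finset.range (n + 1)).filter
    fun f : ℕ × ℕ => y.height f.1 f.2 < x.height f.1 f.2
  have hF : F.Nonempty := by
    obtain ⟨i, j, hi, hj, hlt⟩ := h
    exact ⟨(i, j), by simp [F]; omega⟩
  -- The function 2h + i - j changes by exactly ±1 between adjacent faces. If it grew across one of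
  -- the four edges, the neighbour would still have x above y, because y changes by at most one and
  -- monotonically. So at a maximum all four edges are forced, and they form a counterclockwise
  -- cycle.
  obtain ⟨⟨I, J⟩, hmem, hmax⟩ := Finset.exists_max_image F
    (fun f => 2 * x.height f.1 f.2 + f.1 - f.2) hF
  have hmax' : ∀ i j : ℕ, i ≤ n → j ≤ n → y.height i j < x.height i j →
      2 * x.height i j + i - j ≤ 2 * x.height I J + I - J := fun i j hi hj hlt =>
    hmax (i, j) (by simp [F]; omega)
  obtain ⟨⟨hI, hJ⟩, hlt⟩ : (I ≤ n ∧ J ≤ n) ∧ y.height I J < x.height I J := by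
    simpa [F, Nat.lt_succ_iff] using hmem
  have hint : I ≠ 0 ∧ I ≠ n ∧ J ≠ 0 ∧ J ≠ n := by
    refine ⟨?_, ?_, ?_, ?_⟩ <;>
    · intro he
      have := height_eq_of_agrees hxe hye hx hy hI hJ (by tauto)
      omega
  obtain ⟨A, rfl⟩ := Nat.exists_eq_succ_of_ne_zero hint.1
  obtain ⟨B, rfl⟩ := Nat.exists_eq_succ_of_ne_zero hint.2.2.1
  simp only [Nat.succ_eq_add_one] at *
  have bt : ∀ u : Bool, u.toNat ≠ 0 → u = true := by decide
  have bf : ∀ u : Bool, u.toNat ≠ 1 → u = false := by decide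
  have c₁ : x.horN (A + 1) B = true := by
    refine bt _ fun h0 => ?_
    have e₁ := height_succ_right x (A + 1) B
    have e₂ := height_succ_right y (A + 1) B
    have := hmax' (A + 1) B (by omega) (by omega) (by omega)
    push_cast at this
    omega
  have c₂ : x.horN (A + 1) (B + 1) = false := by
    refine bf _ fun h0 => ?_
    have e₁ := height_succ_right x (A + 1) (B + 1)
    have e₂ := height_succ_right y (A + 1) (B + 1)
    have := Bool.toNat_le (y.horN (A + 1) (B + 1))
    have := hmax' (A + 1) (B + 1 + 1) (by omega) (by omega) (by omega)
    push_cast at this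
    omega
  have c₃ : x.verN A (B + 1) = false := by
    refine bf _ fun h0 => ?_
    have e₁ := hxe.height_succ_left (i := A) (j := B + 1) (by omega) (by omega)
    have e₂ := hye.height_succ_left (i := A) (j := B + 1) (by omega) (by omega)
    have := Bool.toNat_le (y.verN A (B + 1))
    have := hmax' A (B + 1) (by omega) (by omega) (by omega)
    push_cast at this
    omega
  have c₄ : x.verN (A + 1) (B + 1) = true := by
    refine bt _ fun h0 => ?_
    have e₁ := hxe.height_succ_left (i := A + 1) (j := B + 1) (by omega) (by omega)
    have e₂ := hye.height_succ_left (i := A + 1) (j := B + 1) (by omega) (by omega)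
    have := hmax' (A + 1 + 1) (B + 1) (by omega) (by omega) (by omega)
    push_cast at this
    omega
  have hcyc : x.IsCycle (⟨A, by omega⟩, ⟨B, by omega⟩) := by
    rw [isCycle_iff]
    exact Or.inl ⟨c₁, c₄, c₂, c₃⟩
  refine ⟨_, hcyc, Finset.sum_lt_sum (fun f _ => ?_) ⟨(A + 1, B + 1), by simp; omega, ?_⟩⟩
  · rw [height_flip x hcyc, c₁]
    by_cases hf : f.1 = A + 1 ∧ f.2 = B + 1
    · rw [hf.1, hf.2]
      simp
      omega
    · simp [hf]
  · rw [height_flip x hcyc, c₁]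
    simp
    omega

end Orientation

/-! ### Ergodicity -/

variable {n : ℕ} {ξ : BoundaryCondition n}

/-- Two neighbouring cells share an edge, so if both are cycles then reversing one destroys the
other. Two cells in a row exist once n ≥ 3. -/
theorem exists_not_isCycle (hn : 3 ≤ n) (x : State ξ) :
    ∃ (y : State ξ) (q : Cell n), ¬y.1.IsCycle q := by
  let q₀ : Cell n := (⟨0, by omega⟩, ⟨0, by omega⟩)
  let q₁ : Cell n := (⟨1, by omega⟩, ⟨0, by omega⟩)
  by_cases h₀ : x.1.IsCycle q₀
  · by_cases h₁ : x.1.IsCycle q₁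
    · refine ⟨x.flip h₀, q₁, fun h => ?_⟩
      simp only [State.flip] at h
      rw [Orientation.isCycle_iff] at h h₁
      simp only [Orientation.horN_flip, Orientation.verN_flip, q₀, q₁] at h h₁
      rcases h₁ with ⟨h₁, h₂, h₃, h₄⟩ | ⟨h₁, h₂, h₃, h₄⟩ <;> simp_all
    · exact ⟨x, q₁, h₁⟩
  · exact ⟨x, q₀, h₀⟩

theorem glauber_connected {a b c : ℝ} (ha : 0 < a) (hb : 0 < b) (hc : 0 < c) (x y : State ξ) :
    Relation.ReflTransGen (fun x y => 0 < glauber a b c ξ x y) x y := by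
  induction hd : x.1.heightDist y.1 using Nat.strong_induction_on generalizing x y with
  | _ d ih =>
  subst hd
  by_cases hxy : x = y
  · exact hxy ▸ Relation.ReflTransGen.refl
  have hne : ∃ i j, i ≤ n ∧ j ≤ n ∧ x.1.height i j ≠ y.1.height i j := by
    by_contra! hcon
    exact hxy (Subtype.ext (Orientation.eq_of_height_eq x.2.1 y.2.1 hcon))
  obtain ⟨i, j, hi, hj, hne⟩ := hne
  rcases lt_or_gt_of_ne hne with hlt | hlt
  -- Where x is lower than y, it is y that is lowered; the reversal is then read backwards as the
  -- last move of the path.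
  · obtain ⟨q, hq, hd⟩ := Orientation.exists_flip_heightDist_lt y.2.1 x.2.1 y.2.2 x.2.2
      ⟨i, j, hi, hj, hlt⟩
    rw [Orientation.heightDist_comm, Orientation.heightDist_comm y.1] at hd
    refine (ih _ hd x (y.flip hq) rfl).tail ?_
    refine glauber_pos_of_flip ha hb hc (q := q) hq.flip (Orientation.flip_flip _ _).symm ?_
    intro he
    rw [show y.1.flip q = y.1 from congrArg Subtype.val he] at hd
    exact lt_irrefl _ hd
  · obtain ⟨q, hq, hd⟩ := Orientation.exists_flip_heightDist_lt x.2.1 y.2.1 x.2.2 y.2.2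
      ⟨i, j, hi, hj, hlt⟩
    refine Relation.ReflTransGen.head ?_ (ih _ hd (x.flip hq) y rfl)
    refine glauber_pos_of_flip ha hb hc (q := q) hq rfl ?_
    intro he
    rw [← show x.1 = x.1.flip q from congrArg Subtype.val he] at hd
    exact lt_irrefl _ hd

theorem glauber_isPrimitive {a b c : ℝ} (ha : 0 < a) (hb : 0 < b) (hc : 0 < c) (hn : 3 ≤ n)
    [hne : Nonempty (State ξ)] : (glauber a b c ξ).IsPrimitive := by
  obtain ⟨x⟩ := hne
  obtain ⟨y, q, hq⟩ := exists_not_isCycle hn x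
  exact isPrimitive_of_connected_of_loop (glauber_nonneg ha hb hc)
    (glauber_connected ha hb hc) (glauber_self_pos ha hb hc hq)

/-! ### Bottlenecks and the mixing time -/

/-- The states of a set from which a single reversal leads out of the set. -/
def innerBoundary (S : Set (State ξ)) : Set (State ξ) :=
  {x | x ∈ S ∧ ∃ (q : Cell n) (h : x.1.IsCycle q), x.flip h ∉ S}

/-- A set of states whose inner boundary has much less weight than the set and its complement. -/
def HasBottleneck (a b c : ℝ) (ξ : BoundaryCondition n) (ε : ℝ) : Prop :=
  ∃ S : Set (State ξ), S.Nonempty ∧ Sᶜ.Nonempty ∧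
    ∑ᶠ x ∈ innerBoundary S, weight a b c x.1 ≤ ε * ∑ᶠ x ∈ S, weight a b c x.1 ∧
    ∑ᶠ x ∈ innerBoundary S, weight a b c x.1 ≤ ε * ∑ᶠ x ∈ Sᶜ, weight a b c x.1

theorem HasBottleneck.le_of_tvDist_le {a b c : ℝ} (ha : 0 < a) (hb : 0 < b) (hc : 0 < c)
    {ε : ℝ} (hε : 0 < ε) (h : HasBottleneck a b c ξ ε) {t : ℕ}
    (ht : ∀ x, tvDist ((glauber a b c ξ ^ t) x) (gibbs a b c ξ) ≤ 1 / 4) : 1 / (4 * ε) ≤ t := by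
  classical
  obtain ⟨S, ⟨x₀, hx₀⟩, ⟨x₁, hx₁⟩, h₁, h₂⟩ := h
  have : Nonempty (State ξ) := ⟨x₀⟩
  have hfin : ∀ T : Set (State ξ), ∑ᶠ x ∈ T, weight a b c x.1 =
      ∑ x ∈ T.toFinset, weight a b c x.1 := fun T => by
    rw [← finsum_mem_coe_finset, Set.coe_toFinset]
  rw [hfin, hfin] at h₁ h₂
  have hZ := partitionFunction_pos (ξ := ξ) ha hb hc
  -- Only states of the inner boundary can leave S in one step, and each sends out at most its own
  -- mass.
  have hflow : ∑ x ∈ S.toFinset, ∑ y ∈ S.toFinsetᶜ, gibbs a b c ξ x * glauber a b c ξ x y ≤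
      ∑ x ∈ (innerBoundary S).toFinset, gibbs a b c ξ x := by
    have hsub : (innerBoundary S).toFinset ⊆ S.toFinset := by
      intro x hx
      rw [Set.mem_toFinset] at hx ⊢
      exact hx.1
    rw [← Finset.sum_subset_zero_on_sdiff hsub (g := fun x => ∑ y ∈ S.toFinsetᶜ,
      gibbs a b c ξ x * glauber a b c ξ x y) (f := fun x => ∑ y ∈ S.toFinsetᶜ,
      gibbs a b c ξ x * glauber a b c ξ x y) ?_ fun _ _ => rfl]
    · refine Finset.sum_le_sum fun x _ => ?_
      rw [← Finset.mul_sum]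
      refine mul_le_of_le_one_right (gibbs_pos ha hb hc x).le ?_
      rw [← glauber_row_sum a b c x]
      exact Finset.sum_le_sum_of_subset_of_nonneg (Finset.subset_univ _)
        fun y _ _ => glauber_nonneg ha hb hc x y
    · intro x hx
      rw [Finset.mem_sdiff, Set.mem_toFinset, Set.mem_toFinset] at hx
      refine Finset.sum_eq_zero fun y hy => ?_
      rw [Finset.mem_compl, Set.mem_toFinset] at hy
      have hxy : x ≠ y := by rintro rfl; exact hy hx.1
      rw [glauber, if_neg hxy, moveProb, Finset.sum_eq_zero, mul_zero]
      intro q _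
      refine if_neg fun hq => hx.2 ⟨hx.1, q, hq.1, ?_⟩
      rwa [show x.flip hq.1 = y from Subtype.ext hq.2.symm]
  have hg : ∀ T : Finset (State ξ), ∑ x ∈ T, gibbs a b c ξ x =
      (∑ x ∈ T, weight a b c x.1) / partitionFunction a b c ξ := fun T => by
    rw [Finset.sum_div]; rfl
  refine le_of_tvDist_le_of_bottleneck (S := S.toFinset) (glauber_nonneg ha hb hc)
    (glauber_row_sum a b c) (gibbs_pos ha hb hc) (sum_gibbs ha hb hc)
    (gibbs_mul_glauber_comm ha hb hc) ⟨x₀, Set.mem_toFinset.2 hx₀⟩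
    ⟨x₁, by rwa [Finset.mem_compl, Set.mem_toFinset]⟩ hε (hflow.trans ?_) (hflow.trans ?_) ht
  · rw [hg, hg, ← mul_div_assoc]
    exact div_le_div_of_nonneg_right h₁ hZ.le
  · rw [hg, hg, ← mul_div_assoc]
    rw [Set.toFinset_compl] at h₂
    exact div_le_div_of_nonneg_right h₂ hZ.le

theorem HasBottleneck.le_mixingTime {a b c : ℝ} (ha : 0 < a) (hb : 0 < b) (hc : 0 < c)
    {ε : ℝ} (hε : 0 < ε) (h : HasBottleneck a b c ξ ε) :
    ENNReal.ofReal (1 / (4 * ε)) ≤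
      ((mixingTime (glauber a b c ξ) (gibbs a b c ξ) : ℕ∞) : ℝ≥0∞) := by
  by_cases htop : mixingTime (glauber a b c ξ) (gibbs a b c ξ) = ⊤
  · rw [htop]; simp
  have key : ((⌈1 / (4 * ε)⌉₊ : ℕ) : ℕ∞) ≤ mixingTime (glauber a b c ξ) (gibbs a b c ξ) := by
    refine le_iInf₂ fun t ht => ?_
    exact_mod_cast Nat.ceil_le.2 (h.le_of_tvDist_le ha hb hc hε ht)
  calc ENNReal.ofReal (1 / (4 * ε)) ≤ ENNReal.ofReal (⌈1 / (4 * ε)⌉₊ : ℝ) :=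
        ENNReal.ofReal_le_ofReal (Nat.le_ceil _)
    _ = (((⌈1 / (4 * ε)⌉₊ : ℕ) : ℕ∞) : ℝ≥0∞) := by rw [ENNReal.ofReal_natCast]; rfl
    _ ≤ _ := by exact_mod_cast key

/-! ### Weighted sums over lattice paths

A lattice path with `m` steps is encoded by the set of (the indices of) its steps to the east, a
subset of `Finset.range m`; the other steps lead north. -/

/-- The weight of a path between steps `k` and `k + 1`: `β` if it goes straight, `γ` if it
turns. -/
def turnWeight (β γ : ℝ) (A : Finset ℕ) (k : ℕ) : ℝ := if k ∈ A ↔ k + 1 ∈ A then β else γ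

/-- The weight of the first `m + 1` steps of a path. -/
def pathWeight (β γ : ℝ) (m : ℕ) (A : Finset ℕ) : ℝ := ∏ k ∈ Finset.range m, turnWeight β γ A k

/-- The number of steps to the east among the first `σ` steps. -/
def eastSteps (A : Finset ℕ) (σ : ℕ) : ℕ := (A ∩ Finset.range σ).card

theorem eastSteps_zero (A : Finset ℕ) : eastSteps A 0 = 0 := by simp [eastSteps]

theorem eastSteps_succ (A : Finset ℕ) (σ : ℕ) :
    eastSteps A (σ + 1) = eastSteps A σ + if σ ∈ A then 1 else 0 := by
  unfold eastSteps
  rw [Finset.range_add_one]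
  split_ifs with h
  · rw [Finset.inter_insert_of_mem h, Finset.card_insert_of_notMem (by simp)]
  · rw [Finset.inter_insert_of_notMem h, add_zero]

section PathSums

variable {β γ : ℝ}

theorem turnWeight_pos (hβ : 0 < β) (hγ : 0 < γ) (A : Finset ℕ) (k : ℕ) :
    0 < turnWeight β γ A k := by
  unfold turnWeight
  split_ifs <;> assumption

theorem pathWeight_pos (hβ : 0 < β) (hγ : 0 < γ) (m : ℕ) (A : Finset ℕ) :
    0 < pathWeight β γ m A :=
  Finset.prod_pos fun k _ => turnWeight_pos hβ hγ A k

theorem pathWeight_congr {m : ℕ} {A B : Finset ℕ} (h : ∀ k ≤ m, k ∈ A ↔ k ∈ B) :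
    pathWeight β γ m A = pathWeight β γ m B := by
  refine Finset.prod_congr rfl fun k hk => ?_
  have hk := Finset.mem_range.1 hk
  simp only [turnWeight, h k (by omega), h (k + 1) (by omega)]

/-- The transfer step: a path is prolonged by one step north or east, and the new vertex weighs β or
γ according to the direction of step `m`. -/
theorem sum_powerset_range_succ (m : ℕ) (f : Finset ℕ → ℝ) :
    ∑ A ∈ (Finset.range (m + 2)).powerset, pathWeight β γ (m + 1) A * f A =
      ∑ A ∈ (Finset.range (m + 1)).powerset, pathWeight β γ m A *
        ((if m ∈ A then γ else β) * f A + (if m ∈ A then β else γ) * f (insert (m + 1) A)) := by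
  rw [Finset.range_add_one (n := m + 1), Finset.sum_powerset_insert (by simp),
    ← Finset.sum_add_distrib]
  refine Finset.sum_congr rfl fun A hA => ?_
  have hm : m + 1 ∉ A := fun h => by simpa using Finset.mem_powerset.1 hA h
  have h₁ : pathWeight β γ m (insert (m + 1) A) = pathWeight β γ m A :=
    pathWeight_congr fun k hk => by
      rw [Finset.mem_insert, or_iff_right (by omega)]
  have e : ∀ B, pathWeight β γ (m + 1) B = pathWeight β γ m B * turnWeight β γ B m := fun B =>
    Finset.prod_range_succ _ _
  rw [e, e, h₁]
  by_cases h : m ∈ A <;> simp [turnWeight, h, hm] <;> ring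

/-- Whatever the last direction, the two continuations have total weight β + γ. Summing out the last
k steps of a path therefore gives (β + γ)^k, independently of its beginning. -/
theorem sum_pathWeight_add (m k : ℕ) (g : Finset ℕ → ℝ) :
    ∑ A ∈ (Finset.range (m + 1 + k)).powerset,
      pathWeight β γ (m + k) A * g (A ∩ Finset.range (m + 1)) =
    (β + γ) ^ k * ∑ A ∈ (Finset.range (m + 1)).powerset, pathWeight β γ m A * g A := by
  induction k with
  | zero =>
    rw [pow_zero, one_mul]
    refine Finset.sum_congr rfl fun A hA => ?_
    rw [Finset.inter_eq_left.2 (Finset.mem_powerset.1 hA), add_zero]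
  | succ k ih =>
    have h := sum_powerset_range_succ (β := β) (γ := γ) (m + k)
      (fun A => g (A ∩ Finset.range (m + 1)))
    rw [show m + k + 2 = m + 1 + (k + 1) by ring, show m + k + 1 = m + (k + 1) by ring] at h
    rw [h, pow_succ', mul_assoc, ← ih, Finset.mul_sum, show m + (k + 1) = m + 1 + k by ring]
    refine Finset.sum_congr rfl fun A _ => ?_
    rw [Finset.insert_inter_of_notMem (by simp; omega)]
    split_ifs <;> ring

theorem sum_pathWeight_east_first (m : ℕ) :
    ∑ A ∈ (Finset.range (m + 1)).powerset with 0 ∈ A, pathWeight β γ m A = (β + γ) ^ m := by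
  have h := sum_pathWeight_add (β := β) (γ := γ) 0 m (fun A => if 0 ∈ A then 1 else 0)
  simp only [zero_add, Finset.mem_inter, Finset.mem_range, Nat.lt_one_iff, and_true] at h
  rw [Finset.sum_filter, add_comm m 1]
  rw [show (Finset.range 1).powerset = {∅, {0}} by decide] at h
  have hcard : (({∅, {0}} : Finset (Finset ℕ)).filter fun A => 0 ∈ A) = {{0}} := by decide
  simpa [pathWeight, hcard] using h

/-- The exponential moment of a centred two-point distribution. -/
theorem exp_moment_le (hβ : 0 < β) (hγ : 0 < γ) {θ : ℝ} (h₁ : |θ| ≤ 1) (h₂ : |β / γ * θ| ≤ 1) :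
    β * Real.exp θ + γ * Real.exp (-(β / γ * θ)) ≤
      (β + γ) * Real.exp ((1 + (β / γ) ^ 2) * θ ^ 2) := by
  have q : ∀ z : ℝ, |z| ≤ 1 → Real.exp z ≤ 1 + z + z ^ 2 := fun z hz => by
    have := (abs_le.1 (Real.abs_exp_sub_one_sub_id_le hz)).2
    linarith
  have e₁ := mul_le_mul_of_nonneg_left (q θ h₁) hβ.le
  have e₂ := mul_le_mul_of_nonneg_left (q (-(β / γ * θ)) (by rwa [abs_neg])) hγ.le
  have e₃ : (β + γ) * (1 + (1 + (β / γ) ^ 2) * θ ^ 2) ≤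
      (β + γ) * Real.exp ((1 + (β / γ) ^ 2) * θ ^ 2) := by
    refine mul_le_mul_of_nonneg_left ?_ (by positivity)
    linarith [Real.add_one_le_exp ((1 + (β / γ) ^ 2) * θ ^ 2)]
  -- Centring: the linear terms of the two quadratic bounds cancel.
  have e₄ : γ * (β / γ * θ) = β * θ := by field_simp
  have e₅ : 0 ≤ β * (β / γ * θ) ^ 2 + γ * θ ^ 2 := by positivity
  have e₆ : γ * (-(β / γ * θ)) = -(β * θ) := by rw [mul_neg, e₄]
  nlinarith

/-- The exponentially tilted sum over all paths with `m + 1` steps, corrected by a factor for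
the direction of the last step. -/
noncomputable def tiltedSum (β γ θ : ℝ) (m : ℕ) : ℝ :=
  ∑ A ∈ (Finset.range (m + 1)).powerset, pathWeight β γ m A *
    Real.exp (θ * (2 * A.card - (m + 1)) + (if m ∈ A then 1 else -1) * ((β / γ - 1) / 2 * θ))

/-- Normalized, a path is a random walk that keeps its direction with probability β/(β + γ). Its
displacement has correlated increments, but adding (β/γ - 1)/2 times the last direction makes it a
martingale: the corrected increment is 1 on going straight and -β/γ on turning, up to the sign of
the direction. Each step then costs the factor of `exp_moment_le`. -/
theorem tiltedSum_le (hβ : 0 < β) (hγ : 0 < γ) {θ : ℝ} (h₁ : |θ| ≤ 1) (h₂ : |β / γ * θ| ≤ 1)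
    (m : ℕ) : tiltedSum β γ θ m ≤
      2 * Real.exp ((1 + β / γ) * |θ|) *
        ((β + γ) * Real.exp ((1 + (β / γ) ^ 2) * θ ^ 2)) ^ m := by
  have hr : 0 < β / γ := by positivity
  induction m with
  | zero =>
    rw [tiltedSum, show (Finset.range (0 + 1)).powerset = {∅, {0}} by decide,
      Finset.sum_pair (by decide)]
    have b₁ : Real.exp (-θ + -((β / γ - 1) / 2 * θ)) ≤ Real.exp ((1 + β / γ) * |θ|) := by
      rw [Real.exp_le_exp]
      have := neg_abs_le θ
      nlinarith [abs_nonneg θ]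
    have b₂ : Real.exp (θ + (β / γ - 1) / 2 * θ) ≤ Real.exp ((1 + β / γ) * |θ|) := by
      rw [Real.exp_le_exp]
      have := le_abs_self θ
      nlinarith [abs_nonneg θ]
    simp [pathWeight]
    norm_num
    linarith
  | succ m ih =>
    rw [pow_succ, ← mul_assoc]
    refine le_trans ?_ (mul_le_mul_of_nonneg_right ih (by positivity))
    rw [tiltedSum, sum_powerset_range_succ, tiltedSum, Finset.sum_mul]
    refine Finset.sum_le_sum fun A hA => ?_
    have hm : m + 1 ∉ A := fun h => by simpa using Finset.mem_powerset.1 hA h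
    rw [mul_assoc]
    refine mul_le_mul_of_nonneg_left ?_ (pathWeight_pos hβ hγ m A).le
    rw [Finset.card_insert_of_notMem hm]
    by_cases h : m ∈ A
    · have key := exp_moment_le hβ hγ h₁ h₂
      simp only [h, hm, if_true, if_false, Finset.mem_insert_self]
      push_cast
      have e₁ : Real.exp (θ * (2 * A.card - (m + 1 + 1)) + -1 * ((β / γ - 1) / 2 * θ)) =
          Real.exp (θ * (2 * A.card - (m + 1)) + 1 * ((β / γ - 1) / 2 * θ)) *
            Real.exp (-(β / γ * θ)) := by
        rw [← Real.exp_add]; congr 1; ring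
      have e₂ : Real.exp (θ * (2 * (A.card + 1) - (m + 1 + 1)) + 1 * ((β / γ - 1) / 2 * θ)) =
          Real.exp (θ * (2 * A.card - (m + 1)) + 1 * ((β / γ - 1) / 2 * θ)) * Real.exp θ := by
        rw [← Real.exp_add]; congr 1; ring
      rw [e₁, e₂]
      have := mul_le_mul_of_nonneg_left key
        (Real.exp_pos (θ * (2 * A.card - (m + 1)) + 1 * ((β / γ - 1) / 2 * θ))).le
      linarith
    · have key := exp_moment_le hβ hγ (θ := -θ) (by rwa [abs_neg]) (by rwa [mul_neg, abs_neg])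
      simp only [h, hm, if_true, if_false, Finset.mem_insert_self]
      push_cast
      have e₁ : Real.exp (θ * (2 * A.card - (m + 1 + 1)) + -1 * ((β / γ - 1) / 2 * θ)) =
          Real.exp (θ * (2 * A.card - (m + 1)) + -1 * ((β / γ - 1) / 2 * θ)) *
            Real.exp (-θ) := by
        rw [← Real.exp_add]; congr 1; ring
      have e₂ : Real.exp (θ * (2 * (A.card + 1) - (m + 1 + 1)) + 1 * ((β / γ - 1) / 2 * θ)) =
          Real.exp (θ * (2 * A.card - (m + 1)) + -1 * ((β / γ - 1) / 2 * θ)) *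
            Real.exp (-(β / γ * -θ)) := by
        rw [← Real.exp_add]; congr 1; ring
      rw [e₁, e₂]
      rw [neg_sq] at key
      have := mul_le_mul_of_nonneg_left key
        (Real.exp_pos (θ * (2 * A.card - (m + 1)) + -1 * ((β / γ - 1) / 2 * θ))).le
      linarith

/-- Large deviations of the number of steps to the east. -/
theorem sum_deviating_le (hβ : 0 < β) (hγ : 0 < γ) {θ : ℝ} (h₀ : 0 ≤ θ) (h₁ : θ ≤ 1)
    (h₂ : β / γ * θ ≤ 1) (m : ℕ) (D : ℤ) :
    ∑ A ∈ (Finset.range (m + 1)).powerset with D ≤ |2 * (A.card : ℤ) - (m + 1 : ℕ)|,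
      pathWeight β γ m A ≤
    4 * Real.exp (2 * (1 + β / γ) * θ + (1 + (β / γ) ^ 2) * θ ^ 2 * m - θ * D) *
      (β + γ) ^ m := by
  have hr : 0 < β / γ := by positivity
  have habs : |θ| = θ := abs_of_nonneg h₀
  have hrθ : |β / γ * θ| ≤ 1 := by rwa [abs_of_nonneg (by positivity)]
  have t₁ := tiltedSum_le hβ hγ (θ := θ) (by rwa [habs]) hrθ m
  have t₂ := tiltedSum_le hβ hγ (θ := -θ) (by rwa [abs_neg, habs])
    (by rwa [mul_neg, abs_neg]) m
  rw [abs_neg, neg_sq] at t₂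
  rw [habs] at t₁ t₂
  -- Chernoff bound: the tilts by θ and -θ take care of the two tails, and the prefactor pays for
  -- the correction by the last direction, which is at most (1 + β/γ)θ.
  have hmain : ∑ A ∈ (Finset.range (m + 1)).powerset with D ≤ |2 * (A.card : ℤ) - (m + 1 : ℕ)|,
      pathWeight β γ m A ≤
      Real.exp ((1 + β / γ) * θ - θ * D) * (tiltedSum β γ θ m + tiltedSum β γ (-θ) m) := by
    rw [tiltedSum, tiltedSum, ← Finset.sum_add_distrib, Finset.mul_sum]
    refine (Finset.sum_le_sum fun A hA => ?_).trans
      (Finset.sum_le_sum_of_subset_of_nonneg (Finset.filter_subset _ _) fun A _ _ => ?_)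
    · have hD := (Finset.mem_filter.1 hA).2
      have hW := (pathWeight_pos hβ hγ m A).le
      rw [← mul_add, mul_left_comm]
      refine le_mul_of_one_le_right hW ?_
      rw [mul_add, ← Real.exp_add, ← Real.exp_add]
      have hs : |(if m ∈ A then (1 : ℝ) else -1) * ((β / γ - 1) / 2 * θ)| ≤
          (1 + β / γ) * θ := by
        have : |(β / γ - 1) / 2 * θ| ≤ (1 + β / γ) * θ := by
          rw [abs_le]
          constructor <;> nlinarith
        split_ifs
        · rwa [one_mul]
        · rwa [neg_one_mul, abs_neg]
      have hs' : |(if m ∈ A then (1 : ℝ) else -1) * ((β / γ - 1) / 2 * -θ)| ≤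
          (1 + β / γ) * θ := by
        rwa [mul_neg, mul_neg, abs_neg]
      have g₁ := (abs_le.1 hs).1
      have g₂ := (abs_le.1 hs').1
      rcases le_abs'.1 hD with hD | hD
      · have hD' : (2 * A.card - (m + 1) : ℝ) ≤ -D := by exact_mod_cast hD
        have : 1 ≤ Real.exp ((1 + β / γ) * θ - θ * D + (-θ * (2 * A.card - (m + 1)) +
            (if m ∈ A then 1 else -1) * ((β / γ - 1) / 2 * -θ))) := by
          rw [Real.one_le_exp_iff]
          nlinarith
        exact this.trans (le_add_of_nonneg_left (Real.exp_pos _).le)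
      · have hD' : (D : ℝ) ≤ 2 * A.card - (m + 1) := by exact_mod_cast hD
        have : 1 ≤ Real.exp ((1 + β / γ) * θ - θ * D + (θ * (2 * A.card - (m + 1)) +
            (if m ∈ A then 1 else -1) * ((β / γ - 1) / 2 * θ))) := by
          rw [Real.one_le_exp_iff]
          nlinarith
        exact this.trans (le_add_of_nonneg_right (Real.exp_pos _).le)
    · have hW := (pathWeight_pos hβ hγ m A).le
      positivity
  refine hmain.trans ?_
  have hsum := mul_le_mul_of_nonneg_left (add_le_add t₁ t₂)
    (Real.exp_pos ((1 + β / γ) * θ - θ * D)).le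
  refine hsum.trans (le_of_eq ?_)
  rw [mul_pow, ← Real.exp_nat_mul]
  have e : Real.exp (2 * (1 + β / γ) * θ + (1 + (β / γ) ^ 2) * θ ^ 2 * m - θ * D) =
      Real.exp ((1 + β / γ) * θ - θ * D) * (Real.exp ((1 + β / γ) * θ) *
        Real.exp (m * ((1 + (β / γ) ^ 2) * θ ^ 2))) := by
    rw [← Real.exp_add, ← Real.exp_add]; congr 1; ring
  rw [e]
  ring

end PathSums

/-! ### Paths along the diagonal: total weight and deviations -/

/-- The paths with `2 * l` steps, half of them to the east, that start to the east and end to the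
north. -/
def diagonalPaths (l : ℕ) : Finset (Finset ℕ) :=
  {A ∈ (Finset.range (2 * l)).powerset | 0 ∈ A ∧ 2 * l - 1 ∉ A ∧ A.card = l}

/-- All points of the path are closer than `D` to the diagonal. -/
def IsNarrow (l : ℕ) (D : ℤ) (A : Finset ℕ) : Prop :=
  ∀ σ ≤ 2 * l, |2 * (eastSteps A σ : ℤ) - σ| < D

open Classical in
/-- The diagonal paths that stay close to the diagonal. -/
noncomputable def narrowPaths (l : ℕ) (D : ℤ) : Finset (Finset ℕ) :=
  {A ∈ diagonalPaths l | IsNarrow l D A}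

/-- The path that consists of `A` and of the image of `B` under the reflection that exchanges the
two ends. -/
def splice (p : ℕ) (A B : Finset ℕ) : Finset ℕ :=
  A ∪ {k ∈ Finset.range (2 * (p + 1)) | p + 1 ≤ k ∧ 2 * p + 1 - k ∉ B}

theorem sum_biUnion_le_sum {ι κ : Type*} [DecidableEq ι] [DecidableEq κ] (s : Finset ι)
    (t : ι → Finset κ) {f : κ → ℝ} (hf : ∀ x, 0 ≤ f x) :
    ∑ x ∈ s.biUnion t, f x ≤ ∑ i ∈ s, ∑ x ∈ t i, f x := by
  induction s using Finset.induction_on with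
  | empty => simp
  | insert i s hi ih =>
    rw [Finset.biUnion_insert, Finset.sum_insert hi]
    have := Finset.sum_union_inter (s₁ := t i) (s₂ := s.biUnion t) (f := f)
    have h₀ : 0 ≤ ∑ x ∈ t i ∩ s.biUnion t, f x := Finset.sum_nonneg fun x _ => hf x
    linarith

section PathSums

variable {β γ : ℝ}

theorem mem_splice_low {p k : ℕ} {A B : Finset ℕ} (hk : k ≤ p) :
    k ∈ splice p A B ↔ k ∈ A := by
  simp only [splice, Finset.mem_union, Finset.mem_filter, Finset.mem_range]
  constructor
  · rintro (h | h)
    · exact h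
    · omega
  · exact Or.inl

theorem mem_splice_high {p k : ℕ} {A B : Finset ℕ} (hA : A ⊆ Finset.range (p + 1)) (hk : k ≤ p) :
    p + 1 + k ∈ splice p A B ↔ p - k ∉ B := by
  simp only [splice, Finset.mem_union, Finset.mem_filter, Finset.mem_range]
  have h₁ : p + 1 + k ∉ A := fun h => by
    have := Finset.mem_range.1 (hA h)
    omega
  rw [show 2 * p + 1 - (p + 1 + k) = p - k by omega]
  constructor
  · rintro (h | h)
    · exact absurd h h₁
    · exact h.2.2
  · exact fun h => Or.inr ⟨by omega, by omega, h⟩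

theorem card_splice {p : ℕ} {A B : Finset ℕ} (hA : A ⊆ Finset.range (p + 1))
    (hB : B ⊆ Finset.range (p + 1)) (h : A.card = B.card) : (splice p A B).card = p + 1 := by
  rw [splice, Finset.card_union_of_disjoint]
  · have : ({k ∈ Finset.range (2 * (p + 1)) | p + 1 ≤ k ∧ 2 * p + 1 - k ∉ B}).card =
        (Finset.range (p + 1) \ B).card := by
      refine Finset.card_bij' (fun k _ => 2 * p + 1 - k) (fun k _ => 2 * p + 1 - k) ?_ ?_ ?_ ?_
      · intro k hk
        simp only [Finset.mem_filter, Finset.mem_range, Finset.mem_sdiff] at hk ⊢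
        exact ⟨by omega, hk.2.2⟩
      · intro k hk
        simp only [Finset.mem_filter, Finset.mem_range, Finset.mem_sdiff] at hk ⊢
        refine ⟨by omega, by omega, ?_⟩
        rw [show 2 * p + 1 - (2 * p + 1 - k) = k by omega]
        exact hk.2
      · intro k hk
        simp only [Finset.mem_filter, Finset.mem_range] at hk
        omega
      · intro k hk
        simp only [Finset.mem_range, Finset.mem_sdiff] at hk
        omega
    rw [this, Finset.card_sdiff_of_subset hB, Finset.card_range, h]
    have := Finset.card_le_card hB
    rw [Finset.card_range] at this
    omega
  · rw [Finset.disjoint_left]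
    intro k hk hk'
    have := Finset.mem_range.1 (hA hk)
    have := (Finset.mem_filter.1 hk').2.1
    omega

/-- The reflection reverses time and exchanges east and north, so it preserves straight passages and
turns. Only the vertex at the joint is new. -/
theorem pathWeight_splice {p : ℕ} {A B : Finset ℕ} (hA : A ⊆ Finset.range (p + 1)) :
    pathWeight β γ (2 * p + 1) (splice p A B) =
      pathWeight β γ p A * turnWeight β γ (splice p A B) p * pathWeight β γ p B := by
  rw [pathWeight, show 2 * p + 1 = p + 1 + p by ring, Finset.prod_range_add,
    Finset.prod_range_succ]
  congr 1
  · congr 1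
    exact pathWeight_congr fun k hk => mem_splice_low hk
  · rw [pathWeight, ← Finset.prod_range_reflect]
    refine Finset.prod_congr rfl fun k hk => ?_
    have hk := Finset.mem_range.1 hk
    refine if_congr ?_ rfl rfl
    rw [mem_splice_high hA (by omega), add_assoc (p + 1) _ 1, mem_splice_high hA (by omega),
      show p - (p - 1 - k + 1) = k by omega, show p - (p - 1 - k) = k + 1 by omega, not_iff_not]
    exact iff_comm

theorem splice_injOn {p : ℕ} {A B A' B' : Finset ℕ} (hA : A ⊆ Finset.range (p + 1))
    (hB : B ⊆ Finset.range (p + 1)) (hA' : A' ⊆ Finset.range (p + 1))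
    (hB' : B' ⊆ Finset.range (p + 1)) (h : splice p A B = splice p A' B') :
    A = A' ∧ B = B' := by
  have out : ∀ {C : Finset ℕ}, C ⊆ Finset.range (p + 1) → ∀ {k}, p < k → k ∉ C :=
    fun hC k hk hmem => by
      have := Finset.mem_range.1 (hC hmem)
      omega
  constructor
  · ext k
    rcases le_or_gt k p with hk | hk
    · rw [← mem_splice_low (B := B) hk, h, mem_splice_low hk]
    · exact iff_of_false (out hA hk) (out hA' hk)
  · ext k
    rcases le_or_gt k p with hk | hk
    · have e₁ := mem_splice_high (B := B) hA (Nat.sub_le p k)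
      have e₂ := mem_splice_high (B := B') hA' (Nat.sub_le p k)
      rw [h, e₂, Nat.sub_sub_self hk] at e₁
      exact (not_iff_not.1 e₁).symm
    · exact iff_of_false (out hB hk) (out hB' hk)

/-- Two half-paths that start east and have equally many east steps splice into a diagonal path.
Their total weight is the sum of the squares of the weights by number of east steps. With p + 2
possible numbers, Cauchy-Schwarz bounds it below by (β + γ)^(2p)/(p + 2); the joint costs at most
the factor min β γ. -/
theorem le_sum_diagonalPaths (hβ : 0 < β) (hγ : 0 < γ) (p : ℕ) :
    min β γ * (β + γ) ^ (2 * p) / (p + 2) ≤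
      ∑ A ∈ diagonalPaths (p + 1), pathWeight β γ (2 * p + 1) A := by
  classical
  let U : Finset (Finset ℕ) := {A ∈ (Finset.range (p + 1)).powerset | 0 ∈ A}
  have hU : ∀ {A}, A ∈ U → A ⊆ Finset.range (p + 1) ∧ 0 ∈ A := fun hA => by
    simpa [U] using hA
  let T := (U ×ˢ U).filter fun q => q.1.card = q.2.card
  have hT : ∀ {q}, q ∈ T → (q.1 ∈ U ∧ q.2 ∈ U) ∧ q.1.card = q.2.card := fun hq => by
    simpa [T] using hq
  have hmin : 0 < min β γ := lt_min hβ hγ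
  let z : ℕ → ℝ := fun e => ∑ A ∈ U with A.card = e, pathWeight β γ p A
  have hmaps : ∀ A ∈ U, A.card ∈ Finset.range (p + 2) := fun A hA => by
    have := Finset.card_le_card (hU hA).1
    rw [Finset.card_range] at this
    exact Finset.mem_range.2 (by omega)
  have hz : ∑ e ∈ Finset.range (p + 2), z e = (β + γ) ^ p := by
    rw [← sum_pathWeight_east_first, Finset.sum_fiberwise_of_maps_to hmaps]
  have hsq : ((β + γ) ^ p) ^ 2 ≤ (p + 2) * ∑ e ∈ Finset.range (p + 2), z e ^ 2 := by
    have := sq_sum_le_card_mul_sum_sq (s := Finset.range (p + 2)) (f := z)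
    rw [hz, Finset.card_range] at this
    exact_mod_cast this
  have hprod : ∑ e ∈ Finset.range (p + 2), z e ^ 2 =
      ∑ q ∈ T, pathWeight β γ p q.1 * pathWeight β γ p q.2 := by
    rw [← Finset.sum_fiberwise_of_maps_to (s := T) (t := Finset.range (p + 2))
      (g := fun q => q.1.card) fun q hq => hmaps _ (hT hq).1.1]
    refine Finset.sum_congr rfl fun e _ => ?_
    rw [sq, Finset.sum_mul_sum, ← Finset.sum_product']
    refine Finset.sum_congr ?_ fun _ _ => rfl
    ext q
    simp only [Finset.mem_product, Finset.mem_filter, T]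
    constructor
    · rintro ⟨⟨h₁, h₂⟩, h₃, h₄⟩
      exact ⟨⟨⟨h₁, h₃⟩, by omega⟩, h₂⟩
    · rintro ⟨⟨⟨h₁, h₃⟩, h₅⟩, h₂⟩
      exact ⟨⟨h₁, h₂⟩, h₃, by omega⟩
  have hle : min β γ * ∑ q ∈ T, pathWeight β γ p q.1 * pathWeight β γ p q.2 ≤
      ∑ A ∈ diagonalPaths (p + 1), pathWeight β γ (2 * p + 1) A := by
    calc _ ≤ ∑ q ∈ T, pathWeight β γ (2 * p + 1) (splice p q.1 q.2) := by
          rw [Finset.mul_sum]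
          refine Finset.sum_le_sum fun q hq => ?_
          rw [pathWeight_splice (hU (hT hq).1.1).1, mul_right_comm, mul_comm (min β γ)]
          refine mul_le_mul_of_nonneg_left ?_ (mul_pos (pathWeight_pos hβ hγ p q.1)
            (pathWeight_pos hβ hγ p q.2)).le
          unfold turnWeight
          split_ifs
          · exact min_le_left _ _
          · exact min_le_right _ _
      _ = ∑ A ∈ T.image fun q => splice p q.1 q.2, pathWeight β γ (2 * p + 1) A := by
          rw [Finset.sum_image]
          intro q hq q' hq' he
          have hq := hT hq
          have hq' := hT hq'
          obtain ⟨h₁, h₂⟩ := splice_injOn (hU hq.1.1).1 (hU hq.1.2).1 (hU hq'.1.1).1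
            (hU hq'.1.2).1 he
          exact Prod.ext h₁ h₂
      _ ≤ _ := by
          refine Finset.sum_le_sum_of_subset_of_nonneg ?_ fun A _ _ =>
            (pathWeight_pos hβ hγ _ A).le
          intro A hA
          obtain ⟨q, hq, rfl⟩ := Finset.mem_image.1 hA
          obtain ⟨⟨h₁, h₂⟩, h₃⟩ := hT hq
          have h₁ := hU h₁
          have h₂ := hU h₂
          rw [diagonalPaths, Finset.mem_filter, Finset.mem_powerset]
          refine ⟨?_, (mem_splice_low (Nat.zero_le p)).2 h₁.2, ?_, card_splice h₁.1 h₂.1 h₃⟩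
          · refine Finset.union_subset (h₁.1.trans ?_) (Finset.filter_subset _ _)
            exact Finset.range_subset_range.2 (by omega)
          · rw [show 2 * (p + 1) - 1 = p + 1 + p by omega, mem_splice_high h₁.1 le_rfl,
              Nat.sub_self, not_not]
            exact h₂.2
  refine le_trans ?_ hle
  rw [← hprod, mul_div_assoc]
  refine mul_le_mul_of_nonneg_left ?_ hmin.le
  rw [div_le_iff₀ (by positivity), mul_comm 2 p, pow_mul, mul_comm]
  exact hsq

theorem sum_diagonalPaths_le (hβ : 0 < β) (hγ : 0 < γ) (p : ℕ) :
    ∑ A ∈ diagonalPaths (p + 1), pathWeight β γ (2 * p + 1) A ≤ (β + γ) ^ (2 * p + 1) := by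
  rw [← sum_pathWeight_east_first]
  refine Finset.sum_le_sum_of_subset_of_nonneg ?_ fun A _ _ => (pathWeight_pos hβ hγ _ A).le
  intro A hA
  rw [diagonalPaths, Finset.mem_filter] at hA
  exact Finset.mem_filter.2 ⟨hA.1, hA.2.1⟩

open Classical in
/-- The paths that leave a neighbourhood of the diagonal are exponentially unlikely. -/
theorem sum_not_isNarrow_le (hβ : 0 < β) (hγ : 0 < γ) {θ : ℝ} (h₀ : 0 ≤ θ) (h₁ : θ ≤ 1)
    (h₂ : β / γ * θ ≤ 1) (p : ℕ) {D : ℤ} (hD : 0 < D) :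
    ∑ A ∈ diagonalPaths (p + 1) with ¬IsNarrow (p + 1) D A, pathWeight β γ (2 * p + 1) A ≤
      (2 * p + 2) * (4 * Real.exp (2 * (1 + β / γ) * θ +
        (1 + (β / γ) ^ 2) * θ ^ 2 * (2 * p + 1) - θ * D)) * (β + γ) ^ (2 * p + 1) := by
  -- Union bound over the time of the deviation; time 0 drops out because D > 0. The constraint on
  -- the end of the path is discarded.
  have hsub : (diagonalPaths (p + 1)).filter (fun A => ¬IsNarrow (p + 1) D A) ⊆
      (Finset.range (2 * p + 2)).biUnion fun m =>
        {A ∈ (Finset.range (2 * p + 2)).powerset |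
          D ≤ |2 * ((A ∩ Finset.range (m + 1)).card : ℤ) - (m + 1 : ℕ)|} := by
    intro A hA
    rw [Finset.mem_filter, diagonalPaths, Finset.mem_filter] at hA
    obtain ⟨⟨hA, -⟩, hn⟩ := hA
    simp only [IsNarrow, not_forall, not_lt] at hn
    obtain ⟨σ, hσ, hdev⟩ := hn
    rcases σ with _ | m
    · simp [eastSteps_zero] at hdev
      omega
    · rw [Finset.mem_biUnion]
      exact ⟨m, Finset.mem_range.2 (by omega), Finset.mem_filter.2 ⟨hA, hdev⟩⟩
  have hnonneg : ∀ A, 0 ≤ pathWeight β γ (2 * p + 1) A := fun A => (pathWeight_pos hβ hγ _ A).le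
  refine (Finset.sum_le_sum_of_subset_of_nonneg hsub fun A _ _ => hnonneg A).trans ?_
  refine (sum_biUnion_le_sum _ _ hnonneg).trans ?_
  have hterm : ∀ m ∈ Finset.range (2 * p + 2),
      ∑ A ∈ (Finset.range (2 * p + 2)).powerset with
          D ≤ |2 * ((A ∩ Finset.range (m + 1)).card : ℤ) - (m + 1 : ℕ)|,
        pathWeight β γ (2 * p + 1) A ≤
      4 * Real.exp (2 * (1 + β / γ) * θ + (1 + (β / γ) ^ 2) * θ ^ 2 * (2 * p + 1) - θ * D) *
        (β + γ) ^ (2 * p + 1) := by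
    intro m hm
    have hm := Finset.mem_range.1 hm
    -- The deviation depends on the first m + 1 steps only, and the remaining k are summed out.
    obtain ⟨k, hk⟩ : ∃ k, 2 * p + 1 = m + k := ⟨2 * p + 1 - m, by omega⟩
    have hs := sum_pathWeight_add (β := β) (γ := γ) m k
      (fun A => if D ≤ |2 * (A.card : ℤ) - (m + 1 : ℕ)| then 1 else 0)
    simp only [mul_ite, mul_one, mul_zero, ← Finset.sum_filter] at hs
    rw [show m + 1 + k = 2 * p + 2 by omega, ← hk] at hs
    rw [hs]
    refine (mul_le_mul_of_nonneg_left (sum_deviating_le hβ hγ h₀ h₁ h₂ m D)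
      (by positivity)).trans ?_
    rw [hk, pow_add]
    have hm' : (m : ℝ) ≤ 2 * p + 1 := by
      have : m ≤ 2 * p + 1 := by omega
      exact_mod_cast this
    have hexp : Real.exp (2 * (1 + β / γ) * θ + (1 + (β / γ) ^ 2) * θ ^ 2 * m - θ * D) ≤
        Real.exp (2 * (1 + β / γ) * θ + (1 + (β / γ) ^ 2) * θ ^ 2 * (2 * p + 1) - θ * D) := by
      rw [Real.exp_le_exp]
      have := mul_le_mul_of_nonneg_left hm' (by positivity : 0 ≤ (1 + (β / γ) ^ 2) * θ ^ 2)
      linarith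
    have hpos : 0 ≤ 4 * ((β + γ) ^ m * (β + γ) ^ k) := by positivity
    have := mul_le_mul_of_nonneg_left hexp hpos
    linarith
  refine (Finset.sum_le_sum hterm).trans (le_of_eq ?_)
  rw [Finset.sum_const, Finset.card_range, nsmul_eq_mul]
  push_cast
  ring

end PathSums

/-! ### Orientations from height functions -/

/-- Height functions that change by at most one between adjacent faces and that are monotone in
both directions. -/
def IsUnitHeight (n : ℕ) (Y : ℕ → ℕ → ℕ) : Prop :=
  (∀ i j, i ≤ n → j < n → Y i j ≤ Y i (j + 1) ∧ Y i (j + 1) ≤ Y i j + 1) ∧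
    ∀ i j, i < n → j ≤ n → Y (i + 1) j ≤ Y i j ∧ Y i j ≤ Y (i + 1) j + 1

/-- The orientation with a given height function. -/
def ofHeight (n : ℕ) (Y : ℕ → ℕ → ℕ) : Orientation n where
  hor i j := decide (Y i j < Y i (j + 1))
  ver i j := decide (Y (i + 1) j < Y i j)

section OfHeight

variable {n : ℕ} {Y : ℕ → ℕ → ℕ}

theorem horN_ofHeight {i j : ℕ} (hi : i ≤ n) (hj : j < n) :
    (ofHeight n Y).horN i j = decide (Y i j < Y i (j + 1)) :=
  dif_pos ⟨Nat.lt_succ_of_le hi, hj⟩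

theorem verN_ofHeight {i j : ℕ} (hi : i < n) (hj : j ≤ n) :
    (ofHeight n Y).verN i j = decide (Y (i + 1) j < Y i j) :=
  dif_pos ⟨hi, Nat.lt_succ_of_le hj⟩

theorem IsUnitHeight.toNat_horN (hY : IsUnitHeight n Y) {i j : ℕ} (hi : i ≤ n) (hj : j < n) :
    Y i j + ((ofHeight n Y).horN i j).toNat = Y i (j + 1) := by
  have := hY.1 i j hi hj
  rw [horN_ofHeight hi hj]
  by_cases h : Y i j < Y i (j + 1)
  · rw [decide_eq_true h]
    simp
    omega
  · rw [decide_eq_false h]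
    simp
    omega

theorem IsUnitHeight.toNat_verN (hY : IsUnitHeight n Y) {i j : ℕ} (hi : i < n) (hj : j ≤ n) :
    Y (i + 1) j + ((ofHeight n Y).verN i j).toNat = Y i j := by
  have := hY.2 i j hi hj
  rw [verN_ofHeight hi hj]
  by_cases h : Y (i + 1) j < Y i j
  · rw [decide_eq_true h]
    simp
    omega
  · rw [decide_eq_false h]
    simp
    omega

theorem IsUnitHeight.isEulerian (hY : IsUnitHeight n Y) : (ofHeight n Y).IsEulerian := by
  rw [Orientation.isEulerian_iff]
  intro i j hi hj
  have h₁ := hY.toNat_horN (i := i) (j := j) hi.le hj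
  have h₂ := hY.toNat_horN (i := i + 1) (j := j) hi hj
  have h₃ := hY.toNat_verN (i := i) (j := j) hi hj.le
  have h₄ := hY.toNat_verN (i := i) (j := j + 1) hi hj
  omega

end OfHeight

/-- The number of positive horizontal edges that lie below a face. -/
def Orientation.belowCount {n : ℕ} (x : Orientation n) (i j : ℕ) : ℕ :=
  ∑ l ∈ Finset.range j, (x.horN i l).toNat

theorem IsUnitHeight.belowCount_eq {n : ℕ} {Y : ℕ → ℕ → ℕ} (hY : IsUnitHeight n Y)
    (h₀ : ∀ i ≤ n, Y i 0 = 0) {i j : ℕ} (hi : i ≤ n) (hj : j ≤ n) :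
    (ofHeight n Y).belowCount i j = Y i j := by
  induction j with
  | zero => simp [Orientation.belowCount, h₀ i hi]
  | succ j ih =>
    rw [← hY.toNat_horN hi hj, ← ih (by omega)]
    exact Finset.sum_range_succ _ _

/-! ### Comb boundary conditions -/

/-- Lines enter on the left in the rows `0, s, …, (K - 1) s`, and leave at the top at the opposite
ends of the corresponding diagonals. -/
def combBoundary (n K s : ℕ) : BoundaryCondition n where
  left j := decide (∃ t < K, s * t = j)
  right _ := false
  bottom _ := false
  top i := decide (∃ t < K, s * t = n - (i + 1))

/-- The number of lines that enter below height `k`. -/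
def combCount (K s k : ℕ) : ℕ := ((Finset.range K).filter fun t => s * t < k).card

section CombCount

variable {K s : ℕ}

theorem combCount_zero : combCount K s 0 = 0 := by simp [combCount]

theorem combCount_le (k : ℕ) : combCount K s k ≤ K :=
  (Finset.card_filter_le _ _).trans (Finset.card_range K).le

theorem combCount_mono {k l : ℕ} (h : k ≤ l) : combCount K s k ≤ combCount K s l :=
  Finset.card_le_card fun t ht => by
    simp only [Finset.mem_filter] at ht ⊢
    exact ⟨ht.1, by omega⟩

theorem combCount_eq {k : ℕ} (h : s * K ≤ k) (hs : 0 < s) : combCount K s k = K := by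
  rw [combCount, Finset.filter_true_of_mem, Finset.card_range]
  intro t ht
  exact (Nat.mul_lt_mul_of_pos_left (Finset.mem_range.1 ht) hs).trans_le h

theorem combCount_mul (hs : 0 < s) {t : ℕ} (ht : t ≤ K) : combCount K s (s * t) = t := by
  have : (Finset.range K).filter (fun r => s * r < s * t) = Finset.range t := by
    ext r
    simp only [Finset.mem_filter, Finset.mem_range, Nat.mul_lt_mul_left hs]
    omega
  rw [combCount, this, Finset.card_range]

/-- This makes `combCount` a rank function: inequalities between counts become inequalities between
rows. -/
theorem lt_combCount_iff (hs : 0 < s) {t k : ℕ} (ht : t < K) :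
    t < combCount K s k ↔ s * t < k := by
  constructor
  · intro h
    by_contra! hk
    have := combCount_mono (K := K) (s := s) hk
    rw [combCount_mul hs ht.le] at this
    omega
  · intro h
    have h₁ := combCount_mono (K := K) (s := s) (Nat.succ_le_of_lt h)
    refine lt_of_lt_of_le ?_ h₁
    have : (Finset.range K).filter (fun r => s * r < s * t + 1) = Finset.range (t + 1) := by
      ext r
      simp only [Finset.mem_filter, Finset.mem_range, Nat.lt_succ_iff, Nat.mul_le_mul_left_iff hs]
      omega
    rw [Nat.succ_eq_add_one, combCount, this, Finset.card_range]
    exact Nat.lt_succ_self t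

theorem combCount_lt_succ_iff (hs : 0 < s) (k : ℕ) :
    combCount K s k < combCount K s (k + 1) ↔ ∃ t < K, s * t = k := by
  constructor
  · intro h
    have ht : combCount K s k < K := h.trans_le (combCount_le _)
    refine ⟨combCount K s k, ht, ?_⟩
    have h₁ := (lt_combCount_iff hs ht).1 h
    have h₂ := (lt_combCount_iff hs ht (k := k)).not.1 (lt_irrefl _)
    omega
  · rintro ⟨t, ht, rfl⟩
    rw [combCount_mul hs ht.le]
    exact (lt_combCount_iff hs ht).2 (Nat.lt_succ_self _)

theorem combCount_succ_le (hs : 0 < s) (k : ℕ) :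
    combCount K s (k + 1) ≤ combCount K s k + 1 := by
  by_contra! h
  have ht : combCount K s k + 1 < K := h.trans_le (combCount_le _)
  have h₁ := (lt_combCount_iff hs ht).1 h
  have h₂ := (lt_combCount_iff hs (t := combCount K s k) (k := k) (by omega)).not.1 (lt_irrefl _)
  have : s * (combCount K s k + 1) = s * combCount K s k + s := by ring
  omega

theorem agrees_ofHeight {n : ℕ} (hs : 0 < s) {Y : ℕ → ℕ → ℕ}
    (hleft : ∀ j ≤ n, Y 0 j = combCount K s j) (htop : ∀ i ≤ n, Y i n = combCount K s (n - i))
    (hbot : ∀ i ≤ n, Y i 0 = 0) (hright : ∀ j ≤ n, Y n j = 0) :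
    (ofHeight n Y).Agrees (combBoundary n K s) := by
  rw [Orientation.agrees_iff]
  refine ⟨fun j => ?_, fun j => ?_, fun i => ?_, fun i => ?_⟩
  · rw [horN_ofHeight (Nat.zero_le n) j.2, hleft _ j.2.le, hleft _ j.2]
    exact decide_eq_decide.2 (combCount_lt_succ_iff hs _)
  · rw [horN_ofHeight le_rfl j.2, hright _ j.2.le, hright _ j.2]
    rfl
  · rw [verN_ofHeight i.2 (Nat.zero_le n), hbot _ i.2.le, hbot _ i.2]
    rfl
  · rw [verN_ofHeight i.2 le_rfl, htop _ i.2.le, htop _ i.2]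
    refine decide_eq_decide.2 ?_
    rw [← combCount_lt_succ_iff hs, show n - (i + 1 : ℕ) + 1 = n - i by omega]

end CombCount

/-! ### The reference state with bundled lines -/

/-- The height function of a configuration in which all lines run next to each other along the
diagonal. -/
def bundleHeight (n K s i j : ℕ) : ℕ :=
  min (min (combCount K s j) (combCount K s (n - i))) (K + j - i)

section Bundle

variable {n K s : ℕ}

/-- Each of the three terms is monotone with unit steps, and minima preserve this. The term K + j -
i (truncated at 0) drops from K to 0 across the strip j ≤ i ≤ j + K; where it is the minimum there,
all edges are positive. The other two terms are the straight legs that join the strip to the left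
and top sides. -/
theorem isUnitHeight_bundleHeight (hs : 0 < s) : IsUnitHeight n (bundleHeight n K s) := by
  constructor
  · intro i j _ _
    have h₁ := combCount_mono (K := K) (s := s) (Nat.le_succ j)
    have h₂ := combCount_succ_le (K := K) hs j
    simp only [bundleHeight, Nat.succ_eq_add_one] at *
    omega
  · intro i j hi _
    have h₁ := combCount_mono (K := K) (s := s) (Nat.le_succ (n - (i + 1)))
    have h₂ := combCount_succ_le (K := K) hs (n - (i + 1))
    rw [Nat.succ_eq_add_one, show n - (i + 1) + 1 = n - i by omega] at *
    simp only [bundleHeight]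
    omega

theorem agrees_bundleHeight (hs : 0 < s) :
    (ofHeight n (bundleHeight n K s)).Agrees (combBoundary n K s) := by
  have hK := combCount_le (K := K) (s := s)
  refine agrees_ofHeight hs (fun j hj => ?_) (fun i hi => ?_) (fun i hi => ?_) fun j hj => ?_
  · have := combCount_mono (K := K) (s := s) hj
    have := hK j
    simp only [bundleHeight, Nat.sub_zero]
    omega
  · have := combCount_mono (K := K) (s := s) (Nat.sub_le n i)
    have := hK (n - i)
    simp only [bundleHeight]
    omega
  · simp [bundleHeight, combCount_zero]
  · simp [bundleHeight, combCount_zero]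

/-- The configuration in which all lines run next to each other along the diagonal. -/
def bundleState (n K : ℕ) {s : ℕ} (hs : 0 < s) : State (combBoundary n K s) :=
  ⟨ofHeight n (bundleHeight n K s), (isUnitHeight_bundleHeight hs).isEulerian,
    agrees_bundleHeight hs⟩

end Bundle

/-! ### The lines of a state -/

section BelowCount

open SixVertex.Orientation

variable {n K s : ℕ}

theorem belowCount_zero (x : Orientation n) (i : ℕ) : x.belowCount i 0 = 0 := by
  simp [belowCount]

theorem belowCount_succ (x : Orientation n) (i j : ℕ) :
    x.belowCount i (j + 1) = x.belowCount i j + (x.horN i j).toNat :=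
  Finset.sum_range_succ _ _

theorem belowCount_mono (x : Orientation n) (i : ℕ) {j k : ℕ} (h : j ≤ k) :
    x.belowCount i j ≤ x.belowCount i k :=
  Finset.sum_le_sum_of_subset (Finset.range_subset_range.2 h)

theorem belowCount_of_le (x : Orientation n) (i : ℕ) {j : ℕ} (h : n ≤ j) :
    x.belowCount i j = x.belowCount i n := by
  induction j, h using Nat.le_induction with
  | base => rfl
  | succ j hj ih =>
    rw [belowCount_succ, ih, horN, dif_neg (by omega)]
    rfl

theorem belowCount_eq_min (x : Orientation n) (i j : ℕ) :
    x.belowCount i j = x.belowCount i (min j n) := by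
  rcases le_total j n with h | h
  · rw [min_eq_left h]
  · rw [min_eq_right h, belowCount_of_le x i h]

theorem height_eq_belowCount (x : State (combBoundary n K s)) {i : ℕ} (hi : i ≤ n) (j : ℕ) :
    x.1.height i j = x.1.belowCount i j := by
  have h := ((agrees_iff _ _).1 x.2.2).2.2.1
  have h₀ : ∑ k ∈ Finset.range i, ((x.1.verN k 0).toNat : ℤ) = 0 := by
    refine Finset.sum_eq_zero fun k hk => ?_
    have hk := Finset.mem_range.1 hk
    have := h ⟨k, by omega⟩
    simp only at this
    rw [this]
    rfl
  rw [height, h₀, belowCount]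
  push_cast
  ring

/-- Boundary heights depend on the boundary condition alone, so they can be read off from the
bundled state. -/
theorem belowCount_boundary (hs : 0 < s) (x : State (combBoundary n K s)) {i j : ℕ}
    (hi : i ≤ n) (hj : j ≤ n) (h : i = 0 ∨ i = n ∨ j = 0 ∨ j = n) :
    x.1.belowCount i j = bundleHeight n K s i j := by
  have h₁ := height_eq_of_agrees x.2.1 (bundleState n K hs).2.1 x.2.2 (bundleState n K hs).2.2
    hi hj h
  rw [height_eq_belowCount x hi, height_eq_belowCount _ hi] at h₁
  have h₂ := (isUnitHeight_bundleHeight (n := n) (K := K) hs).belowCount_eq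
    (fun i _ => by simp [bundleHeight, combCount_zero]) hi hj
  rw [← h₂]
  exact_mod_cast h₁

theorem belowCount_left (hs : 0 < s) (x : State (combBoundary n K s)) {j : ℕ} (hj : j ≤ n) :
    x.1.belowCount 0 j = combCount K s j := by
  rw [belowCount_boundary hs x (Nat.zero_le n) hj (Or.inl rfl)]
  have := combCount_mono (K := K) (s := s) hj
  have := combCount_le (K := K) (s := s) j
  simp only [bundleHeight, Nat.sub_zero]
  omega

theorem belowCount_top (hs : 0 < s) (x : State (combBoundary n K s)) {i : ℕ} (hi : i ≤ n) :
    x.1.belowCount i n = combCount K s (n - i) := by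
  rw [belowCount_boundary hs x hi le_rfl (by tauto)]
  have := combCount_mono (K := K) (s := s) (Nat.sub_le n i)
  have := combCount_le (K := K) (s := s) (n - i)
  simp only [bundleHeight]
  omega

theorem belowCount_of_right (hs : 0 < s) (x : State (combBoundary n K s)) {i : ℕ} (hi : n ≤ i)
    (j : ℕ) : x.1.belowCount i j = 0 := by
  rcases hi.eq_or_lt with rfl | hi
  · rw [belowCount_eq_min, belowCount_boundary hs x le_rfl (min_le_right _ _) (by tauto)]
    simp [bundleHeight, combCount_zero]
  · refine Finset.sum_eq_zero fun l _ => ?_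
    rw [horN, dif_neg (by omega)]
    rfl

theorem belowCount_succ_left (hs : 0 < s) (x : State (combBoundary n K s)) (i j : ℕ) :
    x.1.belowCount (i + 1) j ≤ x.1.belowCount i j ∧
      x.1.belowCount i j ≤ x.1.belowCount (i + 1) j + 1 := by
  rcases lt_or_ge i n with hi | hi
  · rw [belowCount_eq_min x.1 i, belowCount_eq_min x.1 (i + 1)]
    have h := x.2.1.height_succ_left hi (min_le_right j n)
    rw [height_eq_belowCount x hi.le, height_eq_belowCount x (Nat.succ_le_of_lt hi)] at h
    simp only [Nat.succ_eq_add_one] at h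
    have := Bool.toNat_le (x.1.verN i (min j n))
    omega
  · rw [belowCount_of_right hs x hi, belowCount_of_right hs x (by omega)]
    omega

theorem belowCount_le (hs : 0 < s) (x : State (combBoundary n K s)) (i j : ℕ) :
    x.1.belowCount i j ≤ K := by
  have : x.1.belowCount i j ≤ x.1.belowCount 0 j := by
    induction i with
    | zero => exact le_rfl
    | succ i ih => exact (belowCount_succ_left hs x i j).1.trans ih
  refine this.trans ?_
  rw [belowCount_eq_min, belowCount_left hs x (min_le_right _ _)]
  exact combCount_le _

/-- Moving right and moving down both lower the count. Along an antidiagonal the faces above a given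
line are thus an initial segment, whose length locates the line. Once k exceeds R the truncated row
is 0. -/
theorem belowCount_antidiagonal_le (hs : 0 < s) (x : State (combBoundary n K s)) (R : ℕ)
    {i k : ℕ} (h : i ≤ k) : x.1.belowCount k (R - k) ≤ x.1.belowCount i (R - i) := by
  induction k, h using Nat.le_induction with
  | base => exact le_rfl
  | succ k _ ih =>
    exact ((belowCount_succ_left hs x k _).1.trans (belowCount_mono x.1 k (by omega))).trans ih

theorem lt_card_filter_range_iff {n : ℕ} {p : ℕ → Prop} [DecidablePred p]
    (hp : ∀ i k, i ≤ k → p k → p i) (hn : ∀ i, p i → i < n) (i : ℕ) :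
    i < ((Finset.range n).filter p).card ↔ p i := by
  have hex : ∃ i, ¬p i := ⟨n, fun h => lt_irrefl n (hn n h)⟩
  have hiff : ∀ k, k < Nat.find hex ↔ p k := fun k => by
    rw [Nat.lt_find_iff]
    constructor
    · intro h
      exact not_not.1 (h k le_rfl)
    · intro h m hm
      exact not_not.2 (hp m k hm h)
  have : (Finset.range n).filter p = Finset.range (Nat.find hex) := by
    ext k
    rw [Finset.mem_filter, Finset.mem_range, Finset.mem_range, hiff]
    exact ⟨fun h => h.2, fun h => ⟨hn k h, h⟩⟩
  rw [this, Finset.card_range, hiff]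

/-- The number of steps to the east among the first `σ` steps of line `t`. -/
def lineEast (s : ℕ) (x : Orientation n) (t σ : ℕ) : ℕ :=
  ((Finset.range n).filter fun i => t < x.belowCount i (s * t + σ - i)).card

theorem lt_lineEast_iff (hs : 0 < s) (x : State (combBoundary n K s)) (t σ i : ℕ) :
    i < lineEast s x.1 t σ ↔ t < x.1.belowCount i (s * t + σ - i) := by
  refine lt_card_filter_range_iff (fun i k hik h =>
    h.trans_le (belowCount_antidiagonal_le hs x _ hik)) (fun i h => ?_) i
  by_contra! hi
  rw [belowCount_of_right hs x hi] at h
  omega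

theorem lineEast_zero (hs : 0 < s) (hK : s * K ≤ n) (x : State (combBoundary n K s)) {t : ℕ}
    (ht : t < K) : lineEast s x.1 t 0 = 0 := by
  by_contra h
  have h := (lt_lineEast_iff hs x t 0 0).1 (Nat.pos_of_ne_zero h)
  have := Nat.mul_le_mul_left s ht.le
  rw [add_zero, Nat.sub_zero, belowCount_left hs x (by omega), combCount_mul hs ht.le] at h
  exact lt_irrefl _ h

theorem lineEast_le_succ (hs : 0 < s) (x : State (combBoundary n K s)) (t σ : ℕ) :
    lineEast s x.1 t σ ≤ lineEast s x.1 t (σ + 1) := by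
  refine le_of_forall_lt fun i hi => ?_
  rw [lt_lineEast_iff hs] at hi ⊢
  exact hi.trans_le (belowCount_mono x.1 i (by omega))

theorem lineEast_succ_le (hs : 0 < s) (x : State (combBoundary n K s)) (t σ : ℕ) :
    lineEast s x.1 t (σ + 1) ≤ lineEast s x.1 t σ + 1 := by
  refine le_of_forall_lt fun i hi => ?_
  rcases i with _ | i
  · omega
  · rw [lt_lineEast_iff hs] at hi
    have : i < lineEast s x.1 t σ := by
      rw [lt_lineEast_iff hs]
      have h := (belowCount_succ_left hs x i (s * t + (σ + 1) - (i + 1))).1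
      rw [show s * t + (σ + 1) - (i + 1) = s * t + σ - i by omega] at h hi
      omega
    omega

theorem lineEast_one (hs : 0 < s) (hK : s * K ≤ n) (x : State (combBoundary n K s)) {t : ℕ}
    (ht : t < K) : lineEast s x.1 t 1 = 1 := by
  have h₀ := lineEast_zero hs hK x ht
  have h₁ := lineEast_succ_le hs x t 0
  have h₂ : 0 < lineEast s x.1 t 1 := by
    rw [lt_lineEast_iff hs]
    have := Nat.mul_lt_mul_of_pos_left ht hs
    rw [Nat.sub_zero, belowCount_left hs x (by omega), lt_combCount_iff hs ht]
    omega
  rw [zero_add] at h₁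
  omega

/-- All east steps have been made one step before the end, since the last step leaves through the
top side and leads north. -/
theorem lineEast_of_le (hs : 0 < s) (hK : s * K ≤ n) (x : State (combBoundary n K s)) {t : ℕ}
    (ht : t < K) {σ : ℕ} (hσ : 2 * (n - s * t) - 1 ≤ σ) :
    lineEast s x.1 t σ = n - s * t := by
  have hlt := Nat.mul_lt_mul_of_pos_left ht hs
  refine le_antisymm (le_of_not_gt fun h => ?_) ?_
  · rw [lt_lineEast_iff hs] at h
    have h₁ : x.1.belowCount (n - s * t) (s * t + σ - (n - s * t)) ≤
        x.1.belowCount (n - s * t) n := by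
      rw [belowCount_eq_min]
      exact belowCount_mono _ _ (min_le_right _ _)
    rw [belowCount_top hs x (Nat.sub_le _ _), show n - (n - s * t) = s * t by omega,
      combCount_mul hs ht.le] at h₁
    omega
  · have h : n - s * t - 1 < lineEast s x.1 t σ := by
      rw [lt_lineEast_iff hs, belowCount_of_le _ _ (by omega), belowCount_top hs x (by omega),
        lt_combCount_iff hs ht]
      omega
    omega

/-- Face `(i, j)` lies above line `t` if and only if the line has passed it on the right. -/
theorem lt_belowCount_iff (hs : 0 < s) (hK : s * K ≤ n) (x : State (combBoundary n K s)) {t : ℕ}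
    (ht : t < K) (i j : ℕ) :
    t < x.1.belowCount i j ↔ i < lineEast s x.1 t (i + j - s * t) := by
  rcases le_or_gt (s * t) (i + j) with h | h
  · rw [lt_lineEast_iff hs, show s * t + (i + j - s * t) - i = j by omega]
  · rw [show i + j - s * t = 0 by omega, lineEast_zero hs hK x ht]
    refine iff_of_false (fun hlt => ?_) (by omega)
    have h₁ := belowCount_antidiagonal_le hs x (i + j) (Nat.zero_le i)
    have := Nat.mul_lt_mul_of_pos_left ht hs
    rw [Nat.add_sub_cancel_left, Nat.sub_zero, belowCount_left hs x (by omega)] at h₁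
    have := (lt_combCount_iff hs ht).1 (hlt.trans_le h₁)
    omega

/-- A reversal moves each line by at most one step at any time. -/
theorem lineEast_flip (hs : 0 < s) (x : State (combBoundary n K s)) {q : Cell n}
    (hq : x.1.IsCycle q) (t σ : ℕ) :
    lineEast s (x.flip hq).1 t σ ≤ lineEast s x.1 t σ + 1 ∧
      lineEast s x.1 t σ ≤ lineEast s (x.flip hq).1 t σ + 1 := by
  -- A reversal changes counts in a single column. On each antidiagonal it affects at most one face,
  -- so the initial segment changes its length by at most one.
  have hB : ∀ i j, i ≠ (q.1 : ℕ) + 1 → (x.flip hq).1.belowCount i j = x.1.belowCount i j :=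
    fun i j hi => Finset.sum_congr rfl fun l _ => by
      rw [State.flip, horN_flip, if_neg (by omega)]
  have key : ∀ y z : State (combBoundary n K s),
      (∀ i j, i ≠ (q.1 : ℕ) + 1 → y.1.belowCount i j = z.1.belowCount i j) →
      lineEast s y.1 t σ ≤ lineEast s z.1 t σ + 1 := by
    intro y z hyz
    by_contra! h
    have h₁ := (lt_lineEast_iff hs y t σ (lineEast s z.1 t σ)).1 (by omega)
    have h₂ := (lt_lineEast_iff hs y t σ (lineEast s z.1 t σ + 1)).1 h
    have h₃ := (lt_lineEast_iff hs z t σ (lineEast s z.1 t σ)).not.1 (by omega)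
    have h₄ := (lt_lineEast_iff hs z t σ (lineEast s z.1 t σ + 1)).not.1 (by omega)
    by_cases he : lineEast s z.1 t σ = (q.1 : ℕ) + 1
    · rw [hyz _ _ (by omega)] at h₂
      exact h₄ h₂
    · rw [hyz _ _ he] at h₁
      exact h₃ h₁
  exact ⟨key _ _ hB, key _ _ fun i j hi => (hB i j hi).symm⟩

end BelowCount

/-! ### Families of separated lines -/

theorem eastSteps_mono (A : Finset ℕ) {σ τ : ℕ} (h : σ ≤ τ) : eastSteps A σ ≤ eastSteps A τ :=
  Finset.card_le_card (Finset.inter_subset_inter_left (Finset.range_subset_range.2 h))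

theorem eastSteps_le_add (A : Finset ℕ) {σ τ : ℕ} (h : σ ≤ τ) :
    eastSteps A τ ≤ eastSteps A σ + (τ - σ) := by
  induction τ, h using Nat.le_induction with
  | base => omega
  | succ τ h ih =>
    rw [eastSteps_succ]
    split_ifs <;> omega

theorem eastSteps_le (A : Finset ℕ) (σ : ℕ) : eastSteps A σ ≤ σ := by
  have := eastSteps_le_add A (Nat.zero_le σ)
  rw [eastSteps_zero] at this
  omega

section DiagonalPath

variable {l : ℕ} {A : Finset ℕ}

theorem eastSteps_of_last_le (hA : A ∈ diagonalPaths l) {σ : ℕ} (hσ : 2 * l - 1 ≤ σ) :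
    eastSteps A σ = l := by
  simp only [diagonalPaths, Finset.mem_filter, Finset.mem_powerset] at hA
  rw [eastSteps, Finset.inter_eq_left.2, hA.2.2.2]
  intro k hk
  have h₁ := Finset.mem_range.1 (hA.1 hk)
  have h₂ : k ≠ 2 * l - 1 := fun h => hA.2.2.1 (h ▸ hk)
  exact Finset.mem_range.2 (by omega)

theorem eastSteps_le_half (hA : A ∈ diagonalPaths l) (σ : ℕ) : eastSteps A σ ≤ l := by
  refine (eastSteps_mono A (le_max_left σ (2 * l - 1))).trans ?_
  rw [eastSteps_of_last_le hA (le_max_right _ _)]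

theorem one_le_eastSteps (hA : A ∈ diagonalPaths l) {σ : ℕ} (hσ : 1 ≤ σ) : 1 ≤ eastSteps A σ := by
  simp only [diagonalPaths, Finset.mem_filter] at hA
  have := eastSteps_mono A hσ
  rw [← zero_add 1, eastSteps_succ, eastSteps_zero, zero_add, if_pos hA.2.1] at this
  exact this

theorem le_eastSteps_add (hA : A ∈ diagonalPaths l) (hl : 0 < l) {σ : ℕ} (hσ : σ ≤ 2 * l - 1) :
    σ ≤ eastSteps A σ + (l - 1) := by
  have := eastSteps_le_add A hσ
  rw [eastSteps_of_last_le hA le_rfl] at this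
  omega

end DiagonalPath

theorem mem_narrowPaths {l : ℕ} {D : ℤ} {A : Finset ℕ} :
    A ∈ narrowPaths l D ↔ A ∈ diagonalPaths l ∧ IsNarrow l D A := by
  simp [narrowPaths]

/-- The number of lines below a face. -/
def pathHeight {K : ℕ} (s : ℕ) (p : Fin K → Finset ℕ) (i j : ℕ) : ℕ :=
  (Finset.univ.filter fun t : Fin K => i < eastSteps (p t) (i + j - s * t)).card

section PathHeight

variable {K s : ℕ} {p : Fin K → Finset ℕ}

/-- A line separating the faces (i, j) and (i, j + 1) uses the edge between them as its step `i + j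
- s * t`, which leads east into the vertex (i, j). The line is at that vertex exactly when it has
made i + 1 east steps after `i + j + 1 - s * t` steps, because its first step already enters column
0. -/
theorem east_of_lt {i j : ℕ} {t : Fin K} (h : i < eastSteps (p t) (i + (j + 1) - s * t))
    (h' : ¬i < eastSteps (p t) (i + j - s * t)) :
    s * t ≤ i + j ∧ i + j - s * t ∈ p t ∧ eastSteps (p t) (i + j + 1 - s * t) = i + 1 ∧
      eastSteps (p t) (i + j - s * t) = i := by
  have h₀ : s * t < i + j + 1 := by
    by_contra! hle
    rw [Nat.sub_eq_zero_of_le (by omega), eastSteps_zero] at h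
    omega
  rw [show i + (j + 1) - s * t = i + j - s * t + 1 by omega, eastSteps_succ] at h
  rw [show i + j + 1 - s * t = i + j - s * t + 1 by omega, eastSteps_succ]
  split_ifs at h with hmem
  · rw [if_pos hmem]
    exact ⟨by omega, hmem, by omega, by omega⟩
  · omega

theorem north_of_lt {i j : ℕ} {t : Fin K} (h : i < eastSteps (p t) (i + j - s * t))
    (h' : ¬i + 1 < eastSteps (p t) (i + 1 + j - s * t)) :
    s * t ≤ i + j ∧ i + j - s * t ∉ p t ∧ eastSteps (p t) (i + j + 1 - s * t) = i + 1 ∧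
      eastSteps (p t) (i + j - s * t) = i + 1 := by
  have h₀ : s * t < i + j := by
    by_contra! hle
    rw [Nat.sub_eq_zero_of_le (by omega), eastSteps_zero] at h
    omega
  rw [show i + 1 + j - s * t = i + j - s * t + 1 by omega, eastSteps_succ] at h'
  rw [show i + j + 1 - s * t = i + j - s * t + 1 by omega, eastSteps_succ]
  split_ifs at h' with hmem
  · omega
  · rw [if_neg hmem]
    exact ⟨by omega, hmem, by omega, by omega⟩

theorem pathHeight_hor_subset (i j : ℕ) :
    (Finset.univ.filter fun t : Fin K => i < eastSteps (p t) (i + j - s * t)) ⊆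
      Finset.univ.filter fun t : Fin K => i < eastSteps (p t) (i + (j + 1) - s * t) := by
  intro t ht
  rw [Finset.mem_filter] at ht ⊢
  exact ⟨ht.1, ht.2.trans_le (eastSteps_mono _ (by omega))⟩

theorem pathHeight_ver_subset (i j : ℕ) :
    (Finset.univ.filter fun t : Fin K => i + 1 < eastSteps (p t) (i + 1 + j - s * t)) ⊆
      Finset.univ.filter fun t : Fin K => i < eastSteps (p t) (i + j - s * t) := by
  intro t ht
  rw [Finset.mem_filter] at ht ⊢
  have := eastSteps_le_add (p t) (show i + j - s * t ≤ i + 1 + j - s * t by omega)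
  exact ⟨ht.1, by omega⟩

theorem pathHeight_lt_up_iff (i j : ℕ) : pathHeight s p i j < pathHeight s p i (j + 1) ↔
    ∃ t, i < eastSteps (p t) (i + (j + 1) - s * t) ∧ ¬i < eastSteps (p t) (i + j - s * t) := by
  constructor
  · intro h
    obtain ⟨t, h₁, h₂⟩ := Finset.exists_mem_notMem_of_card_lt_card h
    exact ⟨t, (Finset.mem_filter.1 h₁).2, fun h => h₂ (Finset.mem_filter.2 ⟨Finset.mem_univ t, h⟩)⟩
  · rintro ⟨t, h₁, h₂⟩
    refine Finset.card_lt_card ((Finset.ssubset_iff_of_subset (pathHeight_hor_subset i j)).2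
      ⟨t, Finset.mem_filter.2 ⟨Finset.mem_univ t, h₁⟩, fun h => h₂ (Finset.mem_filter.1 h).2⟩)

theorem pathHeight_lt_left_iff (i j : ℕ) : pathHeight s p (i + 1) j < pathHeight s p i j ↔
    ∃ t, i < eastSteps (p t) (i + j - s * t) ∧ ¬i + 1 < eastSteps (p t) (i + 1 + j - s * t) := by
  constructor
  · intro h
    obtain ⟨t, h₁, h₂⟩ := Finset.exists_mem_notMem_of_card_lt_card h
    exact ⟨t, (Finset.mem_filter.1 h₁).2, fun h => h₂ (Finset.mem_filter.2 ⟨Finset.mem_univ t, h⟩)⟩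
  · rintro ⟨t, h₁, h₂⟩
    refine Finset.card_lt_card ((Finset.ssubset_iff_of_subset (pathHeight_ver_subset i j)).2
      ⟨t, Finset.mem_filter.2 ⟨Finset.mem_univ t, h₁⟩, fun h => h₂ (Finset.mem_filter.1 h).2⟩)

theorem pathHeight_zero (i : ℕ) : pathHeight s p i 0 = 0 := by
  rw [pathHeight, Finset.card_eq_zero, Finset.filter_eq_empty_iff]
  intro t _ h
  have := eastSteps_le (p t) (i + 0 - s * t)
  omega

theorem pathHeight_le (i j : ℕ) : pathHeight s p i j ≤ K :=
  (Finset.card_filter_le _ _).trans (by simp)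

end PathHeight

/-- A family of lines that start in the rows `0, s, …, (K - 1) s` and stay close to the respective
diagonals, far away from each other. -/
structure IsSeparated {K : ℕ} (n s D : ℕ) (p : Fin K → Finset ℕ) : Prop where
  spacing_pos : 0 < s
  fits : s * K ≤ n
  spacing : 2 * D ≤ s
  mem : ∀ t : Fin K, p t ∈ narrowPaths (n - s * t) D

namespace IsSeparated

variable {K n s D : ℕ} {p : Fin K → Finset ℕ} (hp : IsSeparated n s D p)
include hp

theorem mul_lt (t : Fin K) : s * t < n :=
  (Nat.mul_lt_mul_of_pos_left t.2 hp.spacing_pos).trans_le hp.fits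

theorem diag (t : Fin K) : p t ∈ diagonalPaths (n - s * t) := (mem_narrowPaths.1 (hp.mem t)).1

theorem narrow (t : Fin K) : IsNarrow (n - s * t) D (p t) := (mem_narrowPaths.1 (hp.mem t)).2

theorem mul_add_le {t t' : Fin K} (h : t < t') : s * t + 2 * D ≤ s * t' := by
  have h₁ : s * (t + 1) ≤ s * (t' : ℕ) := Nat.mul_le_mul_left s h
  have h₂ := hp.spacing
  rw [mul_add, mul_one] at h₁
  omega

/-- At most one line passes through the vertex `(i, j)`. -/
theorem eq_of_visit {i j : ℕ} (hj : j < n) {t t' : Fin K}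
    (h : eastSteps (p t) (i + j + 1 - s * t) = i + 1)
    (h' : eastSteps (p t') (i + j + 1 - s * t') = i + 1) : t = t' := by
  -- A visiting line has its diagonal within D of the vertex, whereas distinct diagonals are at
  -- least 2D apart.
  have key : ∀ t : Fin K, eastSteps (p t) (i + j + 1 - s * t) = i + 1 →
      |2 * ((i : ℤ) + 1) - (i + j + 1 - s * t)| < D := by
    intro t h
    have hlt := hp.mul_lt t
    have h₀ : s * t < i + j + 1 := by
      by_contra! hle
      rw [Nat.sub_eq_zero_of_le hle, eastSteps_zero] at h
      omega
    have h₁ : i + j + 1 - s * t ≤ 2 * (n - s * t) := by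
      by_contra! hgt
      rw [eastSteps_of_last_le (hp.diag t) (by omega)] at h
      omega
    have h₂ := hp.narrow t _ h₁
    rw [h] at h₂
    push_cast [h₀.le] at h₂
    exact h₂
  have e := abs_lt.1 (key t h)
  have e' := abs_lt.1 (key t' h')
  rcases lt_trichotomy t t' with hlt | heq | hlt
  · have h := hp.mul_add_le hlt
    zify at h
    linarith [e.1, e.2, e'.1, e'.2]
  · exact heq
  · have h := hp.mul_add_le hlt
    zify at h
    linarith [e.1, e.2, e'.1, e'.2]

/-- Lines do not cross. -/
theorem lt_eastSteps_of_lt {i j : ℕ} {t t' : Fin K} (htt : t' < t)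
    (h : i < eastSteps (p t) (i + j - s * t)) : i < eastSteps (p t') (i + j - s * t') := by
  have h₁ := hp.mul_add_le htt
  have h₂ := hp.mul_lt t
  have h₃ := eastSteps_le_half (hp.diag t) (i + j - s * t)
  have h₀ : s * t < i + j := by
    by_contra! hle
    rw [Nat.sub_eq_zero_of_le hle, eastSteps_zero] at h
    omega
  rcases le_or_gt (2 * (n - s * t')) (i + j - s * t') with h₄ | h₄
  · rw [eastSteps_of_last_le (hp.diag t') (by omega)]
    omega
  · have e' := (abs_lt.1 (hp.narrow t' _ h₄.le)).1
    rcases le_or_gt (i + j - s * t) (2 * (n - s * t)) with h₅ | h₅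
    · have e := (abs_lt.1 (hp.narrow t _ h₅)).2
      omega
    · omega

/-- Since the lines are ordered, those below a face are an initial segment of the indices, so their
number determines them. -/
theorem lt_pathHeight_iff (t : Fin K) (i j : ℕ) :
    (t : ℕ) < pathHeight s p i j ↔ i < eastSteps (p t) (i + j - s * t) := by
  constructor
  · intro h
    by_contra hn
    have hsub : (Finset.univ.filter fun r : Fin K => i < eastSteps (p r) (i + j - s * r)) ⊆
        Finset.Iio t := by
      intro r hr
      rw [Finset.mem_Iio]
      by_contra! hle
      have hr := (Finset.mem_filter.1 hr).2
      rcases hle.eq_or_lt with rfl | hlt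
      · exact hn hr
      · exact hn (hp.lt_eastSteps_of_lt hlt hr)
    have := Finset.card_le_card hsub
    rw [Fin.card_Iio] at this
    exact absurd h (not_lt.2 this)
  · intro h
    have hsub : Finset.Iic t ⊆
        Finset.univ.filter fun r : Fin K => i < eastSteps (p r) (i + j - s * r) := by
      intro r hr
      refine Finset.mem_filter.2 ⟨Finset.mem_univ r, ?_⟩
      rcases (Finset.mem_Iic.1 hr).eq_or_lt with rfl | hlt
      · exact h
      · exact hp.lt_eastSteps_of_lt hlt h
    have := Finset.card_le_card hsub
    rw [Fin.card_Iic] at this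
    exact this

theorem isUnitHeight : IsUnitHeight n (pathHeight s p) := by
  constructor
  · intro i j _ hj
    refine ⟨Finset.card_le_card (pathHeight_hor_subset i j), ?_⟩
    have h := Finset.card_sdiff_add_card_eq_card (pathHeight_hor_subset (s := s) (p := p) i j)
    have h₁ : ((Finset.univ.filter fun t : Fin K => i < eastSteps (p t) (i + (j + 1) - s * t)) \
        Finset.univ.filter fun t : Fin K => i < eastSteps (p t) (i + j - s * t)).card ≤ 1 := by
      rw [Finset.card_le_one]
      intro t ht t' ht'
      simp only [Finset.mem_sdiff, Finset.mem_filter, Finset.mem_univ, true_and] at ht ht'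
      exact hp.eq_of_visit hj (east_of_lt ht.1 ht.2).2.2.1 (east_of_lt ht'.1 ht'.2).2.2.1
    unfold pathHeight
    omega
  · intro i j _ hj
    refine ⟨Finset.card_le_card (pathHeight_ver_subset i j), ?_⟩
    have h := Finset.card_sdiff_add_card_eq_card (pathHeight_ver_subset (s := s) (p := p) i j)
    have h₁ : ((Finset.univ.filter fun t : Fin K => i < eastSteps (p t) (i + j - s * t)) \
        Finset.univ.filter fun t : Fin K =>
          i + 1 < eastSteps (p t) (i + 1 + j - s * t)).card ≤ 1 := by
      rw [Finset.card_le_one]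
      intro t ht t' ht'
      simp only [Finset.mem_sdiff, Finset.mem_filter, Finset.mem_univ, true_and] at ht ht'
      have v := north_of_lt ht.1 ht.2
      have v' := north_of_lt ht'.1 ht'.2
      rcases hj.lt_or_eq with hj | rfl
      · exact hp.eq_of_visit hj v.2.2.1 v'.2.2.1
      -- No vertex lies above the topmost edges, so uniqueness is taken from the vertex below, from
      -- which the step departs.
      · obtain ⟨j, rfl⟩ : ∃ k, j = k + 1 := ⟨j - 1, by have := hp.mul_lt t; omega⟩
        have w := v.2.2.2
        have w' := v'.2.2.2
        rw [← add_assoc] at w w'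
        exact hp.eq_of_visit (Nat.lt_succ_self j) w w'
    unfold pathHeight
    omega

theorem eq_combCount_of_forall {Y k : ℕ} (hY : Y ≤ K)
    (h : ∀ t : Fin K, (t : ℕ) < Y ↔ s * t < k) : Y = combCount K s k := by
  refine le_antisymm (le_of_forall_lt fun t ht => ?_) (le_of_forall_lt fun t ht => ?_)
  · have htK := ht.trans_le hY
    exact (lt_combCount_iff hp.spacing_pos htK).2 ((h ⟨t, htK⟩).1 ht)
  · have htK := ht.trans_le (combCount_le k)
    exact (h ⟨t, htK⟩).2 ((lt_combCount_iff hp.spacing_pos htK).1 ht)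

theorem lt_eastSteps_top_iff (t : Fin K) (i : ℕ) :
    i < eastSteps (p t) (i + n - s * t) ↔ i < n - s * t := by
  have hlt := hp.mul_lt t
  constructor
  · exact fun h => h.trans_le (eastSteps_le_half (hp.diag t) _)
  · intro h
    have := le_eastSteps_add (hp.diag t) (σ := i + n - s * t) (by omega) (by omega)
    omega

theorem agrees : (ofHeight n (pathHeight s p)).Agrees (combBoundary n K s) := by
  refine agrees_ofHeight hp.spacing_pos (fun j _ => ?_) (fun i _ => ?_)
    (fun i _ => pathHeight_zero i) fun j _ => ?_
  · refine hp.eq_combCount_of_forall (pathHeight_le 0 j) fun t => ?_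
    rw [hp.lt_pathHeight_iff]
    constructor
    · intro h
      have := eastSteps_le (p t) (0 + j - s * t)
      omega
    · intro h
      exact one_le_eastSteps (hp.diag t) (by omega)
  · refine hp.eq_combCount_of_forall (pathHeight_le i n) fun t => ?_
    rw [hp.lt_pathHeight_iff, hp.lt_eastSteps_top_iff]
    omega
  · rw [pathHeight, Finset.card_eq_zero, Finset.filter_eq_empty_iff]
    intro t _ h
    have := eastSteps_le_half (hp.diag t) (n + j - s * t)
    omega

/-- The configuration that consists of a family of separated lines. -/
def state : State (combBoundary n K s) :=
  ⟨ofHeight n (pathHeight s p), hp.isUnitHeight.isEulerian, hp.agrees⟩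

theorem belowCount_state {i j : ℕ} (hi : i ≤ n) (hj : j ≤ n) :
    hp.state.1.belowCount i j = pathHeight s p i j :=
  hp.isUnitHeight.belowCount_eq (fun i _ => pathHeight_zero i) hi hj

theorem lineEast_state (t : Fin K) (σ : ℕ) :
    lineEast s hp.state.1 t σ = eastSteps (p t) σ := by
  have hlt := hp.mul_lt t
  have h₁ := eastSteps_le_half (hp.diag t) σ
  have h₂ := eastSteps_le (p t) σ
  have key : ∀ i, i < lineEast s hp.state.1 t σ ↔ i < eastSteps (p t) σ := by
    intro i
    rw [lt_lineEast_iff hp.spacing_pos]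
    rcases le_or_gt n i with hi | hi
    · rw [belowCount_of_right hp.spacing_pos _ hi]
      omega
    rcases le_or_gt i (s * t + σ) with hi' | hi'
    · rcases le_or_gt (s * t + σ - i) n with hj | hj
      · rw [hp.belowCount_state hi.le hj, hp.lt_pathHeight_iff,
          show i + (s * t + σ - i) - s * t = σ by omega]
      -- Faces above the lattice inherit the count of the top row. There both sides amount to i < n
      -- - s * t, as the line has finished its east steps.
      · rw [belowCount_of_le _ _ hj.le, hp.belowCount_state hi.le le_rfl, hp.lt_pathHeight_iff,
          hp.lt_eastSteps_top_iff]
        constructor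
        · intro h
          refine ((hp.lt_eastSteps_top_iff t i).2 h).trans_le (eastSteps_mono _ (by omega))
        · exact fun h => h.trans_le h₁
    · rw [Nat.sub_eq_zero_of_le hi'.le, belowCount_zero]
      omega
  exact le_antisymm (le_of_forall_lt fun i hi => (key i).1 hi)
    (le_of_forall_lt fun i hi => (key i).2 hi)

end IsSeparated

theorem mem_iff_eastSteps_lt (A : Finset ℕ) (k : ℕ) :
    k ∈ A ↔ eastSteps A k < eastSteps A (k + 1) := by
  rw [eastSteps_succ]
  split_ifs with h <;> simp [h]

theorem IsSeparated.eq_of_state_eq {K n s D : ℕ} {p p' : Fin K → Finset ℕ}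
    (hp : IsSeparated n s D p) (hp' : IsSeparated n s D p') (h : hp.state = hp'.state) : p = p' := by
  funext t
  ext k
  rw [mem_iff_eastSteps_lt, mem_iff_eastSteps_lt, ← hp.lineEast_state, ← hp.lineEast_state,
    ← hp'.lineEast_state, ← hp'.lineEast_state, h]

/-! ### From separated states back to families of paths -/

/-- The states all of whose lines stay close to the respective diagonals. -/
def separatedStates (n K s D : ℕ) : Set (State (combBoundary n K s)) :=
  {x | ∀ t < K, ∀ σ ≤ 2 * (n - s * t), |2 * (lineEast s x.1 t σ : ℤ) - σ| < D}

/-- The path of line `t`. -/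
def linePath (n s : ℕ) (x : Orientation n) (t : ℕ) : Finset ℕ :=
  (Finset.range (2 * (n - s * t))).filter fun k => lineEast s x t k < lineEast s x t (k + 1)

section LinePath

variable {n K s D : ℕ}

theorem eastSteps_linePath (hs : 0 < s) (hK : s * K ≤ n) (x : State (combBoundary n K s)) {t : ℕ}
    (ht : t < K) {σ : ℕ} (hσ : σ ≤ 2 * (n - s * t)) :
    eastSteps (linePath n s x.1 t) σ = lineEast s x.1 t σ := by
  induction σ with
  | zero => rw [eastSteps_zero, lineEast_zero hs hK x ht]
  | succ σ ih =>
    have h₁ := lineEast_le_succ hs x t σ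
    have h₂ := lineEast_succ_le hs x t σ
    rw [eastSteps_succ, ih (by omega)]
    simp only [linePath, Finset.mem_filter, Finset.mem_range]
    split_ifs with h <;> omega

theorem linePath_mem_diagonalPaths (hs : 0 < s) (hK : s * K ≤ n)
    (x : State (combBoundary n K s)) {t : ℕ} (ht : t < K) :
    linePath n s x.1 t ∈ diagonalPaths (n - s * t) := by
  have hlt := (Nat.mul_lt_mul_of_pos_left ht hs).trans_le hK
  have h₀ := lineEast_zero hs hK x ht
  have h₁ := lineEast_one hs hK x ht
  have h₂ := lineEast_of_le hs hK x ht (σ := 2 * (n - s * t) - 1) le_rfl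
  have h₃ := lineEast_of_le hs hK x ht (σ := 2 * (n - s * t)) (by omega)
  have hsub : linePath n s x.1 t ⊆ Finset.range (2 * (n - s * t)) := Finset.filter_subset _ _
  have h₄ := eastSteps_linePath hs hK x ht le_rfl
  rw [eastSteps, Finset.inter_eq_left.2 hsub] at h₄
  refine Finset.mem_filter.2 ⟨Finset.mem_powerset.2 hsub, ?_, ?_, h₄.trans h₃⟩
  · exact Finset.mem_filter.2 ⟨Finset.mem_range.2 (by omega), by rw [zero_add]; omega⟩
  · intro h
    have := (Finset.mem_filter.1 h).2
    rw [show 2 * (n - s * t) - 1 + 1 = 2 * (n - s * t) by omega] at this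
    omega

theorem isSeparated_linePath (hs : 0 < s) (hK : s * K ≤ n) (hD : 2 * D ≤ s)
    {x : State (combBoundary n K s)} (hx : x ∈ separatedStates n K s D) :
    IsSeparated n s D fun t : Fin K => linePath n s x.1 t where
  spacing_pos := hs
  fits := hK
  spacing := hD
  mem t := mem_narrowPaths.2 ⟨linePath_mem_diagonalPaths hs hK x t.2, fun σ hσ => by
    rw [eastSteps_linePath hs hK x t.2 hσ]
    exact hx t t.2 σ hσ⟩

/-- Lines determine the counts below all faces, hence the heights and the state. With
`IsSeparated.eq_of_state_eq`, this makes separated states correspond bijectively to families of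
narrow paths. -/
theorem state_linePath (hs : 0 < s) (hK : s * K ≤ n) (hD : 2 * D ≤ s)
    {x : State (combBoundary n K s)} (hx : x ∈ separatedStates n K s D) :
    (isSeparated_linePath hs hK hD hx).state = x := by
  have hp := isSeparated_linePath hs hK hD hx
  refine Subtype.ext (Orientation.eq_of_height_eq hp.state.2.1 x.2.1 fun i j hi hj => ?_)
  rw [height_eq_belowCount _ hi, height_eq_belowCount _ hi, Nat.cast_inj]
  have key : ∀ t : Fin K, (t : ℕ) < hp.state.1.belowCount i j ↔ (t : ℕ) < x.1.belowCount i j := by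
    intro t
    rw [hp.belowCount_state hi hj, hp.lt_pathHeight_iff, lt_belowCount_iff hs hK x t.2]
    rcases le_total (i + j - s * t) (2 * (n - s * t)) with h | h
    · rw [eastSteps_linePath hs hK x t.2 h]
    · rw [eastSteps_of_last_le (hp.diag t) (by omega), lineEast_of_le hs hK x t.2 (by omega)]
  have h₁ := belowCount_le hs hp.state i j
  have h₂ := belowCount_le hs x i j
  exact le_antisymm (le_of_forall_lt fun t ht => (key ⟨t, by omega⟩).1 ht)
    (le_of_forall_lt fun t ht => (key ⟨t, by omega⟩).2 ht)

theorem IsSeparated.state_mem {p : Fin K → Finset ℕ} (hp : IsSeparated n s D p) :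
    hp.state ∈ separatedStates n K s D := by
  intro t ht σ hσ
  rw [hp.lineEast_state ⟨t, ht⟩ σ]
  exact hp.narrow ⟨t, ht⟩ σ hσ

/-- Just before leaving the set of separated states, some line is far from its diagonal. -/
theorem exists_not_isNarrow_of_mem_innerBoundary (hs : 0 < s) (hK : s * K ≤ n)
    {x : State (combBoundary n K s)} (hx : x ∈ innerBoundary (separatedStates n K s D)) :
    ∃ t : Fin K, ¬IsNarrow (n - s * t) ((D : ℤ) - 2) (linePath n s x.1 t) := by
  obtain ⟨-, q, hq, hflip⟩ := hx
  simp only [separatedStates, Set.mem_ofPred_eq, not_forall, not_lt] at hflip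
  obtain ⟨t, ht, σ, hσ, hdev⟩ := hflip
  refine ⟨⟨t, ht⟩, fun hn => ?_⟩
  have h₁ := hn σ hσ
  -- A change of one in the number of east steps changes the deviation by two, hence the bound D -
  -- 2.
  have h₂ := lineEast_flip hs x hq t σ
  rw [eastSteps_linePath hs hK x ht hσ] at h₁
  rw [abs_lt] at h₁
  rcases le_abs'.1 hdev with h | h <;> omega

end LinePath

/-! ### Factorization of the weight over the lines -/

/-- The contribution of a line with starting row `R` to the weight of the vertex `(i, j)`. -/
def lineFactor (β γ : ℝ) (R : ℕ) (A : Finset ℕ) (i j : ℕ) : ℝ :=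
  if eastSteps A (i + j + 1 - R) = i + 1 then turnWeight β γ A (i + j - R) else 1

theorem prod_lineFactor (β γ : ℝ) {n R : ℕ} (hR : R < n) {A : Finset ℕ}
    (hA : A ∈ diagonalPaths (n - R)) :
    ∏ i ∈ Finset.range n, ∏ j ∈ Finset.range n, lineFactor β γ R A i j =
      pathWeight β γ (2 * (n - R) - 1) A := by
  rw [← Finset.prod_product']
  simp only [lineFactor]
  rw [← Finset.prod_filter, pathWeight]
  -- After k + 1 steps with e of them east, the line is at the vertex (e - 1, R + k + 1 - e). This
  -- enumerates the vertices on the path by k.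
  refine Finset.prod_bij' (fun q _ => q.1 + q.2 - R)
    (fun k _ => (eastSteps A (k + 1) - 1, R + k + 1 - eastSteps A (k + 1))) ?_ ?_ ?_ ?_ ?_
  · rintro ⟨i, j⟩ hq
    simp only [Finset.mem_filter, Finset.mem_product, Finset.mem_range] at hq ⊢
    by_contra! hle
    rw [eastSteps_of_last_le hA (by omega)] at hq
    omega
  · intro k hk
    have hk := Finset.mem_range.1 hk
    have h₁ := one_le_eastSteps hA (show 1 ≤ k + 1 by omega)
    have h₂ := eastSteps_le_half hA (k + 1)
    have h₃ := le_eastSteps_add hA (show 0 < n - R by omega) (show k + 1 ≤ 2 * (n - R) - 1 by omega)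
    have h₄ := eastSteps_le A (k + 1)
    simp only [Finset.mem_filter, Finset.mem_product, Finset.mem_range]
    rw [show eastSteps A (k + 1) - 1 + (R + k + 1 - eastSteps A (k + 1)) + 1 - R = k + 1 by omega]
    omega
  · rintro ⟨i, j⟩ hq
    simp only [Finset.mem_filter, Finset.mem_product, Finset.mem_range] at hq
    have h₀ : R < i + j + 1 := by
      by_contra! hle
      rw [Nat.sub_eq_zero_of_le hle, eastSteps_zero] at hq
      omega
    rw [show i + j - R + 1 = i + j + 1 - R by omega, hq.2, Prod.mk.injEq]
    omega
  · intro k hk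
    have h₁ := one_le_eastSteps hA (show 1 ≤ k + 1 by omega)
    have h₄ := eastSteps_le A (k + 1)
    simp only
    omega
  · intro q _
    rfl

namespace IsSeparated

variable {K n s D : ℕ} {p : Fin K → Finset ℕ} (hp : IsSeparated n s D p)

include hp in
-- At most one line visits a vertex. Without a visitor all four edges are negative and the weight is
-- `a`; with one, the horizontal and vertical edges record its incoming and outgoing steps, giving b
-- for a straight passage and c for a turn.
theorem vertexWeight_eq {a b c : ℝ} (ha : 0 < a) {i j : ℕ} (hi : i < n) (hj : j < n) :
    vertexWeight a b c (hp.state.1.horN i j) (hp.state.1.horN (i + 1) j) (hp.state.1.verN i j)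
      (hp.state.1.verN i (j + 1)) =
    a * ∏ t : Fin K, lineFactor (b / a) (c / a) (s * t) (p t) i j := by
  have visit_le : ∀ {t : Fin K}, eastSteps (p t) (i + j + 1 - s * t) = i + 1 → s * t ≤ i + j := by
    intro t h
    by_contra! hle
    rw [Nat.sub_eq_zero_of_le hle, eastSteps_zero] at h
    omega
  have step : ∀ {t : Fin K}, s * t ≤ i + j → eastSteps (p t) (i + j + 1 - s * t) =
      eastSteps (p t) (i + j - s * t) + if i + j - s * t ∈ p t then 1 else 0 := by
    intro t h
    rw [show i + j + 1 - s * t = i + j - s * t + 1 by omega, eastSteps_succ]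
  have step' : ∀ {t : Fin K}, s * t ≤ i + j → eastSteps (p t) (i + 1 + (j + 1) - s * t) =
      eastSteps (p t) (i + j + 1 - s * t) + if i + j + 1 - s * t ∈ p t then 1 else 0 := by
    intro t h
    rw [show i + 1 + (j + 1) - s * t = i + j + 1 - s * t + 1 by omega, eastSteps_succ]
  have hL : hp.state.1.horN i j = true ↔
      ∃ t, eastSteps (p t) (i + j + 1 - s * t) = i + 1 ∧ i + j - s * t ∈ p t := by
    rw [state, horN_ofHeight hi.le hj, decide_eq_true_iff, pathHeight_lt_up_iff]
    constructor
    · rintro ⟨t, h₁, h₂⟩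
      exact ⟨t, (east_of_lt h₁ h₂).2.2.1, (east_of_lt h₁ h₂).2.1⟩
    · rintro ⟨t, h₁, h₂⟩
      have e := step (visit_le h₁)
      rw [if_pos h₂] at e
      refine ⟨t, ?_, by omega⟩
      rw [show i + (j + 1) - s * t = i + j + 1 - s * t by omega]
      omega
  have hD : hp.state.1.verN i j = true ↔
      ∃ t, eastSteps (p t) (i + j + 1 - s * t) = i + 1 ∧ i + j - s * t ∉ p t := by
    rw [state, verN_ofHeight hi hj.le, decide_eq_true_iff, pathHeight_lt_left_iff]
    constructor
    · rintro ⟨t, h₁, h₂⟩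
      exact ⟨t, (north_of_lt h₁ h₂).2.2.1, (north_of_lt h₁ h₂).2.1⟩
    · rintro ⟨t, h₁, h₂⟩
      have e := step (visit_le h₁)
      rw [if_neg h₂] at e
      refine ⟨t, by omega, ?_⟩
      rw [show i + 1 + j - s * t = i + j + 1 - s * t by omega]
      omega
  have hR : hp.state.1.horN (i + 1) j = true ↔
      ∃ t, eastSteps (p t) (i + j + 1 - s * t) = i + 1 ∧ i + j + 1 - s * t ∈ p t := by
    rw [state, horN_ofHeight (i := i + 1) hi hj, decide_eq_true_iff, pathHeight_lt_up_iff]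
    constructor
    · rintro ⟨t, h₁, h₂⟩
      have e := east_of_lt h₁ h₂
      rw [show i + 1 + j - s * t = i + j + 1 - s * t by omega] at e
      exact ⟨t, e.2.2.2, e.2.1⟩
    · rintro ⟨t, h₁, h₂⟩
      have e := step' (visit_le h₁)
      rw [if_pos h₂] at e
      refine ⟨t, by omega, ?_⟩
      rw [show i + 1 + j - s * t = i + j + 1 - s * t by omega]
      omega
  have hU : hp.state.1.verN i (j + 1) = true ↔
      ∃ t, eastSteps (p t) (i + j + 1 - s * t) = i + 1 ∧ i + j + 1 - s * t ∉ p t := by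
    rw [state, verN_ofHeight (j := j + 1) hi hj, decide_eq_true_iff, pathHeight_lt_left_iff]
    constructor
    · rintro ⟨t, h₁, h₂⟩
      have e := north_of_lt h₁ h₂
      rw [show i + (j + 1) - s * t = i + j + 1 - s * t by omega] at e
      exact ⟨t, e.2.2.2, e.2.1⟩
    · rintro ⟨t, h₁, h₂⟩
      have e := step' (visit_le h₁)
      rw [if_neg h₂] at e
      refine ⟨t, ?_, by omega⟩
      rw [show i + (j + 1) - s * t = i + j + 1 - s * t by omega]
      omega
  by_cases hv : ∃ t, eastSteps (p t) (i + j + 1 - s * t) = i + 1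
  · obtain ⟨t₀, ht₀⟩ := hv
    have huniq : ∀ {t}, eastSteps (p t) (i + j + 1 - s * t) = i + 1 → t = t₀ :=
      fun h => hp.eq_of_visit hj h ht₀
    have hex : ∀ q : Fin K → Prop,
        (∃ t, eastSteps (p t) (i + j + 1 - s * t) = i + 1 ∧ q t) ↔ q t₀ := by
      refine fun q => ⟨?_, fun h => ⟨t₀, ht₀, h⟩⟩
      rintro ⟨t, h₁, h₂⟩
      exact huniq h₁ ▸ h₂
    rw [hex] at hL hD hR hU
    have hprod : ∏ t : Fin K, lineFactor (b / a) (c / a) (s * t) (p t) i j =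
        turnWeight (b / a) (c / a) (p t₀) (i + j - s * t₀) :=
      (Finset.prod_eq_single t₀ (fun t _ ht => if_neg fun h => ht (huniq h)) (by simp)).trans
        (if_pos ht₀)
    have hle := visit_le ht₀
    rw [hprod, turnWeight, show i + j - s * t₀ + 1 = i + j + 1 - s * t₀ by omega]
    have bL : hp.state.1.horN i j = decide (i + j - s * t₀ ∈ p t₀) := by
      rw [Bool.eq_iff_iff, hL, decide_eq_true_iff]
    have bD : hp.state.1.verN i j = decide (i + j - s * t₀ ∉ p t₀) := by
      rw [Bool.eq_iff_iff, hD, decide_eq_true_iff]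
    have bR : hp.state.1.horN (i + 1) j = decide (i + j + 1 - s * t₀ ∈ p t₀) := by
      rw [Bool.eq_iff_iff, hR, decide_eq_true_iff]
    have bU : hp.state.1.verN i (j + 1) = decide (i + j + 1 - s * t₀ ∉ p t₀) := by
      rw [Bool.eq_iff_iff, hU, decide_eq_true_iff]
    rw [bL, bD, bR, bU]
    by_cases h₁ : i + j - s * t₀ ∈ p t₀ <;> by_cases h₂ : i + j + 1 - s * t₀ ∈ p t₀ <;>
      simp [h₁, h₂, vertexWeight, mul_div_cancel₀ _ ha.ne']
  · have hn : ∀ q : Fin K → Prop,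
        ¬∃ t, eastSteps (p t) (i + j + 1 - s * t) = i + 1 ∧ q t := by
      rintro q ⟨t, h, -⟩
      exact hv ⟨t, h⟩
    simp only [hn, iff_false, Bool.not_eq_true] at hL hD hR hU
    have hprod : ∏ t : Fin K, lineFactor (b / a) (c / a) (s * t) (p t) i j = 1 :=
      Finset.prod_eq_one fun t _ => if_neg fun h => hv ⟨t, h⟩
    rw [hL, hD, hR, hU, hprod, mul_one]
    rfl

include hp in
theorem weight_state {a b c : ℝ} (ha : 0 < a) : weight a b c hp.state.1 =
    a ^ (n * n) * ∏ t : Fin K, pathWeight (b / a) (c / a) (2 * (n - s * t) - 1) (p t) := by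
  have h : weight a b c hp.state.1 = ∏ i : Fin n, ∏ j : Fin n,
      (a * ∏ t : Fin K, lineFactor (b / a) (c / a) (s * t) (p t) i j) := by
    rw [weight_eq]
    exact Finset.prod_congr rfl fun i _ => Finset.prod_congr rfl fun j _ =>
      hp.vertexWeight_eq ha i.2 j.2
  rw [h]
  simp only [Finset.prod_mul_distrib, Finset.prod_const, Finset.card_univ, Fintype.card_fin,
    ← pow_mul]
  congr 1
  rw [Finset.prod_congr rfl fun i _ => Finset.prod_comm, Finset.prod_comm]
  refine Finset.prod_congr rfl fun t _ => ?_
  rw [← prod_lineFactor _ _ (hp.mul_lt t) (hp.diag t),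
    ← Fin.prod_univ_eq_prod_range (fun i => ∏ j ∈ Finset.range n,
      lineFactor (b / a) (c / a) (s * t) (p t) i j)]
  refine Finset.prod_congr rfl fun i _ => ?_
  rw [← Fin.prod_univ_eq_prod_range]

end IsSeparated

open Classical in
/-- The weights of the separated states factor over the lines. -/
theorem sum_separatedStates {a b c : ℝ} (ha : 0 < a) {n K s D : ℕ} (hs : 0 < s)
    (hK : s * K ≤ n) (hD : 2 * D ≤ s) (Q : Fin K → Finset ℕ → Prop) :
    ∑ x : State (combBoundary n K s) with
        x ∈ separatedStates n K s D ∧ ∀ t : Fin K, Q t (linePath n s x.1 t),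
      weight a b c x.1 =
    a ^ (n * n) * ∏ t : Fin K, ∑ A ∈ narrowPaths (n - s * t) D with Q t A,
      pathWeight (b / a) (c / a) (2 * (n - s * t) - 1) A := by
  rw [Finset.prod_univ_sum, Finset.mul_sum]
  have hsep : ∀ {p : Fin K → Finset ℕ},
      p ∈ Fintype.piFinset (fun t : Fin K => {A ∈ narrowPaths (n - s * t) D | Q t A}) →
      IsSeparated n s D p := fun hp =>
    ⟨hs, hK, hD, fun t => (Finset.mem_filter.1 (Fintype.mem_piFinset.1 hp t)).1⟩
  refine Finset.sum_bij (fun x _ => fun t : Fin K => linePath n s x.1 t) ?_ ?_ ?_ ?_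
  · intro x hx
    obtain ⟨hx, hQ⟩ := (Finset.mem_filter.1 hx).2
    exact Fintype.mem_piFinset.2 fun t => Finset.mem_filter.2
      ⟨(isSeparated_linePath hs hK hD hx).mem t, hQ t⟩
  · intro x hx y hy hxy
    have hx := (Finset.mem_filter.1 hx).2.1
    have hy := (Finset.mem_filter.1 hy).2.1
    rw [← state_linePath hs hK hD hx, ← state_linePath hs hK hD hy]
    congr 1
  · intro p hp
    have hp' := hsep hp
    have he : (fun t : Fin K => linePath n s hp'.state.1 t) = p :=
      (isSeparated_linePath hs hK hD hp'.state_mem).eq_of_state_eq hp'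
        (state_linePath hs hK hD hp'.state_mem)
    refine ⟨hp'.state, Finset.mem_filter.2 ⟨Finset.mem_univ _, hp'.state_mem, fun t => ?_⟩, he⟩
    rw [congrFun he t]
    exact (Finset.mem_filter.1 (Fintype.mem_piFinset.1 hp t)).2
  · intro x hx
    have hx := (Finset.mem_filter.1 hx).2.1
    rw [← (isSeparated_linePath hs hK hD hx).weight_state ha, state_linePath hs hK hD hx]

/-! ### The bottleneck criterion -/

open Classical in
/-- If each line is unlikely to come close to the boundary of its neighbourhood of the diagonal,
and if the separated states weigh less than some other state, then they form a bottleneck. -/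
theorem hasBottleneck_combBoundary {a b c : ℝ} (ha : 0 < a) (hb : 0 < b) (hc : 0 < c)
    {n K s D : ℕ} (hs : 0 < s) (hK : s * K ≤ n) (hD : 2 * D ≤ s) {ε : ℝ} (hε : 0 ≤ ε)
    (hpos : ∀ t : Fin K, 0 < ∑ A ∈ narrowPaths (n - s * t) D,
      pathWeight (b / a) (c / a) (2 * (n - s * t) - 1) A)
    (hdev : ∀ t : Fin K, K * ∑ A ∈ narrowPaths (n - s * t) D with
        ¬IsNarrow (n - s * t) ((D : ℤ) - 2) A,
      pathWeight (b / a) (c / a) (2 * (n - s * t) - 1) A ≤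
      ε * ∑ A ∈ narrowPaths (n - s * t) D,
        pathWeight (b / a) (c / a) (2 * (n - s * t) - 1) A)
    {y : State (combBoundary n K s)} (hy : y ∉ separatedStates n K s D)
    (hweight : a ^ (n * n) * ∏ t : Fin K, ∑ A ∈ narrowPaths (n - s * t) D,
      pathWeight (b / a) (c / a) (2 * (n - s * t) - 1) A ≤ weight a b c y.1) :
    HasBottleneck a b c (combBoundary n K s) ε := by
  let S := separatedStates n K s D
  let Z : Fin K → ℝ := fun t => ∑ A ∈ narrowPaths (n - s * t) D,
    pathWeight (b / a) (c / a) (2 * (n - s * t) - 1) A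
  have hfin : ∀ T : Set (State (combBoundary n K s)), ∑ᶠ x ∈ T, weight a b c x.1 =
      ∑ x with x ∈ T, weight a b c x.1 := fun T => by
    rw [← finsum_mem_coe_finset]
    simp
  have hw := fun x : State (combBoundary n K s) => (weight_pos ha hb hc x).le
  have hS : ∑ᶠ x ∈ S, weight a b c x.1 = a ^ (n * n) * ∏ t, Z t := by
    rw [hfin]
    have := sum_separatedStates (b := b) (c := c) ha hs hK hD fun _ _ => True
    simpa using this
  have hne : S.Nonempty := by
    by_contra h
    rw [Set.not_nonempty_iff_eq_empty] at h
    rw [h, finsum_mem_empty] at hS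
    have : 0 < a ^ (n * n) * ∏ t, Z t :=
      mul_pos (pow_pos ha _) (Finset.prod_pos fun t _ => hpos t)
    linarith
  have hbound : ∑ᶠ x ∈ innerBoundary S, weight a b c x.1 ≤ ε * ∑ᶠ x ∈ S, weight a b c x.1 := by
    rw [hfin, hS]
    -- Union bound over the deviating line r. The condition constrains r only, so after
    -- factorization the sums of the other lines cancel.
    let Q : Fin K → Fin K → Finset ℕ → Prop := fun r t A =>
      t = r → ¬IsNarrow (n - s * t) ((D : ℤ) - 2) A
    have hcover : Finset.univ.filter (fun x => x ∈ innerBoundary S) ⊆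
        Finset.univ.biUnion fun r : Fin K => Finset.univ.filter fun x =>
          x ∈ S ∧ ∀ t : Fin K, Q r t (linePath n s x.1 t) := by
      intro x hx
      have hx := (Finset.mem_filter.1 hx).2
      obtain ⟨r, hr⟩ := exists_not_isNarrow_of_mem_innerBoundary hs hK hx
      refine Finset.mem_biUnion.2 ⟨r, Finset.mem_univ r, Finset.mem_filter.2
        ⟨Finset.mem_univ x, hx.1, ?_⟩⟩
      rintro t rfl
      exact hr
    refine (Finset.sum_le_sum_of_subset_of_nonneg hcover fun x _ _ => hw x).trans ?_
    refine (sum_biUnion_le_sum _ _ hw).trans ?_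
    have hterm : ∀ r : Fin K, K * ∑ x with x ∈ S ∧ ∀ t : Fin K, Q r t (linePath n s x.1 t),
        weight a b c x.1 ≤ ε * (a ^ (n * n) * ∏ t, Z t) := by
      intro r
      have hsum : ∑ x with x ∈ S ∧ ∀ t : Fin K, Q r t (linePath n s x.1 t), weight a b c x.1 =
          a ^ (n * n) * ∏ t : Fin K, ∑ A ∈ narrowPaths (n - s * t) D with Q r t A,
            pathWeight (b / a) (c / a) (2 * (n - s * t) - 1) A := by
        convert sum_separatedStates (b := b) (c := c) ha hs hK hD (Q r)
      rw [hsum, ← Finset.mul_prod_erase _ _ (Finset.mem_univ r),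
        ← Finset.mul_prod_erase _ Z (Finset.mem_univ r)]
      have h₁ : ∏ t ∈ Finset.univ.erase r, ∑ A ∈ narrowPaths (n - s * t) D with Q r t A,
          pathWeight (b / a) (c / a) (2 * (n - s * t) - 1) A = ∏ t ∈ Finset.univ.erase r, Z t := by
        refine Finset.prod_congr rfl fun t ht => ?_
        rw [Finset.filter_true_of_mem]
        exact fun A _ h => absurd h (Finset.ne_of_mem_erase ht)
      have h₂ : ∑ A ∈ narrowPaths (n - s * r) D with Q r r A,
          pathWeight (b / a) (c / a) (2 * (n - s * r) - 1) A =
          ∑ A ∈ narrowPaths (n - s * r) D with ¬IsNarrow (n - s * r) ((D : ℤ) - 2) A,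
          pathWeight (b / a) (c / a) (2 * (n - s * r) - 1) A := by
        refine Finset.sum_congr (Finset.filter_congr fun A _ => ?_) fun _ _ => rfl
        simp [Q]
      rw [h₁, h₂]
      have hP : 0 ≤ a ^ (n * n) * ∏ t ∈ Finset.univ.erase r, Z t :=
        mul_nonneg (pow_pos ha _).le (Finset.prod_nonneg fun t _ => (hpos t).le)
      have := mul_le_mul_of_nonneg_right (hdev r) hP
      linarith
    rcases Nat.eq_zero_or_pos K with hK0 | hK0
    · subst hK0
      simp only [Finset.univ_eq_empty, Finset.sum_empty]
      exact mul_nonneg hε (mul_nonneg (pow_pos ha _).le (Finset.prod_nonneg fun t _ => (hpos t).le))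
    · have hK0' : (0 : ℝ) < K := by exact_mod_cast hK0
      refine le_of_mul_le_mul_left ?_ hK0'
      rw [Finset.mul_sum]
      refine (Finset.sum_le_sum fun r _ => hterm r).trans (le_of_eq ?_)
      rw [Finset.sum_const, Finset.card_univ, Fintype.card_fin, nsmul_eq_mul]
  refine ⟨S, hne, ⟨y, hy⟩, hbound, hbound.trans (mul_le_mul_of_nonneg_left ?_ hε)⟩
  have hle : ∀ T : Set (State (combBoundary n K s)), y ∈ T →
      weight a b c y.1 ≤ ∑ᶠ x ∈ T, weight a b c x.1 := by
    intro T hT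
    rw [hfin]
    exact Finset.single_le_sum (f := fun x : State (combBoundary n K s) => weight a b c x.1)
      (fun x _ => hw x) (Finset.mem_filter.2 ⟨Finset.mem_univ y, hT⟩)
  rw [hS]
  exact hweight.trans (hle _ hy)

/-! ### The bundled configuration -/

section Bundle

variable {n K s : ℕ}

/-- The hypothesis says that exactly one of the two edges entering from the left and below is
positive. Away from the two ends of the strip this happens only on its two sides and on the straight
legs. -/
theorem bundleHeight_cases (hs : 0 < s) {i j : ℕ} (hi : i < n)
    (h : bundleHeight n K s i (j + 1) = bundleHeight n K s (i + 1) j + 1) :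
    i = j ∨ i = j + K ∨ (i < j ∧ ∃ t < K, s * t = j) ∨ (i < j ∧ ∃ t < K, s * t = n - (i + 1)) ∨
      (j ≤ i ∧ i ≤ j + K ∧ j < s * K) ∨ (j ≤ i ∧ i ≤ j + K ∧ n - (i + 1) < s * K) := by
  have hn : n - (i + 1) + 1 = n - i := by omega
  have m₁ := combCount_mono (K := K) (s := s) (Nat.le_succ j)
  have m₂ := combCount_mono (K := K) (s := s) (Nat.le_succ (n - (i + 1)))
  have q₁ := combCount_succ_le (K := K) hs j
  have q₂ := combCount_succ_le (K := K) hs (n - (i + 1))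
  have k₁ := combCount_le (K := K) (s := s) (j + 1)
  have k₂ := combCount_le (K := K) (s := s) (n - i)
  simp only [Nat.succ_eq_add_one, hn] at m₁ m₂ q₂
  unfold bundleHeight at h
  rcases lt_or_ge i j with hij | hij
  · have hc : combCount K s j < combCount K s (j + 1) ∨
        combCount K s (n - (i + 1)) < combCount K s (n - (i + 1) + 1) := by
      rw [hn]
      omega
    rcases hc with hc | hc
    · exact Or.inr (Or.inr (Or.inl ⟨hij, (combCount_lt_succ_iff hs _).1 hc⟩))
    · exact Or.inr (Or.inr (Or.inr (Or.inl ⟨hij, (combCount_lt_succ_iff hs _).1 hc⟩)))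
  · have hle : i ≤ j + K := by omega
    rcases lt_or_ge j (s * K) with h₁ | h₁
    · exact Or.inr (Or.inr (Or.inr (Or.inr (Or.inl ⟨hij, hle, h₁⟩))))
    rcases lt_or_ge (n - (i + 1)) (s * K) with h₂ | h₂
    · exact Or.inr (Or.inr (Or.inr (Or.inr (Or.inr ⟨hij, hle, h₂⟩))))
    have u₁ := combCount_eq h₁ hs
    have u₂ := combCount_eq h₂ hs
    have hc : i = j ∨ i = j + K := by omega
    rcases hc with hc | hc
    · exact Or.inl hc
    · exact Or.inr (Or.inl hc)

/-- The sides of the strip contribute n each, the two families of legs K(sK) each, and the two ends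
of the strip (K + 1)(sK) each. -/
theorem card_bundleHeight_le (hs : 0 < s) :
    ((Finset.range n ×ˢ Finset.range n).filter fun q : ℕ × ℕ =>
      bundleHeight n K s q.1 (q.2 + 1) = bundleHeight n K s (q.1 + 1) q.2 + 1).card ≤
      2 * n + (4 * K + 2) * (s * K) := by
  have hsub : ((Finset.range n ×ˢ Finset.range n).filter fun q : ℕ × ℕ =>
      bundleHeight n K s q.1 (q.2 + 1) = bundleHeight n K s (q.1 + 1) q.2 + 1) ⊆
      (Finset.range n).image (fun i => (i, i)) ∪
      ((Finset.range n).image (fun j => (j + K, j)) ∪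
      ((Finset.range K ×ˢ Finset.range (s * K)).image (fun r : ℕ × ℕ => (r.2, s * r.1)) ∪
      ((Finset.range K ×ˢ Finset.range (s * K)).image
        (fun r : ℕ × ℕ => (n - (s * r.1 + 1), n - (r.2 + 1))) ∪
      ((Finset.range (K + 1) ×ˢ Finset.range (s * K)).image (fun r : ℕ × ℕ => (r.2 + r.1, r.2)) ∪
      (Finset.range (K + 1) ×ˢ Finset.range (s * K)).image
        (fun r : ℕ × ℕ => (n - (r.2 + 1), n - (r.2 + 1) - r.1)))))) := by
    rintro ⟨i, j⟩ hq
    simp only [Finset.mem_filter, Finset.mem_product, Finset.mem_range] at hq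
    obtain ⟨⟨hi, hj⟩, hq⟩ := hq
    simp only [Finset.mem_union, Finset.mem_image, Finset.mem_product, Finset.mem_range,
      Prod.exists, Prod.mk.injEq]
    rcases bundleHeight_cases hs hi hq with h | h | ⟨h, t, ht, he⟩ | ⟨h, t, ht, he⟩ |
      ⟨h₁, h₂, h₃⟩ | ⟨h₁, h₂, h₃⟩
    · exact Or.inl ⟨i, hi, rfl, h⟩
    · exact Or.inr (Or.inl ⟨j, hj, h.symm, rfl⟩)
    · have := Nat.mul_lt_mul_of_pos_left ht hs
      exact Or.inr (Or.inr (Or.inl ⟨t, i, ⟨ht, by omega⟩, rfl, he⟩))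
    · have := Nat.mul_lt_mul_of_pos_left ht hs
      exact Or.inr (Or.inr (Or.inr (Or.inl ⟨t, n - (j + 1), ⟨ht, by omega⟩, by omega, by omega⟩)))
    · exact Or.inr (Or.inr (Or.inr (Or.inr (Or.inl
        ⟨i - j, j, ⟨by omega, h₃⟩, by omega, rfl⟩))))
    · exact Or.inr (Or.inr (Or.inr (Or.inr (Or.inr
        ⟨i - j, n - (i + 1), ⟨by omega, h₃⟩, by omega, by omega⟩))))
  have i₁ : ((Finset.range n).image (fun i => (i, i))).card ≤ n :=
    Finset.card_image_le.trans (Finset.card_range n).le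
  have i₂ : ((Finset.range n).image (fun j => (j + K, j))).card ≤ n :=
    Finset.card_image_le.trans (Finset.card_range n).le
  have i₃ : ∀ (m : ℕ) (f : ℕ × ℕ → ℕ × ℕ),
      ((Finset.range m ×ˢ Finset.range (s * K)).image f).card ≤ m * (s * K) := fun m f =>
    Finset.card_image_le.trans (by rw [Finset.card_product, Finset.card_range, Finset.card_range])
  refine (Finset.card_le_card hsub).trans ?_
  refine (Finset.card_union_le _ _).trans ((add_le_add i₁ ((Finset.card_union_le _ _).trans
    (add_le_add i₂ ((Finset.card_union_le _ _).trans (add_le_add (i₃ _ _)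
      ((Finset.card_union_le _ _).trans (add_le_add (i₃ _ _) ((Finset.card_union_le _ _).trans
        (add_le_add (i₃ _ _) (i₃ _ _)))))))))).trans (le_of_eq ?_))
  ring

theorem le_vertexWeight {a b c μ : ℝ} (ha : 0 < a) (hμb : μ ≤ b / a) (hμc : μ ≤ c / a)
    {l r d u : Bool} (h : l.toNat + d.toNat = r.toNat + u.toNat) :
    a * (if l.toNat + d.toNat = 1 then μ else 1) ≤ vertexWeight a b c l r d u := by
  rw [le_div_iff₀' ha] at hμb hμc
  revert h
  cases l <;> cases r <;> cases d <;> cases u <;> simp [vertexWeight, hμb, hμc]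

theorem le_weight_bundleState {a b c μ : ℝ} (ha : 0 < a) (hμ : 0 < μ) (hμ1 : μ ≤ 1)
    (hμb : μ ≤ b / a) (hμc : μ ≤ c / a) (hs : 0 < s) (hn : (4 * K + 2) * (s * K) ≤ n) :
    a ^ (n * n) * μ ^ (3 * n) ≤ weight a b c (bundleState n K hs).1 := by
  let N : ℕ → ℕ → Prop := fun i j =>
    bundleHeight n K s i (j + 1) = bundleHeight n K s (i + 1) j + 1
  classical
  have hY := isUnitHeight_bundleHeight (n := n) (K := K) hs
  have hE := (Orientation.isEulerian_iff _).1 (bundleState n K hs).2.1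
  have h₁ : ∏ i ∈ Finset.range n, ∏ j ∈ Finset.range n, (a * if N i j then μ else 1) ≤
      weight a b c (bundleState n K hs).1 := by
    rw [weight_eq, ← Fin.prod_univ_eq_prod_range (fun i => ∏ j ∈ Finset.range n,
      (a * if N i j then μ else 1))]
    have hnn : ∀ i j, 0 ≤ a * if N i j then μ else 1 := fun i j => by
      split_ifs <;> positivity
    refine Finset.prod_le_prod (fun i _ => Finset.prod_nonneg fun j _ => hnn i j) fun i _ => ?_
    rw [← Fin.prod_univ_eq_prod_range (fun j => a * if N i j then μ else 1)]
    refine Finset.prod_le_prod (fun j _ => hnn i j) fun j _ => ?_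
    refine le_trans (le_of_eq ?_) (le_vertexWeight ha hμb hμc (hE i j i.2 j.2))
    congr 1
    refine if_congr ?_ rfl rfl
    have e₁ := hY.toNat_horN (i := i) (j := j) i.2.le j.2
    have e₂ := hY.toNat_verN (i := i) (j := j) i.2 j.2.le
    simp only [N, bundleState]
    omega
  refine le_trans ?_ h₁
  simp only [Finset.prod_mul_distrib, Finset.prod_const, Finset.card_range, ← pow_mul]
  refine mul_le_mul_of_nonneg_left ?_ (pow_pos ha _).le
  rw [← Finset.prod_product', ← Finset.prod_filter, Finset.prod_const]
  refine pow_le_pow_of_le_one hμ.le hμ1 ?_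
  have := card_bundleHeight_le (n := n) (K := K) hs
  refine (le_trans (le_of_eq ?_) this).trans (by omega)
  congr

/-- The face (n/2, n/2) has height K, so even the uppermost line passes below it. That line's own
diagonal is shifted up by s(K - 1), which is at least 2D as K ≥ 2. -/
theorem bundleState_notMem (hs : 0 < s) (hK : 2 ≤ K) {D : ℕ} (hD : 2 * D ≤ s)
    (hn : 2 * (s * K) + 2 ≤ n) : bundleState n K hs ∉ separatedStates n K s D := by
  intro h
  have hR : s * (K - 1) + s = s * K := by
    obtain ⟨k, rfl⟩ : ∃ k, K = k + 1 := ⟨K - 1, by omega⟩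
    rw [Nat.add_sub_cancel]; ring
  have hsK : s * 1 ≤ s * (K - 1) := Nat.mul_le_mul_left s (by omega)
  have h₁ := h (K - 1) (by omega) (n / 2 + n / 2 - s * (K - 1)) (by omega)
  have h₂ : n / 2 < lineEast s (bundleState n K hs).1 (K - 1)
      (n / 2 + n / 2 - s * (K - 1)) := by
    rw [← lt_belowCount_iff hs (by omega) _ (by omega)]
    have e := (isUnitHeight_bundleHeight (n := n) (K := K) hs).belowCount_eq
      (fun i _ => by simp [bundleHeight, combCount_zero]) (i := n / 2) (j := n / 2)
      (by omega) (by omega)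
    have u₁ := combCount_eq (K := K) (s := s) (k := n / 2) (by omega) hs
    have u₂ := combCount_eq (K := K) (s := s) (k := n - n / 2) (by omega) hs
    rw [bundleState, e, bundleHeight, u₁, u₂]
    omega
  have h₃ := (abs_lt.1 h₁).2
  omega

end Bundle

/-! ### Asymptotics -/

section LineBounds

variable {β γ : ℝ}

theorem IsNarrow.mono {l : ℕ} {D E : ℤ} {A : Finset ℕ} (h : IsNarrow l D A) (hDE : D ≤ E) :
    IsNarrow l E A := fun σ hσ => (h σ hσ).trans_le hDE

theorem sum_narrowPaths_le (hβ : 0 < β) (hγ : 0 < γ) {l : ℕ} (hl : 0 < l) (D : ℤ) :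
    ∑ A ∈ narrowPaths l D, pathWeight β γ (2 * l - 1) A ≤ (β + γ) ^ (2 * l - 1) := by
  classical
  obtain ⟨p, rfl⟩ : ∃ p, l = p + 1 := ⟨l - 1, by omega⟩
  rw [show 2 * (p + 1) - 1 = 2 * p + 1 by omega]
  refine le_trans ?_ (sum_diagonalPaths_le hβ hγ p)
  exact Finset.sum_le_sum_of_subset_of_nonneg (Finset.filter_subset _ _)
    fun A _ _ => (pathWeight_pos hβ hγ _ A).le

open Classical in
-- One deviation estimate η serves twice: it bounds the paths near the edge of the neighbourhood,
-- and it is what the narrow paths lose compared with all diagonal paths.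
theorem line_bounds (hβ : 0 < β) (hγ : 0 < γ) (hsum : β + γ < 1) {θ : ℝ} (h₀ : 0 ≤ θ)
    (h₁ : θ ≤ 1) (h₂ : β / γ * θ ≤ 1) {l n D : ℕ} (hl : 0 < l) (hln : l ≤ n) (hD : 3 ≤ D)
    {η : ℝ} (hη : 8 * n * Real.exp (2 * (1 + β / γ) * θ + 2 * (1 + (β / γ) ^ 2) * θ ^ 2 * n -
      θ * (D - 2)) ≤ η) :
    ∑ A ∈ narrowPaths l D with ¬IsNarrow l ((D : ℤ) - 2) A, pathWeight β γ (2 * l - 1) A ≤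
        η * (β + γ) ^ (2 * l - 1) ∧
      (min β γ / (n + 1) - η) * (β + γ) ^ (2 * l - 1) ≤
        ∑ A ∈ narrowPaths l D, pathWeight β γ (2 * l - 1) A := by
  obtain ⟨p, rfl⟩ : ∃ p, l = p + 1 := ⟨l - 1, by omega⟩
  rw [show 2 * (p + 1) - 1 = 2 * p + 1 by omega]
  have hW := fun A => (pathWeight_pos hβ hγ (2 * p + 1) A).le
  have hpn : (p : ℝ) + 1 ≤ n := by exact_mod_cast hln
  have hp0 : (0 : ℝ) ≤ p := Nat.cast_nonneg p
  have hlam : 0 < β + γ := by positivity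
  have hdev : ∑ A ∈ diagonalPaths (p + 1) with ¬IsNarrow (p + 1) ((D : ℤ) - 2) A,
      pathWeight β γ (2 * p + 1) A ≤ η * (β + γ) ^ (2 * p + 1) := by
    refine (sum_not_isNarrow_le hβ hγ h₀ h₁ h₂ p (by omega)).trans ?_
    refine mul_le_mul_of_nonneg_right (le_trans ?_ hη) (by positivity)
    push_cast
    have hexp : Real.exp (2 * (1 + β / γ) * θ + (1 + (β / γ) ^ 2) * θ ^ 2 * (2 * p + 1) -
        θ * (D - 2)) ≤ Real.exp (2 * (1 + β / γ) * θ + 2 * (1 + (β / γ) ^ 2) * θ ^ 2 * n -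
        θ * (D - 2)) := by
      rw [Real.exp_le_exp]
      have h : (2 * p + 1 : ℝ) ≤ 2 * n := by linarith
      have := mul_le_mul_of_nonneg_left h (by positivity : 0 ≤ (1 + (β / γ) ^ 2) * θ ^ 2)
      linarith
    have h : (2 * p + 2 : ℝ) * 4 ≤ 8 * n := by linarith
    rw [← mul_assoc]
    exact mul_le_mul h hexp (Real.exp_pos _).le (by positivity)
  constructor
  · refine le_trans (Finset.sum_le_sum_of_subset_of_nonneg ?_ fun A _ _ => hW A) hdev
    exact Finset.filter_subset_filter _ (Finset.filter_subset _ _)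
  · have hsplit := Finset.sum_filter_add_sum_filter_not (diagonalPaths (p + 1))
      (fun A => IsNarrow (p + 1) D A) (pathWeight β γ (2 * p + 1))
    have hle : ∑ A ∈ diagonalPaths (p + 1) with ¬IsNarrow (p + 1) D A,
        pathWeight β γ (2 * p + 1) A ≤ η * (β + γ) ^ (2 * p + 1) := by
      refine le_trans (Finset.sum_le_sum_of_subset_of_nonneg ?_ fun A _ _ => hW A) hdev
      intro A hA
      rw [Finset.mem_filter] at hA ⊢
      exact ⟨hA.1, fun h => hA.2 (h.mono (by omega))⟩
    have hlow := le_sum_diagonalPaths hβ hγ p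
    have hmain : min β γ / (n + 1) * (β + γ) ^ (2 * p + 1) ≤
        min β γ * (β + γ) ^ (2 * p) / (p + 2) := by
      rw [div_mul_eq_mul_div]
      have hmin : 0 < min β γ := lt_min hβ hγ
      refine div_le_div₀ (by positivity) (mul_le_mul_of_nonneg_left ?_ hmin.le) (by positivity)
        (by linarith)
      exact pow_le_pow_of_le_one hlam.le hsum.le (Nat.le_succ _)
    have hdef : ∑ A ∈ narrowPaths (p + 1) D, pathWeight β γ (2 * p + 1) A =
        ∑ A ∈ diagonalPaths (p + 1) with IsNarrow (p + 1) D A, pathWeight β γ (2 * p + 1) A := by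
      rw [narrowPaths]
    rw [hdef, sub_mul]
    linarith

end LineBounds

theorem eventually_mul_exp_le {κ C μ : ℝ} (hκ : 0 < κ) (hC : 0 ≤ C) (hμ : 0 < μ) :
    ∀ᶠ n : ℕ in Filter.atTop, C * (n : ℝ) ^ 2 * Real.exp (√n - κ * n) ≤ μ := by
  have h₁ : Filter.Tendsto (fun n : ℕ => κ / 2 * (n : ℝ)) Filter.atTop Filter.atTop :=
    tendsto_natCast_atTop_atTop.const_mul_atTop (by positivity)
  have h₂ := ((Real.tendsto_pow_mul_exp_neg_atTop_nhds_zero 2).comp h₁).const_mul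
    (C * Real.exp (1 / (2 * κ)) * (2 / κ) ^ 2)
  rw [mul_zero] at h₂
  filter_upwards [h₂.eventually (ge_mem_nhds hμ)] with n hn
  refine le_trans ?_ hn
  simp only [Function.comp_apply]
  -- Completing the square lets half of the decay rate κ absorb the square root.
  have hsqrt : √(n : ℝ) ≤ 1 / (2 * κ) + κ / 2 * n := by
    have hs := Real.sq_sqrt (Nat.cast_nonneg (α := ℝ) n)
    have : 1 / (2 * κ) + κ / 2 * n - √(n : ℝ) = (κ * √(n : ℝ) - 1) ^ 2 / (2 * κ) := by
      field_simp
      nlinarith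
    have h0 : 0 ≤ (κ * √(n : ℝ) - 1) ^ 2 / (2 * κ) := by positivity
    linarith
  have hexp : Real.exp (√n - κ * n) ≤ Real.exp (1 / (2 * κ)) * Real.exp (-(κ / 2 * n)) := by
    rw [← Real.exp_add, Real.exp_le_exp]
    linarith
  calc C * (n : ℝ) ^ 2 * Real.exp (√n - κ * n) ≤
      C * (n : ℝ) ^ 2 * (Real.exp (1 / (2 * κ)) * Real.exp (-(κ / 2 * n))) :=
        mul_le_mul_of_nonneg_left hexp (by positivity)
    _ = _ := by field_simp

open Classical in
theorem eventually_hasBottleneck {a b c : ℝ} (ha : 0 < a) (hb : 0 < b) (hc : 0 < c)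
    (h : b + c < a) : ∃ K L : ℕ, ∀ᶠ n : ℕ in Filter.atTop,
      HasBottleneck a b c (combBoundary n K (n / L)) (Real.exp (-√n) / 4) := by
  have hβ : 0 < b / a := by positivity
  have hγ : 0 < c / a := by positivity
  have hlam : b / a + c / a < 1 := by rw [← add_div, div_lt_one ha]; exact h
  have hμ : 0 < min (b / a) (c / a) := lt_min hβ hγ
  -- K is chosen so that K separate lines over n steps weigh no more than the 3n defects of the
  -- bundle; K ≥ 2 keeps the bundle out of the separated set.
  obtain ⟨K₀, hK₀⟩ := exists_pow_lt_of_lt_one (pow_pos hμ 3) hlam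
  obtain ⟨K, hK2, hKpow⟩ : ∃ K, 2 ≤ K ∧ (b / a + c / a) ^ K ≤ min (b / a) (c / a) ^ 3 :=
    ⟨max K₀ 2, le_max_right _ _,
      (pow_le_pow_of_le_one (by positivity) hlam.le (le_max_left _ _)).trans hK₀.le⟩
  -- With s = n / L, the legs and ends of the bundle have at most (4K + 2)(sK) ≤ n vertices.
  obtain ⟨L, hL⟩ : ∃ L, L = (4 * K + 2) * K := ⟨_, rfl⟩
  have hLpos : 0 < L := by rw [hL]; positivity
  have hLpos' : (0 : ℝ) < L := by exact_mod_cast hLpos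
  set r := b / a / (c / a) with hr
  have hrpos : 0 < r := by positivity
  -- The linear gain is about θn/(2L), since D ≈ n/(2L). The last condition limits the quadratic
  -- loss to half of it, which leaves a decay rate θ/(4L).
  obtain ⟨θ, hθ, hθ1, hθr, hθL⟩ : ∃ θ : ℝ, 0 < θ ∧ θ ≤ 1 ∧ r * θ ≤ 1 ∧
      2 * (1 + r ^ 2) * θ ≤ 1 / (4 * L) := by
    refine ⟨min 1 (min (1 / r) (1 / (4 * L) / (2 * (1 + r ^ 2)))), ?_, min_le_left _ _, ?_, ?_⟩
    · exact lt_min one_pos (lt_min (by positivity) (by positivity))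
    · rw [← le_div_iff₀' hrpos]
      exact (min_le_right _ _).trans (min_le_left _ _)
    · rw [← le_div_iff₀' (by positivity)]
      exact (min_le_right _ _).trans (min_le_right _ _)
  refine ⟨K, L, ?_⟩
  have hev := eventually_mul_exp_le (κ := θ / (4 * L))
    (C := 64 * (K + 1) * Real.exp (2 * (1 + r) * θ + 4 * θ)) (by positivity) (by positivity) hμ
  -- Since n ≥ 6L, the spacing is at least 6 and D at least 3, so D - 2 is positive.
  filter_upwards [hev, Filter.eventually_ge_atTop (6 * L)] with n hn hn6
  set s := n / L with hs
  have hs6 : 6 ≤ s := (Nat.le_div_iff_mul_le hLpos).2 hn6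
  have hsL : (4 * K + 2) * (s * K) ≤ n := by
    have := Nat.div_mul_le_self n L
    calc (4 * K + 2) * (s * K) = s * L := by rw [hL]; ring
      _ ≤ n := this
  have hspos : 0 < s := by omega
  have hsK : 10 * (s * K) ≤ n := le_trans (Nat.mul_le_mul_right _ (by omega)) hsL
  have hsK' : 6 * 2 ≤ s * K := Nat.mul_le_mul hs6 hK2
  have hn0 : 0 < n := by omega
  have hn1 : (1 : ℝ) ≤ n := by exact_mod_cast hn0
  set D := s / 2 with hD
  have hD3 : 3 ≤ D := by omega
  have hDreal : (n : ℝ) / (2 * L) - 4 ≤ (D : ℝ) - 2 := by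
    have h₁ : n < (s + 1) * L := by
      rw [hs]
      rw [mul_comm]; exact Nat.lt_mul_div_succ n hLpos
    have h₂ : s ≤ 2 * D + 1 := by omega
    have h₃ : (n : ℝ) ≤ (2 * D + 2) * L := by
      have : n ≤ (2 * D + 2) * L := h₁.le.trans (Nat.mul_le_mul_right L (by omega))
      exact_mod_cast this
    have h₄ : (n : ℝ) / (2 * L) ≤ D + 1 := by
      rw [div_le_iff₀ (by positivity)]
      linarith
    linarith
  set ε := Real.exp (-√n) / 4 with hε
  have hεpos : 0 < ε := by positivity
  have hε1 : ε ≤ 1 := by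
    have : Real.exp (-√n) ≤ 1 := Real.exp_le_one_iff.2 (neg_nonpos.2 (Real.sqrt_nonneg _))
    rw [hε]
    linarith
  obtain ⟨η, hη⟩ : ∃ η, η = 8 * n * Real.exp (2 * (1 + r) * θ + 2 * (1 + r ^ 2) * θ ^ 2 * n -
    θ * (D - 2)) := ⟨_, rfl⟩
  have hηpos : 0 < η := by rw [hη]; positivity
  -- The factor K + 1 rather than K leaves one η to spare, which pays for the loss in the lower
  -- bound of `line_bounds`.
  have hηε : (K + 1) * (n + 1) * η ≤ ε * min (b / a) (c / a) := by
    have hexp : Real.exp (2 * (1 + r) * θ + 2 * (1 + r ^ 2) * θ ^ 2 * n - θ * (D - 2)) ≤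
        Real.exp (2 * (1 + r) * θ + 4 * θ) * (Real.exp (√n - θ / (4 * L) * n) *
          Real.exp (-√n)) := by
      rw [← Real.exp_add, ← Real.exp_add, Real.exp_le_exp]
      have h₁ := mul_le_mul_of_nonneg_left hDreal hθ.le
      have h₂ := mul_le_mul_of_nonneg_right hθL (by positivity : 0 ≤ θ * n)
      have h₃ : θ * (n / (2 * L)) = 1 / (4 * L) * (θ * n) + θ / (4 * L) * n := by
        field_simp
        ring
      nlinarith
    have hηle : η ≤ 8 * n * (Real.exp (2 * (1 + r) * θ + 4 * θ) *
        (Real.exp (√n - θ / (4 * L) * n) * Real.exp (-√n))) := by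
      rw [hη]
      exact mul_le_mul_of_nonneg_left hexp (by positivity)
    calc (K + 1) * (n + 1) * η ≤ (K + 1) * (2 * n) * (8 * n *
          (Real.exp (2 * (1 + r) * θ + 4 * θ) *
            (Real.exp (√n - θ / (4 * L) * n) * Real.exp (-√n)))) := by
          refine mul_le_mul ?_ hηle hηpos.le (by positivity)
          exact mul_le_mul_of_nonneg_left (by linarith) (by positivity)
      _ = ε * (64 * (K + 1) * Real.exp (2 * (1 + r) * θ + 4 * θ) * n ^ 2 *
            Real.exp (√n - θ / (4 * L) * n)) := by
          rw [hε]; ring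
      _ ≤ ε * min (b / a) (c / a) := mul_le_mul_of_nonneg_left hn hεpos.le
  have hlt : ∀ t : Fin K, s * t < s * K := fun t => Nat.mul_lt_mul_of_pos_left t.2 hspos
  have hbounds := fun t : Fin K => line_bounds hβ hγ hlam hθ.le hθ1 hθr
    (l := n - s * t) (n := n) (D := D) (by have := hlt t; omega) (Nat.sub_le _ _) hD3 hη.ge
  have hgap : (K : ℝ) * η ≤ ε * (min (b / a) (c / a) / (n + 1) - η) := by
    have h₁ : (K + 1) * η ≤ ε * (min (b / a) (c / a) / (n + 1)) := by
      rw [← mul_div_assoc, le_div_iff₀ (by positivity)]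
      linarith
    have h₂ := mul_le_mul_of_nonneg_right hε1 hηpos.le
    linarith
  have hpos : 0 < min (b / a) (c / a) / (n + 1) - η := by
    have : 0 < (K : ℝ) * η := mul_pos (by exact_mod_cast (by omega : 0 < K)) hηpos
    exact pos_of_mul_pos_right (this.trans_le hgap) hεpos.le
  have hζ : ∀ m : ℕ, 0 < (b / a + c / a) ^ m := fun m => by positivity
  refine hasBottleneck_combBoundary ha hb hc hspos (by omega) (by omega) hεpos.le
    (fun t => (mul_pos hpos (hζ _)).trans_le (hbounds t).2) (fun t => ?_)
    (bundleState_notMem hspos hK2 (D := D) (by omega) (by omega)) ?_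
  · have h₁ := mul_le_mul_of_nonneg_left (hbounds t).1 (Nat.cast_nonneg (α := ℝ) K)
    have h₂ := mul_le_mul_of_nonneg_left (hbounds t).2 hεpos.le
    have h₃ := mul_le_mul_of_nonneg_right hgap (hζ (2 * (n - s * t) - 1)).le
    calc _ ≤ _ := h₁
      _ = (K : ℝ) * η * (b / a + c / a) ^ (2 * (n - s * t) - 1) := by ring
      _ ≤ _ := h₃
      _ = ε * ((min (b / a) (c / a) / (n + 1) - η) *
          (b / a + c / a) ^ (2 * (n - s * t) - 1)) := by ring
      _ ≤ _ := h₂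
  · refine le_trans ?_ (le_weight_bundleState ha hμ ((min_le_left _ _).trans ?_)
      (min_le_left _ _) (min_le_right _ _) hspos hsL)
    · refine mul_le_mul_of_nonneg_left ?_ (pow_pos ha _).le
      calc _ ≤ ∏ _t : Fin K, (b / a + c / a) ^ n := by
            refine Finset.prod_le_prod (fun t _ => ?_) fun t _ => ?_
            · exact Finset.sum_nonneg fun A _ => (pathWeight_pos hβ hγ _ A).le
            · have := hlt t
              refine (sum_narrowPaths_le hβ hγ (by omega) _).trans ?_
              exact pow_le_pow_of_le_one (by positivity) hlam.le (by omega)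
        _ = ((b / a + c / a) ^ K) ^ n := by
            rw [Finset.prod_const, Finset.card_univ, Fintype.card_fin, ← pow_mul, ← pow_mul,
              mul_comm]
        _ ≤ (min (b / a) (c / a) ^ 3) ^ n := pow_le_pow_left₀ (by positivity) hKpow n
        _ = _ := (pow_mul _ _ _).symm
    · linarith

/-! ### Reflection of the lattice -/

/-- The mirror image of an orientation under the exchange of left and right. -/
def Orientation.reflect {n : ℕ} (x : Orientation n) : Orientation n where
  hor i j := !x.hor i.rev j
  ver i j := x.ver i.rev j

/-- The mirror image of a boundary condition. -/
def BoundaryCondition.reflect {n : ℕ} (ξ : BoundaryCondition n) : BoundaryCondition n where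
  left j := !ξ.right j
  right j := !ξ.left j
  bottom i := ξ.bottom i.rev
  top i := ξ.top i.rev

section Reflection

variable {n : ℕ} {ξ : BoundaryCondition n}

theorem Orientation.reflect_reflect (x : Orientation n) : x.reflect.reflect = x := by
  simp [Orientation.reflect]

theorem BoundaryCondition.reflect_reflect (ξ : BoundaryCondition n) : ξ.reflect.reflect = ξ := by
  simp [BoundaryCondition.reflect]

theorem Orientation.IsEulerian.reflect {x : Orientation n} (hx : x.IsEulerian) :
    x.reflect.IsEulerian := by
  intro i j
  rw [← hx i.rev j]
  simp only [inDegree, left, right, below, above, Orientation.reflect, Fin.rev_castSucc,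
    Fin.rev_succ, Bool.not_not]
  omega

theorem Orientation.Agrees.reflect {x : Orientation n} (hx : x.Agrees ξ) :
    x.reflect.Agrees ξ.reflect := by
  obtain ⟨h₁, h₂, h₃, h₄⟩ := hx
  refine ⟨fun j => ?_, fun j => ?_, fun i => ?_, fun i => ?_⟩
  · simp [Orientation.reflect, BoundaryCondition.reflect, h₂]
  · simp [Orientation.reflect, BoundaryCondition.reflect, h₁]
  · simp [Orientation.reflect, BoundaryCondition.reflect, h₃]
  · simp [Orientation.reflect, BoundaryCondition.reflect, h₄]

/-- The mirror exchanges east and west and keeps north and south. Horizontal signs flip and vertical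
signs do not, so `a` and `b` trade places and `c` is fixed. -/
theorem weight_reflect (a b c : ℝ) (x : Orientation n) :
    weight a b c x.reflect = weight b a c x := by
  have key : ∀ l r d u : Bool, vertexWeight a b c (!r) (!l) d u = vertexWeight b a c l r d u := by
    intro l r d u
    cases l <;> cases r <;> cases d <;> cases u <;> rfl
  unfold weight
  rw [← Equiv.prod_comp Fin.revPerm]
  refine Finset.prod_congr rfl fun i _ => Finset.prod_congr rfl fun j _ => ?_
  rw [← key]
  simp [Orientation.left, Orientation.right, Orientation.below, Orientation.above,
    Orientation.reflect, Fin.rev_castSucc, Fin.rev_succ]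

/-- The mirror image of a cell. -/
def reflectCell (q : Cell n) : Cell n := (q.1.rev, q.2)

theorem rev_mid (i : Fin (n - 1)) : (mid i).rev = mid i.rev := by
  ext; simp [mid]; omega

theorem rev_lo (i : Fin (n - 1)) : (lo i).rev = hi i.rev := by
  ext; simp [lo, hi]; omega

theorem rev_hi (i : Fin (n - 1)) : (hi i).rev = lo i.rev := by
  ext; simp [lo, hi]; omega

theorem isCycle_reflect {x : Orientation n} {q : Cell n} (h : x.IsCycle q) :
    x.reflect.IsCycle (reflectCell q) := by
  simp only [Orientation.IsCycle, Orientation.reflect, reflectCell, rev_mid, rev_lo, rev_hi,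
    Fin.rev_rev, Bool.not_eq_true', Bool.not_eq_false'] at h ⊢
  tauto

theorem flip_reflect (x : Orientation n) (q : Cell n) :
    (x.flip q).reflect = x.reflect.flip (reflectCell q) := by
  have e : ∀ {m : ℕ} (i k : Fin m), i.rev = k ↔ i = k.rev := fun i k => Fin.rev_eq_iff
  simp only [Orientation.flip, Orientation.reflect, reflectCell, e, rev_mid, rev_lo, rev_hi,
    Orientation.mk.injEq]
  constructor
  · funext i j
    split_ifs with h <;> simp [h]
  · funext i j
    simp only [or_comm]

/-- The mirror image of a state. -/
def State.reflect (x : State ξ) : State ξ.reflect := ⟨x.1.reflect, x.2.1.reflect, x.2.2.reflect⟩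

theorem State.reflect_bijective : Function.Bijective (State.reflect (ξ := ξ)) := by
  constructor
  · intro x y h
    have := congrArg (fun z => Orientation.reflect z.1) h
    simp only [State.reflect, Orientation.reflect_reflect] at this
    exact Subtype.ext this
  · intro y
    refine ⟨⟨y.1.reflect, y.2.1.reflect, ?_⟩, Subtype.ext y.1.reflect_reflect⟩
    have := y.2.2.reflect
    rwa [BoundaryCondition.reflect_reflect] at this

/-- Reflections exchange the weights `a` and `b`. -/
theorem HasBottleneck.reflect {a b c ε : ℝ} (h : HasBottleneck b a c ξ ε) :
    HasBottleneck a b c ξ.reflect ε := by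
  obtain ⟨S, hS, hS', h₁, h₂⟩ := h
  have hinj := State.reflect_bijective (ξ := ξ).1
  have hsum : ∀ T : Set (State ξ), ∑ᶠ y ∈ State.reflect '' T, weight a b c y.1 =
      ∑ᶠ x ∈ T, weight b a c x.1 := fun T => by
    rw [finsum_mem_image hinj.injOn]
    exact finsum_mem_congr rfl fun x _ => weight_reflect a b c x.1
  have hcompl : (State.reflect '' S)ᶜ = State.reflect '' Sᶜ :=
    (Set.image_compl_eq State.reflect_bijective).symm
  have hbd : innerBoundary (State.reflect '' S) = State.reflect '' innerBoundary S := by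
    ext y
    constructor
    · rintro ⟨⟨x, hx, rfl⟩, q, hq, hout⟩
      refine ⟨x, ⟨hx, reflectCell q, ?_⟩, rfl⟩
      have hq' := isCycle_reflect hq
      simp only [State.reflect, Orientation.reflect_reflect] at hq'
      refine ⟨hq', fun hmem => hout ⟨_, hmem, Subtype.ext ?_⟩⟩
      simp only [State.reflect, State.flip, flip_reflect]
      simp [reflectCell]
    · rintro ⟨x, ⟨hx, q, hq, hout⟩, rfl⟩
      refine ⟨⟨x, hx, rfl⟩, reflectCell q, isCycle_reflect hq, ?_⟩
      rintro ⟨z, hz, he⟩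
      refine hout ?_
      have : z = x.flip hq := by
        refine hinj (he.trans (Subtype.ext ?_))
        simp only [State.reflect, State.flip, flip_reflect]
      rwa [← this]
  refine ⟨State.reflect '' S, hS.image _, ?_, ?_, ?_⟩
  · rw [hcompl]; exact hS'.image _
  · rwa [hbd, hsum, hsum]
  · rwa [hcompl, hbd, hsum, hsum]

end Reflection

end SixVertex

/-! ### Conclusion -/

/-- For all weights in the ferroelectric phase there are boundary conditions under which Glauber
dynamics is an ergodic chain (some power of its transition matrix is positive) with mixing time
`Ω(exp(n ^ δ))` for some `δ > 0`. -/
theorem theorem1 (a b c : ℝ) (ha : 0 < a) (hb : 0 < b) (hc : 0 < c)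
    (hferro : a > b + c ∨ b > a + c) :
    ∃ ξ : (n : ℕ) → SixVertex.BoundaryCondition n,
      ∃ δ : ℝ, 0 < δ ∧ ∃ C : ℝ, 0 < C ∧ ∃ N : ℕ, ∀ n : ℕ, N ≤ n →
        Nonempty (SixVertex.State (ξ n)) ∧
        (SixVertex.glauber a b c (ξ n)).IsPrimitive ∧
        ENNReal.ofReal (C * Real.exp ((n : ℝ) ^ δ)) ≤
          ((mixingTime (SixVertex.glauber a b c (ξ n)) (SixVertex.gibbs a b c (ξ n)) : ℕ∞) :
            ℝ≥0∞) := by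
  obtain ⟨ξ, hξ⟩ : ∃ ξ : (n : ℕ) → SixVertex.BoundaryCondition n, ∀ᶠ n : ℕ in Filter.atTop,
      SixVertex.HasBottleneck a b c (ξ n) (Real.exp (-√n) / 4) := by
    rcases hferro with h | h
    · obtain ⟨K, L, hKL⟩ := SixVertex.eventually_hasBottleneck ha hb hc h
      exact ⟨_, hKL⟩
    · obtain ⟨K, L, hKL⟩ := SixVertex.eventually_hasBottleneck hb ha hc h
      exact ⟨fun n => (SixVertex.combBoundary n K (n / L)).reflect, hKL.mono fun n hn => hn.reflect⟩
  obtain ⟨N, hN⟩ := Filter.eventually_atTop.1 hξ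
  -- With ε = exp(-√n)/4 the bound 1/(4ε) is exactly exp(√n), hence δ = 1/2 and C = 1. Primitivity
  -- needs n ≥ 3.
  refine ⟨ξ, 1 / 2, by norm_num, 1, one_pos, max N 3, fun n hn => ?_⟩
  have h := hN n ((le_max_left _ _).trans hn)
  have hne : Nonempty (SixVertex.State (ξ n)) := by
    obtain ⟨S, ⟨x, -⟩, -⟩ := h
    exact ⟨x⟩
  refine ⟨hne, SixVertex.glauber_isPrimitive ha hb hc ((le_max_right _ _).trans hn), ?_⟩
  refine le_trans (le_of_eq ?_) (h.le_mixingTime ha hb hc (by positivity))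
  congr 1
  rw [← Real.sqrt_eq_rpow, Real.exp_neg]
  field_simp
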